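/- Setting. Let $V$ be a finite set with at least two points and let $Q$ be a continuous-time Markov chain on $V$ with transition rates $q(x,y)\ge 0$ ($x\ne y$) and path laws $(\mathbb P_x)_{x\in V}$. Assume that $Q$ is mixing: it has a unique stationary measure $\pi$, and for every $\alpha\in(0,1)$ there is a $T\ge0$ with $\max_x d_{TV}(\mathbb P_x(X_T\in\cdot),\pi)\le\alpha$; the smallest such $T$ is $T_{mix}(\alpha)$, and $T_{mix}=T_{mix}(1/4)$. For $k\ge2$ and a probability measure $\lambda$ on $V^k$, let $\mathbb P_\lambda$ be the law of $k$ trajectories $X(1),\dots,X(k)$ of $Q$ whose vector of initial states has law $\lambda$ and which are independent given the initial states, and let $$M^{(k)}=\inf\{t\ge0:\ \exists\, i<j,\ X_t(i)=X_t(j)\}.$$ Let $m=\mathbb E_{\pi\otimes\pi}[M^{(2)}]$, $q_{\max}=\max_x\sum_{y\ne x}q(x,y)$, $\pi_{\max}=\max_x\pi(x)$. Put $$\rho=\frac{T_{mix}}{m}\ \text{ if $Q$ is reversible and transitive},\qquad \rho=(1+q_{\max}T_{mix})\,\pi_{\max}\ \text{ otherwise,}$$ where transitive means that for all $x,y$ some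 permutation of $V$ preserves the rates and maps $x$ to $y$. For constants $c_0,c_1>0$ put $\mathrm{err}=c\sqrt{\rho\ln(1/\rho)}$, where $c=c_0$ if $Q$ is reversible and transitive, and $c=c_1$ otherwise. For $\mu>0$, $\alpha>0$, $\beta\in(0,1)$, a random variable $Z\ge0$ is said to be $\mathrm{Exp}(\mu,\alpha,\beta)$ if for all $t>0$ $$(1-\alpha)\,e^{-t/((1-\beta)\mu)}\le\mathbb P(Z\ge t)\le(1+\alpha)\,e^{-t/((1+\beta)\mu)} .$$ Lemma. For every $s<1$ there are constants $c_0,c_1,C,\xi>0$, depending only on $s$, such that the following holds for every $V$ and $Q$ as above with $\rho\le s$. Let $k\ge2$ and $\ell=\binom k2$, and suppose that $\mathrm{err}\le 1/(10\ell)$. Then for every probability measure $\lambda$ on $V^k$, writing $r=\mathbb P_\lambda\big(M^{(k)}\le T_{mix}(\mathrm{err}^2)\big)$, there are real numbers $a,b$ that are $O(k^2\,\mathrm{err})$, in the sense that $$k^2\,\mathrm{err}\le\xi\ \Longrightarrow\ |a|\le C\,k^2\,\mathrm{err}\ \text{ and }\ |b|\le C\,k^2\,\mathrm{err},$$ such that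 under $\mathbb P_\lambda$ $$M^{(k)}\ \text{ is }\ \mathrm{Exp}\Big(\frac m\ell,\ a+2r,\ b\Big)$$ (in particular $m>0$, $a+2r>0$, $0<b<1$, and $M^{(k)}<\infty$ almost surely). Moreover the mean of $M^{(k)}$ is finite and is close to $m/\binom k2$: $$\Big|\mathbb E_\lambda[M^{(k)}]-\frac m\ell\Big|\le 2\big((a+2r)+b\big)\,\frac m\ell .$$ -/

import Mathlib

open MeasureTheory Filter Topology
open scoped NNReal ENNReal BigOperators

universe u

namespace MeanField

section Paths

variable {V : Type u}

/-- A path that is constant on each interval `[t n, t (n+1))` of some strictly increasing sequence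
of times starting at `0` and tending to infinity. -/
def IsStepPath (w : ℝ≥0 → V) : Prop :=
  ∃ t : ℕ → ℝ≥0, t 0 = 0 ∧ StrictMono t ∧ Tendsto t atTop atTop ∧
    ∀ n, ∀ s ∈ Set.Ico (t n) (t (n + 1)), w s = w (t n)

theorem IsStepPath.shift {w : ℝ≥0 → V} (hw : IsStepPath w) (T : ℝ≥0) :
    IsStepPath (fun s => w (s + T)) := by
  classical
  obtain ⟨t, h0, hmono, htop, hconst⟩ := hw
  -- `N` is the first index with `T < t N`
  have hex : ∃ n, T < t n := (htop.eventually_gt_atTop T).exists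
  have hN : T < t (Nat.find hex) := Nat.find_spec hex
  have hlt : ∀ n, n < Nat.find hex → t n ≤ T := fun n hn => not_lt.1 (Nat.find_min hex hn)
  obtain ⟨M, hM⟩ : ∃ M, Nat.find hex = M + 1 := by
    refine Nat.exists_eq_succ_of_ne_zero ?_
    intro h
    rw [h, h0] at hN
    exact absurd hN not_lt_zero
  rw [hM] at hN hlt
  have hMT : t M ≤ T := hlt M (Nat.lt_succ_self M)
  have hge : ∀ n, T < t (M + 1 + n) := fun n =>
    hN.trans_le (hmono.monotone (Nat.le_add_right _ _))
  refine ⟨fun n => Nat.casesOn n 0 (fun j => t (M + 1 + j) - T), rfl, ?_, ?_, ?_⟩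
  · refine strictMono_nat_of_lt_succ ?_
    intro n
    cases n with
    | zero => exact tsub_pos_of_lt (hge 0)
    | succ j =>
      exact (tsub_lt_tsub_iff_right (hge j).le).2 (hmono (by omega))
  · refine (tendsto_add_atTop_iff_nat 1).1 ?_
    refine tendsto_atTop.2 fun b => ?_
    have h1 : Tendsto (fun j => t (M + 1 + j)) atTop atTop := by
      have := (tendsto_add_atTop_iff_nat (f := t) (l := atTop) (M + 1)).2 htop
      simpa [add_comm, add_left_comm] using this
    filter_upwards [h1.eventually_ge_atTop (b + T)] with j hj
    exact le_tsub_of_add_le_right hj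
  · intro n s hs
    cases n with
    | zero =>
      have hs2 : s < t (M + 1) - T := hs.2
      have h2 : s + T < t (M + 1) := lt_tsub_iff_right.1 hs2
      have e1 := hconst M (s + T) ⟨hMT.trans le_add_self, h2⟩
      have e2 := hconst M (0 + T) ⟨by simpa using hMT, by simpa using hN⟩
      exact e1.trans e2.symm
    | succ j =>
      have hs1 : t (M + 1 + j) - T ≤ s := hs.1
      have hs2 : s < t (M + 1 + (j + 1)) - T := hs.2
      have h2 : s + T < t (M + 1 + j + 1) := lt_tsub_iff_right.1 hs2
      have e1 := hconst (M + 1 + j) (s + T) ⟨tsub_le_iff_right.1 hs1, h2⟩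
      have e2 : t (M + 1 + j) - T + T = t (M + 1 + j) := tsub_add_cancel_of_le (hge j).le
      change w (s + T) = w (t (M + 1 + j) - T + T)
      rw [e2, e1]

end Paths

/-- The path space `𝔻([0,∞), V)`. -/
def StepPath (V : Type u) : Type u := {w : ℝ≥0 → V // IsStepPath w}

section Chains

variable {V : Type u}

/-- The coordinate `X_t(ω) = ω_t`. -/
def StepPath.at (w : StepPath V) (t : ℝ≥0) : V := w.1 t

/-- The time shift `Θ_T`. -/
def StepPath.shift (T : ℝ≥0) (w : StepPath V) : StepPath V := ⟨fun s => w.1 (s + T), w.2.shift T⟩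

/-- The σ-field on path space generated by the coordinates (`V` carries its discrete σ-field). -/
instance : MeasurableSpace (StepPath V) :=
  ⨆ t : ℝ≥0, MeasurableSpace.comap (fun w : StepPath V => w.at t) ⊤

/-- The σ-field `σ(X_s : s ≤ T)`. -/
@[reducible] def pastSigma (V : Type u) (T : ℝ≥0) : MeasurableSpace (StepPath V) :=
  ⨆ s : Set.Iic T, MeasurableSpace.comap (fun w : StepPath V => w.at s) ⊤

/-- `P` is the Markov chain with transition rates `q x y` (`x ≠ y`; the diagonal of `q` is never
used): the unique family of path laws `P x` with `X_0 = x` a.s., with the prescribed jump rates at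
time `0`, and with the Markov property. -/
structure IsMarkovChain (q : V → V → ℝ≥0) (P : V → Measure (StepPath V)) : Prop where
  prob : ∀ x, IsProbabilityMeasure (P x)
  start : ∀ x, P x {w | w.at 0 = x} = 1
  rate : ∀ x y, x ≠ y →
    Tendsto (fun e : ℝ≥0 => (P x).real {w | w.at e = y} / (e : ℝ)) (𝓝[>] 0) (𝓝 (q x y : ℝ))
  markov : ∀ (x : V) (T : ℝ≥0) (A S : Set (StepPath V)),
    MeasurableSet[pastSigma V T] A → MeasurableSet S →
      P x (A ∩ StepPath.shift T ⁻¹' S) = ∫⁻ w in A, P (w.at T) S ∂(P x)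

variable [Fintype V]

/-- The chain started from a random state with law `ν`: the mixture of the `P x`. -/
noncomputable def chainFrom (P : V → Measure (StepPath V)) (ν : PMF V) : Measure (StepPath V) :=
  ∑ x, ν x • P x

/-- `ν` is a stationary measure: the shifted process has the same law as the process itself. -/
def IsStationary (P : V → Measure (StepPath V)) (ν : PMF V) : Prop :=
  ∀ (T : ℝ≥0) (S : Set (StepPath V)), MeasurableSet S →
    chainFrom P ν (StepPath.shift T ⁻¹' S) = chainFrom P ν S

/-- Total variation distance between the law of `X_T` started at `x` and `ν`. -/
noncomputable def tvAt (P : V → Measure (StepPath V)) (ν : PMF V) (x : V) (T : ℝ≥0) : ℝ :=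
  (1 / 2) * ∑ y, |(P x).real {w | w.at T = y} - (ν y).toReal|

/-- The chain is mixing and `π` is its unique stationary measure. -/
structure IsMixing (P : V → Measure (StepPath V)) (π : PMF V) : Prop where
  stationary : IsStationary P π
  unique : ∀ ν, IsStationary P ν → ν = π
  mixes : ∀ a ∈ Set.Ioo (0 : ℝ) 1, ∃ T : ℝ≥0, ∀ x, tvAt P π x T ≤ a

/-- The `a`-mixing time. -/
noncomputable def tmix (P : V → Measure (StepPath V)) (π : PMF V) (a : ℝ) : ℝ≥0 :=
  sInf {T : ℝ≥0 | ∀ x, tvAt P π x T ≤ a}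

/-- Reversibility (detailed balance) with respect to `π`. -/
def IsReversible (q : V → V → ℝ≥0) (π : PMF V) : Prop :=
  ∀ x y, x ≠ y → π x * (q x y : ℝ≥0∞) = π y * (q y x : ℝ≥0∞)

/-- Transitivity: permutations of the state space that leave the transition rates invariant act
transitively. -/
def IsTransitive (q : V → V → ℝ≥0) : Prop :=
  ∀ x y, ∃ g : Equiv.Perm V, g x = y ∧ ∀ a b, a ≠ b → q (g a) (g b) = q a b

open Classical in
/-- The maximal total transition rate out of a state. -/
noncomputable def qMax (q : V → V → ℝ≥0) : ℝ≥0 :=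
  Finset.univ.sup fun x => ∑ y ∈ Finset.univ.filter (fun y => y ≠ x), q x y

/-- The maximal stationary probability of a state. -/
noncomputable def piMax (π : PMF V) : ℝ := (Finset.univ.sup fun x => π x).toReal

/-- The joint law of `k` independent trajectories of the chain, when the `k`-tuple of initial
states is chosen at random with weights `ν`. -/
noncomputable def walkersFrom (P : V → Measure (StepPath V)) {k : ℕ}
    (ν : (Fin k → V) → ℝ≥0∞) : Measure (Fin k → StepPath V) :=
  ∑ x, ν x • Measure.pi fun i => P (x i)

/-- The first meeting time `inf {t ≥ 0 : ∃ i < j, X_t(i) = X_t(j)}` (infinite if there is none). -/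
noncomputable def meetingTime {k : ℕ} (w : Fin k → StepPath V) : ℝ≥0∞ :=
  ⨅ (t : ℝ≥0) (_ : ∃ i j, i < j ∧ (w i).at t = (w j).at t), (t : ℝ≥0∞)

/-- The mean meeting time of two independent walkers, both started from `π`. -/
noncomputable def meanMeeting (P : V → Measure (StepPath V)) (π : PMF V) : ℝ :=
  (∫⁻ w, meetingTime w ∂(walkersFrom P fun x : Fin 2 → V => ∏ i, π (x i))).toReal

open Classical in
/-- The parameter that measures the size of the error: `T_mix / m` for reversible, transitive
chains, and `(1 + q_max T_mix) π_max` for all other chains, with `T_mix = T_mix(1/4)`. -/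
noncomputable def smallParam (q : V → V → ℝ≥0) (P : V → Measure (StepPath V)) (π : PMF V) : ℝ :=
  if IsReversible q π ∧ IsTransitive q then
    (tmix P π (1 / 4) : ℝ) / meanMeeting P π
  else (1 + (qMax q : ℝ) * (tmix P π (1 / 4) : ℝ)) * piMax π

open Classical in
/-- The error parameter `c √(ρ ln (1/ρ))`, where `ρ` is the parameter above, and `c` is `c₀` for
reversible, transitive chains and `c₁` for all other chains. -/
noncomputable def err (c₀ c₁ : ℝ) (q : V → V → ℝ≥0) (P : V → Measure (StepPath V)) (π : PMF V) :
    ℝ :=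
  (if IsReversible q π ∧ IsTransitive q then c₀ else c₁) *
    √(smallParam q P π * Real.log (1 / smallParam q P π))

end Chains

/-- Under `μ`, the nonnegative random variable `Z` has a law of type `Exp(m, α, β)`. -/
structure IsNearExp {Ω : Type*} [MeasurableSpace Ω] (μ : Measure Ω) (Z : Ω → ℝ≥0∞)
    (m α β : ℝ) : Prop where
  m_pos : 0 < m
  α_pos : 0 < α
  β_pos : 0 < β
  β_lt_one : β < 1
  aemeasurable : AEMeasurable Z μ
  finite : ∀ᵐ w ∂μ, Z w ≠ ∞
  lower : ∀ t : ℝ, 0 < t →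
    (1 - α) * Real.exp (-t / ((1 - β) * m)) ≤ μ.real {w | ENNReal.ofReal t ≤ Z w}
  upper : ∀ t : ℝ, 0 < t →
    μ.real {w | ENNReal.ofReal t ≤ Z w} ≤ (1 + α) * Real.exp (-t / ((1 + β) * m))

end MeanField

open MeanField

set_option linter.unusedSectionVars false

/-! The meeting time is nearly exponential because the walkers forget where they started long before
they are likely to meet. Write `ε` for the error parameter, `e = ε / 1000`, `l = k.choose 2`, `T =
tmix (ε ^ 2)` and `U = 5 • T`. Two facts make `U` a good unit of time: after `U` a walker is within
`e ^ 2` of stationarity, and a stationary walker meets a walker started anywhere within time `U`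
with probability at most `e ^ 2`. Choose a window `N • U` in which two stationary walkers meet with
probability `p` between `e` and `2 * e` (`exists_window_size`). All errors made in one window are
then `O(l * e)` relative to `l * p`.

Among `k` stationary walkers the probability of a meeting in one window is at most `l * p` by the
union bound, and at least `l * p` up to a second-order Bonferroni term (`le_one_sub_statSurv`).
Disjoint pairs are independent. Pairs that share a walker are handled by ordering the two meetings:
when the first pair meets, the third walker is still stationary and independent of them, so the
second meeting costs another factor (`correlation_le`).

Leaving a gap `U` at the start of a window lets the walkers mix, so survival is multiplied in each
window by `1 - l * p * (1 + O(l * e))`. The upper bound merely ignores meetings in the gap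
(`surv_upper`). The lower bound must charge for them, and does so by using the preceding stretch of
length `U` for mixing (`surv_lower`). Iterating gives exponential tails with rate `l * p / (N • U)`,
uniformly in the initial law; that law enters only through the first window, where it costs `r`
(`IsWindow.tail_upper`, `IsWindow.tail_lower`). For `k = 2` and a stationary start, integrating
these tails gives `m * p ≈ N • U` (`IsWindow.mean_bounds`). Substituting this eliminates the window
and leaves the rate `l / m` (`IsWindow.nearExp`).

The meeting bound for time `U` is the only place where the two definitions of `ρ` differ
(`hitFrom_five_tmix_le`). For a transitive chain the bound does not depend on the starting point,
and a larger meeting probability would force a mean meeting time smaller than `m`. In general,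
occupation times are counted: two walkers that meet stay together for a time of order `1 / q_max`
with probability bounded below, while at a fixed time a stationary walker sits at the position of
the other with probability at most `π_max`.

No stopping times or strong Markov property are needed: everything is proved by induction for
discrete kernels on dyadic grids, and passes to continuous time because step paths are
right-continuous (`tendsto_surv`). -/

namespace MeanField

/-! ### Killed discrete-time chains: survival inequalities and occupation counts. -/

section Discrete

open Matrix

variable {W : Type*} [Fintype W]

/-- A row-stochastic matrix. -/
structure IsStoch (K : Matrix W W ℝ) : Prop where
  nonneg : ∀ x y, 0 ≤ K x y
  sum_eq_one : ∀ x, ∑ y, K x y = 1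

/-- `avoid K A n φ x` is the expectation of `φ (Y n)` on the event that the discrete chain `Y`
with kernel `K`, started at `x`, does not visit `A` at the times `0, …, n`. -/
noncomputable def avoid (K : Matrix W W ℝ) (A : Set W) : ℕ → (W → ℝ) → W → ℝ
  | 0, φ => Aᶜ.indicator φ
  | n + 1, φ => Aᶜ.indicator (K *ᵥ avoid K A n φ)

variable {K : Matrix W W ℝ} {A B : Set W} {φ ψ : W → ℝ}

theorem IsStoch.mulVec_mono (hK : IsStoch K) (h : φ ≤ ψ) : K *ᵥ φ ≤ K *ᵥ ψ := fun x =>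
  Finset.sum_le_sum fun y _ => mul_le_mul_of_nonneg_left (h y) (hK.nonneg x y)

theorem IsStoch.mulVec_one (hK : IsStoch K) : K *ᵥ (1 : W → ℝ) = 1 := by
  ext x
  simp [mulVec, dotProduct, hK.sum_eq_one]

theorem avoid_mono (hK : IsStoch K) (h : φ ≤ ψ) (n : ℕ) : avoid K A n φ ≤ avoid K A n ψ := by
  induction n with
  | zero => exact fun x => Set.indicator_le_indicator (h x)
  | succ n ih => exact fun x => Set.indicator_le_indicator (hK.mulVec_mono ih x)

theorem avoid_zero_fun (n : ℕ) : avoid K A n 0 = 0 := by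
  induction n with
  | zero => simp [avoid]
  | succ n ih => simp [avoid, ih]

theorem avoid_nonneg (hK : IsStoch K) (h : 0 ≤ φ) (n : ℕ) : 0 ≤ avoid K A n φ := by
  have := avoid_mono (A := A) hK h n
  rwa [avoid_zero_fun] at this

theorem avoid_anti (hK : IsStoch K) (hAB : A ⊆ B) (h : 0 ≤ φ) (n : ℕ) :
    avoid K B n φ ≤ avoid K A n φ := by
  induction n with
  | zero =>
    exact Set.indicator_le_indicator_of_subset (Set.compl_subset_compl.2 hAB) h
  | succ n ih =>
    refine le_trans (b := Bᶜ.indicator (K *ᵥ avoid K A n φ))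
      (fun x => Set.indicator_le_indicator (hK.mulVec_mono ih x)) ?_
    refine Set.indicator_le_indicator_of_subset (Set.compl_subset_compl.2 hAB) fun x => ?_
    have := hK.mulVec_mono (avoid_nonneg (A := A) hK h n) x
    simpa using this

theorem avoid_sub (n : ℕ) : avoid K A n (φ - ψ) = avoid K A n φ - avoid K A n ψ := by
  induction n with
  | zero => exact Set.indicator_sub' _ _ _
  | succ n ih => simp only [avoid, ih, mulVec_sub, Set.indicator_sub']

theorem avoid_smul (c : ℝ) (n : ℕ) : avoid K A n (c • φ) = c • avoid K A n φ := by
  induction n with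
  | zero => exact Set.indicator_const_smul Aᶜ c φ
  | succ n ih =>
    simp only [avoid, ih, mulVec_smul]
    exact Set.indicator_const_smul Aᶜ c (K *ᵥ avoid K A n φ)

theorem indicator_avoid (n : ℕ) : Aᶜ.indicator (avoid K A n φ) = avoid K A n φ := by
  cases n <;> simp [avoid]

theorem avoid_add (a b : ℕ) : avoid K A (a + b) φ = avoid K A a (avoid K A b φ) := by
  induction a with
  | zero => simp [avoid, indicator_avoid]
  | succ a ih => rw [Nat.add_right_comm]; simp only [avoid, ih]

theorem avoid_empty_zero : avoid K ∅ 0 φ = φ := by simp [avoid]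

theorem avoid_empty_succ (n : ℕ) : avoid K ∅ (n + 1) φ = K *ᵥ avoid K ∅ n φ := by simp [avoid]

theorem avoid_empty_one (hK : IsStoch K) (n : ℕ) : avoid K ∅ n 1 = 1 := by
  induction n with
  | zero => exact avoid_empty_zero
  | succ n ih => rw [avoid_empty_succ, ih, hK.mulVec_one]

theorem avoid_one_le_one (hK : IsStoch K) (n : ℕ) : avoid K A n 1 ≤ 1 :=
  (avoid_anti hK (Set.empty_subset A) zero_le_one n).trans (avoid_empty_one hK n).le

theorem avoid_one_nonneg (hK : IsStoch K) (n : ℕ) : 0 ≤ avoid K A n 1 :=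
  avoid_nonneg hK zero_le_one n

/-- The probability of no visit to `A` is at least the probability of no visit after time `a`,
minus the probability of a visit by time `a`. -/
theorem avoid_ge (hK : IsStoch K) (hφ : φ ≤ 1) (a : ℕ) :
    avoid K ∅ a φ + avoid K A a 1 - 1 ≤ avoid K A a φ := by
  -- Enlarging the killing set decreases the expectation of the nonnegative function `1 - φ`; by
  -- linearity this rearranges to the claim.
  have h := avoid_anti hK (Set.empty_subset A) (sub_nonneg.2 hφ) a
  rw [avoid_sub, avoid_sub, avoid_empty_one hK] at h
  intro x
  have := h x
  simp only [Pi.sub_apply, Pi.add_apply] at this ⊢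
  linarith

theorem avoid_one_antitone (hK : IsStoch K) : Antitone fun n => avoid K A n 1 := by
  refine antitone_nat_of_succ_le fun n => ?_
  rw [avoid_add]
  exact avoid_mono hK (avoid_one_le_one hK 1) n

variable {μ : W → ℝ} {d : ℝ} {T : ℕ}

theorem stationary_avoid (hμ : μ ᵥ* K = μ) (n : ℕ) : μ ⬝ᵥ avoid K ∅ n φ = μ ⬝ᵥ φ := by
  induction n with
  | zero => rw [avoid_empty_zero]
  | succ n ih => rw [avoid_empty_succ, dotProduct_mulVec, hμ, ih]

/-- `d` bounds the distance to `μ` after `T` steps. -/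
def MixesTo (K : Matrix W W ℝ) (μ : W → ℝ) (T : ℕ) (d : ℝ) : Prop :=
  ∀ φ : W → ℝ, 0 ≤ φ → φ ≤ 1 → ∀ x, |avoid K ∅ T φ x - μ ⬝ᵥ φ| ≤ d

theorem avoid_const (c : ℝ) (n : ℕ) : avoid K A n (fun _ => c) = c • avoid K A n 1 := by
  rw [← avoid_smul]
  congr 1
  ext
  simp

/-- Visits during the `T` steps after time `t` are ignored. By then the chain is within `d` of `μ`
whatever its position at time `t`, so the last `v` steps contribute an almost independent factor. -/
theorem surv_upper (hK : IsStoch K) (hd : MixesTo K μ T d) (t v : ℕ) (x : W) :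
    avoid K A (t + (T + v)) 1 x ≤ avoid K A t 1 x * (μ ⬝ᵥ avoid K A v 1 + d) := by
  have h1 : avoid K A (T + v) 1 ≤ fun _ => μ ⬝ᵥ avoid K A v 1 + d := by
    rw [avoid_add]
    intro y
    have h2 := avoid_anti hK (Set.empty_subset A) (avoid_one_nonneg (A := A) hK v) T y
    have h3 := (abs_le.1 (hd _ (avoid_one_nonneg (A := A) hK v) (avoid_one_le_one hK v) y)).2
    dsimp only
    linarith
  rw [avoid_add]
  have := avoid_mono (A := A) hK h1 t x
  rw [avoid_const] at this
  simpa [mul_comm] using this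

theorem surv_base (hK : IsStoch K) (hd : MixesTo K μ T d) (v : ℕ) (x : W) :
    avoid K A T 1 x - (1 - μ ⬝ᵥ avoid K A v 1) - d ≤ avoid K A (T + v) 1 x := by
  rw [avoid_add]
  have h2 := avoid_ge (A := A) hK (avoid_one_le_one (A := A) hK v) T x
  have h3 := (abs_le.1 (hd _ (avoid_one_nonneg (A := A) hK v) (avoid_one_le_one hK v) x)).1
  simp only [Pi.sub_apply, Pi.add_apply, Pi.one_apply] at h2
  linarith

/-- The gap after time `t + T` cannot be ignored here: a visit during it must be subtracted.
Restarting at `t + T` gives no control over that visit, but on survival up to the earlier time `t`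
the steps from `t` to `t + T` act as a mixing period. Hence the subtracted term carries the nearly
stationary hitting probability, multiplied by survival to `t` rather than to `t + T`. -/
theorem surv_lower (hK : IsStoch K) (hd : MixesTo K μ T d) (hμ1 : μ ⬝ᵥ 1 = 1) (t v : ℕ) (x : W) :
    avoid K A (t + T) 1 x * (μ ⬝ᵥ avoid K A v 1 - d)
        - avoid K A t 1 x * (1 - μ ⬝ᵥ avoid K A T 1 + d)
      ≤ avoid K A (t + T + (T + v)) 1 x := by
  have h1 : (fun _ => μ ⬝ᵥ avoid K A v 1 - d) - (1 - avoid K A T 1) ≤ avoid K A (T + v) 1 := by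
    intro y
    have := surv_base (A := A) hK hd v y
    simp only [Pi.sub_apply, Pi.one_apply]
    linarith
  have h2 := avoid_mono (A := A) hK h1 (t + T) x
  rw [avoid_sub, avoid_const, ← avoid_add] at h2
  have h3 : avoid K A T (1 - avoid K A T 1) ≤ fun _ => 1 - μ ⬝ᵥ avoid K A T 1 + d := by
    intro y
    have h0 : (0 : W → ℝ) ≤ 1 - avoid K A T 1 := sub_nonneg.2 (avoid_one_le_one hK T)
    have h4 := avoid_anti hK (Set.empty_subset A) h0 T y
    have h5 := (abs_le.1 (hd _ h0 (sub_le_self _ (avoid_one_nonneg hK T)) y)).2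
    rw [dotProduct_sub, hμ1] at h5
    dsimp only
    linarith
  have h6 := avoid_mono (A := A) hK h3 t x
  rw [← avoid_add, avoid_const] at h6
  simp only [Pi.sub_apply, Pi.smul_apply, smul_eq_mul] at h2 h6
  linarith

theorem stat_subadd (hK : IsStoch K) (hμ0 : 0 ≤ μ) (hμ : μ ᵥ* K = μ) (hμ1 : μ ⬝ᵥ 1 = 1)
    (a b : ℕ) :
    1 - μ ⬝ᵥ avoid K A (a + b) 1 ≤ (1 - μ ⬝ᵥ avoid K A a 1) + (1 - μ ⬝ᵥ avoid K A b 1) := by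
  have h := dotProduct_le_dotProduct_of_nonneg_left
    (avoid_ge (A := A) hK (avoid_one_le_one (A := A) hK b) a) hμ0
  rw [dotProduct_sub, dotProduct_add, stationary_avoid hμ, hμ1, ← avoid_add] at h
  linarith

/-- The expected number of visits to `A` before time `n`. -/
noncomputable def occupation (K : Matrix W W ℝ) (A : Set W) (n : ℕ) : W → ℝ :=
  ∑ i ∈ Finset.range n, avoid K ∅ i (A.indicator 1)

theorem occupation_succ (n : ℕ) :
    occupation K A (n + 1) = A.indicator 1 + K *ᵥ occupation K A n := by
  unfold occupation
  rw [Finset.sum_range_succ', avoid_empty_zero, add_comm]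
  congr 1
  simp only [avoid_empty_succ]
  exact (map_sum (Matrix.mulVecLin K) _ _).symm

/-- Once `A` is hit, each of the next `m` times is spent in `A` with probability at least `c`. The
induction on `n` conditions on the first step, which replaces the strong Markov property at the
hitting time. -/
theorem occupation_ge (hK : IsStoch K) (m n : ℕ) {c : ℝ}
    (hc : ∀ x ∈ A, ∀ i < m, c ≤ avoid K ∅ i (A.indicator 1) x) (x : W) :
    (c * m) * (1 - avoid K A n 1 x) ≤ occupation K A (n + m) x := by
  have hpos : ∀ i, (0 : W → ℝ) ≤ avoid K ∅ i (A.indicator 1) := fun i =>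
    avoid_nonneg hK (Set.indicator_nonneg fun _ _ => zero_le_one) i
  have hin : ∀ x ∈ A, ∀ n, c * m ≤ occupation K A (n + m) x := by
    intro x hx n
    calc c * m = ∑ i ∈ Finset.range m, c := by simp [mul_comm]
      _ ≤ ∑ i ∈ Finset.range m, avoid K ∅ i (A.indicator 1) x :=
        Finset.sum_le_sum fun i hi => hc x hx i (Finset.mem_range.1 hi)
      _ ≤ ∑ i ∈ Finset.range (n + m), avoid K ∅ i (A.indicator 1) x :=
        Finset.sum_le_sum_of_subset_of_nonneg (Finset.range_mono (by omega))
          fun i _ _ => hpos i x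
      _ = _ := by simp [occupation]
  have hnn : ∀ n, (0 : W → ℝ) ≤ occupation K A n := fun n =>
    Finset.sum_nonneg fun i _ => hpos i
  induction n generalizing x with
  | zero =>
    by_cases hx : x ∈ A
    · simpa [avoid, hx] using hin x hx 0
    · simpa [avoid, hx] using hnn m x
  | succ n ih =>
    by_cases hx : x ∈ A
    · simpa [avoid, hx] using hin x hx (n + 1)
    · have h1 : (c * m) • ((1 : W → ℝ) - avoid K A n 1) ≤ occupation K A (n + m) := fun y => by
        simpa using ih y
      have h2 := hK.mulVec_mono h1 x
      rw [mulVec_smul, mulVec_sub, hK.mulVec_one] at h2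
      rw [Nat.add_right_comm, occupation_succ]
      simpa [avoid, hx] using h2

end Discrete

/-! ### Products of kernels: `k` independent chains and their mixing. -/

section Product

open Matrix

variable {V : Type*} {k : ℕ}

/-- The kernel of `k` independent chains with kernel `p`. -/
def prodK (p : Matrix V V ℝ) (k : ℕ) : Matrix (Fin k → V) (Fin k → V) ℝ :=
  fun x y => ∏ i, p (x i) (y i)

/-- The `k`-fold product of the weights `π`. -/
def prodLaw (π : V → ℝ) (k : ℕ) : (Fin k → V) → ℝ := fun x => ∏ i, π (x i)

theorem prodLaw_nonneg {π : V → ℝ} (h : 0 ≤ π) : 0 ≤ prodLaw π k := fun x =>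
  Finset.prod_nonneg fun i _ => h (x i)

variable [Fintype V]

theorem sum_prod_pi (f : Fin k → V → ℝ) : ∑ y : Fin k → V, ∏ i, f i (y i) = ∏ i, ∑ v, f i v := by
  rw [Finset.prod_univ_sum, Fintype.piFinset_univ]

theorem prodLaw_one {π : V → ℝ} (h : ∑ v, π v = 1) : prodLaw π k ⬝ᵥ 1 = 1 := by
  simp only [dotProduct, prodLaw, Pi.one_apply, mul_one]
  rw [sum_prod_pi fun _ v => π v]
  simp [h]

theorem prodK_stoch {p : Matrix V V ℝ} (hp : IsStoch p) : IsStoch (prodK p k) where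
  nonneg x y := Finset.prod_nonneg fun i _ => hp.nonneg _ _
  sum_eq_one x := by
    simp only [prodK]
    rw [sum_prod_pi fun i v => p (x i) v]
    simp [hp.sum_eq_one]

theorem prodK_mul (p q : Matrix V V ℝ) : prodK (p * q) k = prodK p k * prodK q k := by
  ext x y
  simp only [prodK, Matrix.mul_apply, ← Finset.prod_mul_distrib]
  rw [sum_prod_pi fun i v => p (x i) v * q v (y i)]

theorem prodLaw_vecMul {π : V → ℝ} {p : Matrix V V ℝ} (h : π ᵥ* p = π) :
    prodLaw π k ᵥ* prodK p k = prodLaw π k := by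
  ext y
  simp only [prodK, prodLaw, vecMul, dotProduct, ← Finset.prod_mul_distrib]
  rw [sum_prod_pi fun i v => π v * p v (y i)]
  refine Finset.prod_congr rfl fun i _ => ?_
  exact congrFun h (y i)

/-- A stochastic semigroup in continuous time. -/
structure IsSemigroup (p : ℝ≥0 → Matrix V V ℝ) : Prop where
  stoch : ∀ t, IsStoch (p t)
  zero : ∀ φ : V → ℝ, p 0 *ᵥ φ = φ
  add : ∀ s t, p (s + t) = p s * p t

theorem IsSemigroup.zero_self {p : ℝ≥0 → Matrix V V ℝ} (hp : IsSemigroup p) (x : V) :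
    p 0 x x = 1 := by
  classical
  have := congrFun (hp.zero (Pi.single x 1)) x
  simpa using this

theorem IsSemigroup.zero_ne {p : ℝ≥0 → Matrix V V ℝ} (hp : IsSemigroup p) {x y : V}
    (h : x ≠ y) : p 0 x y = 0 := by
  classical
  have := congrFun (hp.zero (Pi.single y 1)) x
  simpa [h] using this

theorem IsSemigroup.prod {p : ℝ≥0 → Matrix V V ℝ} (hp : IsSemigroup p) :
    IsSemigroup fun t => prodK (p t) k where
  stoch t := prodK_stoch (hp.stoch t)
  zero φ := by
    classical
    ext x
    simp only [mulVec, dotProduct]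
    rw [Finset.sum_eq_single x]
    · simp [prodK, hp.zero_self]
    · intro y _ hy
      obtain ⟨i, hi⟩ := Function.ne_iff.1 hy
      rw [prodK, Finset.prod_eq_zero (Finset.mem_univ i) (hp.zero_ne (Ne.symm hi)), zero_mul]
    · simp
  add s t := by rw [hp.add, prodK_mul]

theorem IsSemigroup.avoid_empty {p : ℝ≥0 → Matrix V V ℝ} (hp : IsSemigroup p) (h : ℝ≥0) (n : ℕ)
    (φ : V → ℝ) : avoid (p h) ∅ n φ = p (n • h) *ᵥ φ := by
  induction n with
  | zero => rw [avoid_empty_zero, zero_smul, hp.zero]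
  | succ n ih => rw [avoid_empty_succ, ih, mulVec_mulVec, succ_nsmul', hp.add]

/-- Replacing the factors one at a time changes the product law by at most the distance in that
factor, since the remaining factors have total mass one. -/
theorem sum_abs_prod_sub_le (a b : Fin k → V → ℝ) (ha : ∀ i v, 0 ≤ a i v) (hb : ∀ i v, 0 ≤ b i v)
    (ha1 : ∀ i, ∑ v, a i v = 1) (hb1 : ∀ i, ∑ v, b i v = 1) :
    ∑ y : Fin k → V, |∏ i, a i (y i) - ∏ i, b i (y i)| ≤ ∑ i, ∑ v, |a i v - b i v| := by
  induction k with
  | zero => simp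
  | succ k ih =>
    rw [← (Fin.consEquiv fun _ => V).sum_comp, Fintype.sum_prod_type, Fin.sum_univ_succ]
    simp only [Fin.consEquiv, Equiv.coe_fn_mk, Fin.prod_univ_succ, Fin.cons_zero, Fin.cons_succ]
    have ih' := ih (fun i => a i.succ) (fun i => b i.succ) (fun i => ha _) (fun i => hb _)
      (fun i => ha1 _) (fun i => hb1 _)
    calc ∑ v, ∑ y : Fin k → V,
          |a 0 v * ∏ i : Fin k, a i.succ (y i) - b 0 v * ∏ i : Fin k, b i.succ (y i)|
        ≤ ∑ v, ∑ y : Fin k → V, (|a 0 v - b 0 v| * ∏ i : Fin k, a i.succ (y i)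
          + b 0 v * |∏ i : Fin k, a i.succ (y i) - ∏ i : Fin k, b i.succ (y i)|) := by
          refine Finset.sum_le_sum fun v _ => Finset.sum_le_sum fun y _ => ?_
          have e : a 0 v * ∏ i : Fin k, a i.succ (y i) - b 0 v * ∏ i : Fin k, b i.succ (y i)
            = (a 0 v - b 0 v) * ∏ i : Fin k, a i.succ (y i)
              + b 0 v * (∏ i : Fin k, a i.succ (y i) - ∏ i : Fin k, b i.succ (y i)) := by ring
          rw [e]
          refine (abs_add_le _ _).trans (le_of_eq ?_)
          rw [abs_mul, abs_mul, abs_of_nonneg (hb 0 v),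
            abs_of_nonneg (Finset.prod_nonneg fun i _ => ha i.succ (y i))]
      _ = ∑ v, |a 0 v - b 0 v|
          + ∑ y : Fin k → V, |∏ i : Fin k, a i.succ (y i) - ∏ i : Fin k, b i.succ (y i)| := by
          simp only [Finset.sum_add_distrib, ← Finset.mul_sum, ← Finset.sum_mul]
          rw [sum_prod_pi fun i v => a (Fin.succ i) v]
          simp [ha1, hb1]
      _ ≤ _ := by gcongr

theorem abs_sub_dotProduct_le {W : Type*} [Fintype W] (a b φ : W → ℝ) (h : ∑ v, a v = ∑ v, b v)
    (h0 : 0 ≤ φ) (h1 : φ ≤ 1) : |a ⬝ᵥ φ - b ⬝ᵥ φ| ≤ 1 / 2 * ∑ v, |a v - b v| := by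
  -- Equal total masses allow `φ` to be recentred to values in `[-1/2, 1/2]`, which yields the
  -- factor `1 / 2` of total variation.
  have e : a ⬝ᵥ φ - b ⬝ᵥ φ = ∑ v, (a v - b v) * (φ v - 1 / 2) := by
    simp only [dotProduct, sub_mul, mul_sub, Finset.sum_sub_distrib, ← Finset.sum_mul, h]
    ring
  rw [e, Finset.mul_sum]
  refine (Finset.abs_sum_le_sum_abs _ _).trans (Finset.sum_le_sum fun v _ => ?_)
  rw [abs_mul, mul_comm]
  refine mul_le_mul_of_nonneg_right ?_ (abs_nonneg _)
  have := h0 v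
  have := h1 v
  simp only [Pi.zero_apply, Pi.one_apply] at *
  rw [abs_le]
  constructor <;> linarith

theorem mixesTo_prod {p : ℝ≥0 → Matrix V V ℝ} (hp : IsSemigroup p) {π : V → ℝ} (hπ : 0 ≤ π)
    (hπ1 : ∑ v, π v = 1) {D : ℝ} (h : ℝ≥0) (T : ℕ)
    (hD : ∀ x, 1 / 2 * ∑ y, |p (T • h) x y - π y| ≤ D) :
    MixesTo (prodK (p h) k) (prodLaw π k) T (k * D) := by
  intro φ h0 h1 x
  rw [(hp.prod (k := k)).avoid_empty h T φ]
  have hs := (hp.prod (k := k)).stoch (T • h)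
  have h2 := abs_sub_dotProduct_le (prodK (p (T • h)) k x) (prodLaw π k) φ (by
    rw [hs.sum_eq_one]
    simpa [dotProduct] using (prodLaw_one (k := k) hπ1).symm) h0 h1
  refine h2.trans ?_
  have h3 := sum_abs_prod_sub_le (fun i : Fin k => p (T • h) (x i)) (fun _ => π)
    (fun i v => (hp.stoch _).nonneg _ _) (fun i v => hπ v)
    (fun i => (hp.stoch _).sum_eq_one _) fun _ => hπ1
  calc 1 / 2 * ∑ y, |prodK (p (T • h)) k x y - prodLaw π k y|
      ≤ 1 / 2 * ∑ i : Fin k, ∑ v, |p (T • h) (x i) v - π v| :=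
        mul_le_mul_of_nonneg_left h3 (by norm_num)
    _ = ∑ i : Fin k, 1 / 2 * ∑ v, |p (T • h) (x i) v - π v| := Finset.mul_sum _ _ _
    _ ≤ ∑ i : Fin k, D := Finset.sum_le_sum fun i _ => hD _
    _ = k * D := by simp

end Product

/-! ### Two meetings that share a walker are nearly independent. -/

section Correlation

open Matrix

variable {V : Type*} [Fintype V]

theorem sum_fin_two (f : (Fin 2 → V) → ℝ) : ∑ x, f x = ∑ a, ∑ b, f ![a, b] := by
  rw [← (finTwoArrowEquiv V).symm.sum_comp, Fintype.sum_prod_type]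
  rfl

theorem sum_fin_three (f : (Fin 3 → V) → ℝ) : ∑ x, f x = ∑ a, ∑ b, ∑ c, f ![a, b, c] := by
  rw [← (Fin.consEquiv fun _ => V).sum_comp, Fintype.sum_prod_type]
  simp only [sum_fin_two]
  rfl

/-- The pairs that have met. -/
def diag₂ (V : Type*) : Set (Fin 2 → V) := {x | x 0 = x 1}

/-- The triples whose first member has met one of the two others. -/
def diag₃ (V : Type*) : Set (Fin 3 → V) := {x | x 0 = x 1 ∨ x 0 = x 2}

/-- The probability that two discrete chains meet by time `n`. -/
noncomputable def hit₂ (p : Matrix V V ℝ) (n : ℕ) (x y : V) : ℝ :=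
  1 - avoid (prodK p 2) (diag₂ V) n 1 ![x, y]

/-- The probability that the first of three discrete chains meets one of the others by time `n`. -/
noncomputable def hit₃ (p : Matrix V V ℝ) (n : ℕ) (x y z : V) : ℝ :=
  1 - avoid (prodK p 3) (diag₃ V) n 1 ![x, y, z]

variable {p : Matrix V V ℝ}

theorem hit₂_self (n : ℕ) (x : V) : hit₂ p n x x = 1 := by
  cases n <;> simp [hit₂, avoid, diag₂]

theorem hit₂_zero {x y : V} (h : x ≠ y) : hit₂ p 0 x y = 0 := by
  simp [hit₂, avoid, diag₂, h]

theorem hit₂_succ (hp : IsStoch p) (n : ℕ) {x y : V} (h : x ≠ y) :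
    hit₂ p (n + 1) x y = ∑ a, ∑ b, p x a * p y b * hit₂ p n a b := by
  simp only [hit₂, mul_sub, Finset.sum_sub_distrib, mul_one, ← Finset.mul_sum, hp.sum_eq_one]
  simp [avoid, diag₂, h, mulVec, dotProduct, sum_fin_two, prodK, Fin.prod_univ_two]

theorem hit₂_nonneg (hp : IsStoch p) (n : ℕ) (x y : V) : 0 ≤ hit₂ p n x y :=
  sub_nonneg.2 (avoid_one_le_one (prodK_stoch hp) n _)

theorem hit₂_mono (hp : IsStoch p) (x y : V) : Monotone fun n => hit₂ p n x y := fun _ _ h =>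
  sub_le_sub_left (avoid_one_antitone (prodK_stoch hp) h _) _

theorem hit₃_of_or (n : ℕ) {x y z : V} (h : x = y ∨ x = z) : hit₃ p n x y z = 1 := by
  cases n <;> simp [hit₃, avoid, diag₃, h]

theorem hit₃_zero {x y z : V} (h : ¬ (x = y ∨ x = z)) : hit₃ p 0 x y z = 0 := by
  simp [hit₃, avoid, diag₃, h]

theorem hit₃_succ (hp : IsStoch p) (n : ℕ) {x y z : V} (h : ¬ (x = y ∨ x = z)) :
    hit₃ p (n + 1) x y z = ∑ a, ∑ b, ∑ c, p x a * p y b * p z c * hit₃ p n a b c := by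
  simp only [hit₃, mul_sub, Finset.sum_sub_distrib, mul_one, ← Finset.mul_sum, hp.sum_eq_one]
  simp [avoid, diag₃, h, mulVec, dotProduct, sum_fin_three, prodK, Fin.prod_univ_three]

open Classical in
/-- The probability that the first two of three discrete chains meet and that the first and the
third meet afterwards, both by time `n`. -/
noncomputable def hitThen (p : Matrix V V ℝ) : ℕ → V → V → V → ℝ
  | 0, x, y, z => if x = y then hit₂ p 0 x z else 0
  | n + 1, x, y, z => if x = y then hit₂ p (n + 1) x z else
      ∑ a, ∑ b, ∑ c, p x a * p y b * p z c * hitThen p n a b c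

theorem hitThen_self (n : ℕ) (x z : V) : hitThen p n x x z = hit₂ p n x z := by
  cases n <;> simp [hitThen]

theorem hitThen_zero {x y : V} (h : x ≠ y) (z : V) : hitThen p 0 x y z = 0 := by
  simp [hitThen, h]

theorem hitThen_succ {x y : V} (h : x ≠ y) (z : V) (n : ℕ) :
    hitThen p (n + 1) x y z = ∑ a, ∑ b, ∑ c, p x a * p y b * p z c * hitThen p n a b c := by
  simp [hitThen, h]

theorem hitThen_nonneg (hp : IsStoch p) (n : ℕ) (x y z : V) : 0 ≤ hitThen p n x y z := by
  induction n generalizing x y z with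
  | zero =>
    by_cases h : x = y
    · subst h; rw [hitThen_self]; exact hit₂_nonneg hp _ _ _
    · rw [hitThen_zero h]
  | succ n ih =>
    by_cases h : x = y
    · subst h; rw [hitThen_self]; exact hit₂_nonneg hp _ _ _
    · rw [hitThen_succ h]
      exact Finset.sum_nonneg fun a _ => Finset.sum_nonneg fun b _ => Finset.sum_nonneg fun c _ =>
        mul_nonneg (mul_nonneg (mul_nonneg (hp.nonneg _ _) (hp.nonneg _ _)) (hp.nonneg _ _))
          (ih _ _ _)

/-- By inclusion–exclusion the left side is the probability that the first chain meets both others.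
One of the two meetings comes first, and each order gives one term on the right. -/
theorem hit_both_le (hp : IsStoch p) (n : ℕ) (x y z : V) :
    hit₂ p n x y + hit₂ p n x z - hit₃ p n x y z ≤ hitThen p n x y z + hitThen p n x z y := by
  by_cases h : x = y
  · subst h
    rw [hit₂_self, hit₃_of_or _ (Or.inl rfl), hitThen_self]
    have := hitThen_nonneg hp n x z x
    linarith
  by_cases h' : x = z
  · subst h'
    rw [hit₂_self, hit₃_of_or _ (Or.inr rfl), hitThen_self]
    have := hitThen_nonneg hp n x y x
    linarith
  have hn : ¬ (x = y ∨ x = z) := by tauto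
  induction n generalizing x y z with
  | zero => rw [hit₂_zero h, hit₂_zero h', hit₃_zero hn, hitThen_zero h, hitThen_zero h']; simp
  | succ n ih =>
    have ih' : ∀ x y z, hit₂ p n x y + hit₂ p n x z - hit₃ p n x y z
        ≤ hitThen p n x y z + hitThen p n x z y := by
      intro x y z
      by_cases h : x = y
      · subst h
        rw [hit₂_self, hit₃_of_or _ (Or.inl rfl), hitThen_self]
        have := hitThen_nonneg hp n x z x
        linarith
      by_cases h' : x = z
      · subst h'
        rw [hit₂_self, hit₃_of_or _ (Or.inr rfl), hitThen_self]
        have := hitThen_nonneg hp n x y x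
        linarith
      exact ih x y z h h' (by tauto)
    rw [hitThen_succ h, hitThen_succ h', hit₃_succ hp n hn]
    -- The two-chain probabilities are rewritten with a dummy third chain whose transition
    -- probabilities sum to one, so that all terms become sums over the same triples.
    have e1 : hit₂ p (n + 1) x y
        = ∑ a, ∑ b, ∑ c, p x a * p y b * p z c * hit₂ p n a b := by
      rw [hit₂_succ hp n h]
      refine Finset.sum_congr rfl fun a _ => Finset.sum_congr rfl fun b _ => ?_
      rw [← Finset.sum_mul, ← Finset.mul_sum, hp.sum_eq_one, mul_one]
    have e2 : hit₂ p (n + 1) x z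
        = ∑ a, ∑ b, ∑ c, p x a * p y b * p z c * hit₂ p n a c := by
      rw [hit₂_succ hp n h']
      refine Finset.sum_congr rfl fun a _ => ?_
      rw [Finset.sum_comm]
      refine Finset.sum_congr rfl fun c _ => ?_
      have : ∀ b, p x a * p y b * p z c * hit₂ p n a c
        = p y b * (p x a * p z c * hit₂ p n a c) := fun b => by ring
      simp only [this]
      rw [← Finset.sum_mul, hp.sum_eq_one, one_mul]
    have e3 : ∑ a, ∑ b, ∑ c, p x a * p z b * p y c * hitThen p n a b c
        = ∑ a, ∑ b, ∑ c, p x a * p y b * p z c * hitThen p n a c b := by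
      refine Finset.sum_congr rfl fun a _ => ?_
      rw [Finset.sum_comm]
      exact Finset.sum_congr rfl fun b _ => Finset.sum_congr rfl fun c _ => by ring
    rw [e1, e2, e3, ← Finset.sum_add_distrib, ← Finset.sum_sub_distrib, ← Finset.sum_add_distrib]
    refine Finset.sum_le_sum fun a _ => ?_
    rw [← Finset.sum_add_distrib, ← Finset.sum_sub_distrib, ← Finset.sum_add_distrib]
    refine Finset.sum_le_sum fun b _ => ?_
    rw [← Finset.sum_add_distrib, ← Finset.sum_sub_distrib, ← Finset.sum_add_distrib]
    refine Finset.sum_le_sum fun c _ => ?_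
    rw [← mul_add, ← mul_sub, ← mul_add]
    exact mul_le_mul_of_nonneg_left (ih' a b c)
      (mul_nonneg (mul_nonneg (hp.nonneg _ _) (hp.nonneg _ _)) (hp.nonneg _ _))

/-- When the first two chains meet, the third, started from `π` and independent of them, still has
law `π`. Hence the meeting that follows has conditional probability at most `c`, wherever the first
one happened. The bound is required for all `m ≤ n` because the time left is random. -/
theorem sum_hitThen_le (hp : IsStoch p) {π : V → ℝ} (hπ : π ᵥ* p = π) (n : ℕ) {c : ℝ}
    (hc : ∀ m ≤ n, ∀ x, ∑ z, π z * hit₂ p m x z ≤ c) (x y : V) :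
    ∑ z, π z * hitThen p n x y z ≤ c * hit₂ p n x y := by
  by_cases h : x = y
  · subst h
    simpa [hitThen_self, hit₂_self] using hc n le_rfl x
  induction n generalizing x y with
  | zero => simp [hitThen_zero h, hit₂_zero h]
  | succ n ih =>
    have ih' : ∀ x y, ∑ z, π z * hitThen p n x y z ≤ c * hit₂ p n x y := by
      intro x y
      by_cases h : x = y
      · subst h
        simpa [hitThen_self, hit₂_self] using hc n (Nat.le_succ n) x
      · exact ih (fun m hm => hc m (hm.trans (Nat.le_succ n))) x y h
    have e : ∑ z, π z * hitThen p (n + 1) x y z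
        = ∑ a, ∑ b, p x a * p y b * ∑ c, π c * hitThen p n a b c := by
      simp only [hitThen_succ h, Finset.mul_sum]
      rw [Finset.sum_comm]
      refine Finset.sum_congr rfl fun a _ => ?_
      rw [Finset.sum_comm]
      refine Finset.sum_congr rfl fun b _ => ?_
      rw [Finset.sum_comm]
      refine Finset.sum_congr rfl fun c _ => ?_
      have hπc : ∑ z, π z * p z c = π c := congrFun hπ c
      have : ∀ z, π z * (p x a * p y b * p z c * hitThen p n a b c)
        = π z * p z c * (p x a * p y b * hitThen p n a b c) := fun z => by ring
      simp only [this]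
      rw [← Finset.sum_mul, hπc]
      ring
    rw [e, hit₂_succ hp n h, Finset.mul_sum]
    refine Finset.sum_le_sum fun a _ => ?_
    rw [Finset.mul_sum]
    refine Finset.sum_le_sum fun b _ => ?_
    calc p x a * p y b * ∑ c, π c * hitThen p n a b c ≤ p x a * p y b * (c * hit₂ p n a b) :=
          mul_le_mul_of_nonneg_left (ih' a b) (mul_nonneg (hp.nonneg _ _) (hp.nonneg _ _))
      _ = _ := by ring

/-- Averaging `hit_both_le` over three stationary starts makes the two orders equally likely, and
`sum_hitThen_le` bounds each of them; this is the factor `2 * c`. -/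
theorem correlation_le (hp : IsStoch p) {π : V → ℝ} (hπ0 : 0 ≤ π) (hπ1 : ∑ v, π v = 1)
    (hπ : π ᵥ* p = π) (n : ℕ) {c : ℝ} (hc : ∀ x, ∑ z, π z * hit₂ p n x z ≤ c) :
    2 * (1 - prodLaw π 2 ⬝ᵥ avoid (prodK p 2) (diag₂ V) n 1)
        - (1 - prodLaw π 3 ⬝ᵥ avoid (prodK p 3) (diag₃ V) n 1)
      ≤ 2 * c * (1 - prodLaw π 2 ⬝ᵥ avoid (prodK p 2) (diag₂ V) n 1) := by
  have e2 : 1 - prodLaw π 2 ⬝ᵥ avoid (prodK p 2) (diag₂ V) n 1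
      = ∑ x, ∑ y, π x * π y * hit₂ p n x y := by
    rw [← prodLaw_one (k := 2) hπ1, ← dotProduct_sub, dotProduct, sum_fin_two]
    simp [prodLaw, hit₂, Fin.prod_univ_two]
  have e3 : 1 - prodLaw π 3 ⬝ᵥ avoid (prodK p 3) (diag₃ V) n 1
      = ∑ x, ∑ y, ∑ z, π x * π y * π z * hit₃ p n x y z := by
    rw [← prodLaw_one (k := 3) hπ1, ← dotProduct_sub, dotProduct, sum_fin_three]
    simp [prodLaw, hit₃, Fin.prod_univ_three]
  have hc' : ∀ m ≤ n, ∀ x, ∑ z, π z * hit₂ p m x z ≤ c := fun m hm x =>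
    (Finset.sum_le_sum fun z _ =>
      mul_le_mul_of_nonneg_left (hit₂_mono hp x z hm) (hπ0 z)).trans (hc x)
  have f1 : ∑ x, ∑ y, π x * π y * hit₂ p n x y
      = ∑ x, ∑ y, ∑ z, π x * π y * π z * hit₂ p n x y := by
    refine Finset.sum_congr rfl fun x _ => Finset.sum_congr rfl fun y _ => ?_
    rw [← Finset.sum_mul, ← Finset.mul_sum, hπ1, mul_one]
  have f2 : ∑ x, ∑ y, π x * π y * hit₂ p n x y
      = ∑ x, ∑ y, ∑ z, π x * π y * π z * hit₂ p n x z := by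
    rw [f1]
    refine Finset.sum_congr rfl fun x _ => ?_
    rw [Finset.sum_comm]
    exact Finset.sum_congr rfl fun y _ => Finset.sum_congr rfl fun z _ => by ring
  have g1 : ∑ x, ∑ y, ∑ z, π x * π y * π z * hitThen p n x y z
      ≤ c * ∑ x, ∑ y, π x * π y * hit₂ p n x y := by
    rw [Finset.mul_sum]
    refine Finset.sum_le_sum fun x _ => ?_
    rw [Finset.mul_sum]
    refine Finset.sum_le_sum fun y _ => ?_
    calc ∑ z, π x * π y * π z * hitThen p n x y z
        = π x * π y * ∑ z, π z * hitThen p n x y z := by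
          rw [Finset.mul_sum]
          exact Finset.sum_congr rfl fun z _ => by ring
      _ ≤ π x * π y * (c * hit₂ p n x y) :=
          mul_le_mul_of_nonneg_left (sum_hitThen_le hp hπ n hc' x y)
            (mul_nonneg (hπ0 x) (hπ0 y))
      _ = _ := by ring
  have g2 : ∑ x, ∑ y, ∑ z, π x * π y * π z * hitThen p n x z y
      = ∑ x, ∑ y, ∑ z, π x * π y * π z * hitThen p n x y z := by
    refine Finset.sum_congr rfl fun x _ => ?_
    rw [Finset.sum_comm]
    exact Finset.sum_congr rfl fun y _ => Finset.sum_congr rfl fun z _ => by ring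
  have g3 : ∑ x, ∑ y, ∑ z, π x * π y * π z * hit₂ p n x y
      + ∑ x, ∑ y, ∑ z, π x * π y * π z * hit₂ p n x z
      - ∑ x, ∑ y, ∑ z, π x * π y * π z * hit₃ p n x y z
      ≤ ∑ x, ∑ y, ∑ z, π x * π y * π z * hitThen p n x y z
        + ∑ x, ∑ y, ∑ z, π x * π y * π z * hitThen p n x z y := by
    simp only [← Finset.sum_add_distrib, ← Finset.sum_sub_distrib]
    refine Finset.sum_le_sum fun x _ => Finset.sum_le_sum fun y _ => Finset.sum_le_sum fun z _ => ?_
    rw [← mul_add, ← mul_sub, ← mul_add]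
    exact mul_le_mul_of_nonneg_left (hit_both_le hp n x y z)
      (mul_nonneg (mul_nonneg (hπ0 x) (hπ0 y)) (hπ0 z))
  rw [← f1, ← f2, g2] at g3
  rw [e2, e3]
  linarith

end Correlation

/-! ### From path measures to kernels on dyadic grids, and back by right-continuity. -/

section PathMeasure

open Matrix

variable {V : Type u} {k : ℕ}

theorem measurableSet_at_mem (t : ℝ≥0) (S : Set V) : MeasurableSet {w : StepPath V | w.at t ∈ S} :=
  (le_iSup (fun t : ℝ≥0 => MeasurableSpace.comap (fun w : StepPath V => w.at t) ⊤) t) _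
    ⟨S, trivial, rfl⟩

theorem measurableSet_at (t : ℝ≥0) (y : V) : MeasurableSet {w : StepPath V | w.at t = y} :=
  measurableSet_at_mem t {y}

theorem measurable_shift (T : ℝ≥0) : Measurable (StepPath.shift T : StepPath V → StepPath V) := by
  refine measurable_iff_comap_le.2 ?_
  rw [show (instMeasurableSpaceStepPath : MeasurableSpace (StepPath V))
    = ⨆ t : ℝ≥0, MeasurableSpace.comap (fun w : StepPath V => w.at t) ⊤ from rfl,
    MeasurableSpace.comap_iSup]
  refine iSup_le fun t => ?_
  rw [MeasurableSpace.comap_comp]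
  exact le_iSup (fun t : ℝ≥0 => MeasurableSpace.comap (fun w : StepPath V => w.at t) ⊤) (t + T)

theorem StepPath.eventually_at_eq (w : StepPath V) (s : ℝ≥0) :
    ∀ᶠ r in 𝓝[≥] s, w.at r = w.at s := by
  obtain ⟨t, h0, hmono, htop, hconst⟩ := w.2
  have hex : ∃ n, s < t n := (htop.eventually_gt_atTop s).exists
  classical
  obtain ⟨m, hm⟩ : ∃ m, Nat.find hex = m + 1 := by
    refine Nat.exists_eq_succ_of_ne_zero fun h => ?_
    have := Nat.find_spec hex
    rw [h, h0] at this
    exact absurd this not_lt_zero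
  have h1 : s < t (m + 1) := hm ▸ Nat.find_spec hex
  have h2 : t m ≤ s := not_lt.1 (Nat.find_min hex (by omega))
  filter_upwards [Ico_mem_nhdsGE h1] with r hr
  exact (hconst m r ⟨h2.trans hr.1, hr.2⟩).trans (hconst m s ⟨h2, h1⟩).symm

theorem eventually_at_eq (w : Fin k → StepPath V) (s : ℝ≥0) :
    ∀ᶠ r in 𝓝[≥] s, (fun i => (w i).at r) = fun i => (w i).at s := by
  filter_upwards [eventually_all.2 fun i => (w i).eventually_at_eq s] with r hr
  exact funext hr

/-- No visit of the walkers to `A` at the times `0, h, …, n h`. -/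
def gridAvoid (k : ℕ) (A : Set (Fin k → V)) (h : ℝ≥0) (n : ℕ) : Set (Fin k → StepPath V) :=
  {w | ∀ j ≤ n, (fun i => (w i).at (j • h)) ∉ A}

/-- No visit of the walkers to `A` up to time `t`. -/
def pathAvoid (k : ℕ) (A : Set (Fin k → V)) (t : ℝ≥0) : Set (Fin k → StepPath V) :=
  {w | ∀ s ≤ t, (fun i => (w i).at s) ∉ A}

/-- A visit at time `s` lasts on some interval `[s, b)`, and a fine enough dyadic grid has a point
there. Rounding `s` up stays within the horizon because `j • T` is itself a grid point. -/
theorem exists_grid_of_mem {A : Set (Fin k → V)} {w : Fin k → StepPath V} {s T : ℝ≥0} (hT : 0 < T)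
    {j : ℕ} (hs : s ≤ j • T) (hA : (fun i => (w i).at s) ∈ A) :
    ∃ n, ∃ i ≤ j * 2 ^ n, (fun l => (w l).at (i • (T / 2 ^ n))) ∈ A := by
  obtain ⟨b, hb, hb'⟩ := (mem_nhdsGE_iff_exists_Ico_subset).1 (eventually_at_eq w s)
  have hsb : s < b := hb
  obtain ⟨n, hn⟩ : ∃ n : ℕ, T / 2 ^ n < b - s := by
    have h1 : Tendsto (fun n : ℕ => T * (1 / 2 : ℝ≥0) ^ n) atTop (𝓝 (T * 0)) :=
      (NNReal.tendsto_pow_atTop_nhds_zero_of_lt_one (by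
        rw [div_lt_one (by norm_num)]; norm_num)).const_mul T
    rw [mul_zero] at h1
    obtain ⟨n, hn⟩ := (h1.eventually (gt_mem_nhds (tsub_pos_of_lt hsb))).exists
    exact ⟨n, by simpa [div_eq_mul_inv] using hn⟩
  have hh : 0 < T / 2 ^ n := by positivity
  refine ⟨n, ⌈s / (T / 2 ^ n)⌉₊, ?_, ?_⟩
  · rw [Nat.ceil_le, div_le_iff₀ hh]
    refine hs.trans (le_of_eq ?_)
    push_cast
    rw [nsmul_eq_mul]
    field_simp
  · have h1 : s ≤ ⌈s / (T / 2 ^ n)⌉₊ • (T / 2 ^ n) := by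
      rw [nsmul_eq_mul, ← div_le_iff₀ hh]
      exact Nat.le_ceil _
    have h2 : ⌈s / (T / 2 ^ n)⌉₊ • (T / 2 ^ n) < b := by
      have := Nat.ceil_lt_add_one (a := s / (T / 2 ^ n)) (by positivity)
      have h3 : (⌈s / (T / 2 ^ n)⌉₊ : ℝ≥0) * (T / 2 ^ n) < s + T / 2 ^ n := by
        calc _ < (s / (T / 2 ^ n) + 1) * (T / 2 ^ n) := mul_lt_mul_of_pos_right this hh
          _ = _ := by rw [add_mul, one_mul, div_mul_cancel₀ _ hh.ne']
      rw [nsmul_eq_mul]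
      refine h3.trans ?_
      rw [add_comm]
      exact lt_tsub_iff_right.1 hn
    have := hb' ⟨h1, h2⟩
    simp only [Set.mem_ofPred_eq] at this
    rwa [this]

theorem pathAvoid_eq_iInter (A : Set (Fin k → V)) {T : ℝ≥0} (hT : 0 < T) (j : ℕ) :
    pathAvoid k A (j • T) = ⋂ n, gridAvoid k A (T / 2 ^ n) (j * 2 ^ n) := by
  ext w
  simp only [Set.mem_iInter]
  constructor
  · intro h n i hi
    refine h _ ?_
    have : (i : ℝ≥0) ≤ j * 2 ^ n := by exact_mod_cast hi
    calc i • (T / 2 ^ n) ≤ (j * 2 ^ n) * (T / 2 ^ n) := by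
          rw [nsmul_eq_mul]; gcongr
      _ = j • T := by rw [nsmul_eq_mul]; field_simp
  · intro h s hs hA
    obtain ⟨n, i, hi, hiA⟩ := exists_grid_of_mem hT hs hA
    exact h n i hi hiA

/-- Dyadic grids are nested, so the grid events decrease and continuity from above applies to their
intersection. -/
theorem gridAvoid_antitone (A : Set (Fin k → V)) (T : ℝ≥0) (j : ℕ) :
    Antitone fun n => gridAvoid k A (T / 2 ^ n) (j * 2 ^ n) := by
  refine antitone_nat_of_succ_le fun n w h i hi => ?_
  have := h (2 * i) (by rw [pow_succ]; nlinarith)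
  convert this using 4
  simp only [nsmul_eq_mul]
  push_cast
  field_simp
  ring

theorem measurableSet_vec_mem [Finite V] (A : Set (Fin k → V)) (t : ℝ≥0) :
    MeasurableSet {w : Fin k → StepPath V | (fun i => (w i).at t) ∈ A} := by
  have : {w : Fin k → StepPath V | (fun i => (w i).at t) ∈ A}
      = ⋃ a ∈ A, Set.univ.pi fun i => {w | w.at t = a i} := by
    ext w
    simp only [Set.mem_ofPred_eq, Set.mem_iUnion, Set.mem_pi, Set.mem_univ, true_implies,
      exists_prop]
    exact ⟨fun h => ⟨_, h, fun _ => rfl⟩, fun ⟨a, ha, h⟩ => by rwa [funext h]⟩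
  rw [this]
  exact MeasurableSet.biUnion (Set.to_countable A) fun a _ =>
    MeasurableSet.univ_pi fun i => measurableSet_at t (a i)

theorem measurableSet_gridAvoid [Finite V] (A : Set (Fin k → V)) (h : ℝ≥0) (n : ℕ) :
    MeasurableSet (gridAvoid k A h n) := by
  have : gridAvoid k A h n = ⋂ j ≤ n, {w : Fin k → StepPath V | (fun i => (w i).at (j • h)) ∈ A}ᶜ :=
    by ext w; simp [gridAvoid]
  rw [this]
  exact MeasurableSet.iInter fun j => MeasurableSet.iInter fun _ =>
    (measurableSet_vec_mem A _).compl

variable [Fintype V]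

/-- The transition probabilities. -/
noncomputable def trans (P : V → Measure (StepPath V)) (t : ℝ≥0) : Matrix V V ℝ :=
  fun x y => (P x).real {w | w.at t = y}

variable {q : V → V → ℝ≥0} {P : V → Measure (StepPath V)}

theorem measure_shift_preimage (hP : IsMarkovChain q P) (T : ℝ≥0) {S : Set (StepPath V)}
    (hS : MeasurableSet S) (x : V) :
    P x (StepPath.shift T ⁻¹' S) = ∑ y, P x {w | w.at T = y} * P y S := by
  have h := hP.markov x T Set.univ S MeasurableSet.univ hS
  rw [Set.univ_inter, Measure.restrict_univ] at h
  rw [h]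
  have e : ∀ w : StepPath V, P (w.at T) S
      = ∑ y, ({w : StepPath V | w.at T = y}).indicator (fun _ => P y S) w := by
    intro w
    rw [Finset.sum_eq_single (w.at T)]
    · simp
    · intro y _ hy
      simp [Ne.symm hy]
    · simp
  simp only [e]
  rw [lintegral_finsetSum _ fun y _ => measurable_const.indicator (measurableSet_at T y)]
  refine Finset.sum_congr rfl fun y _ => ?_
  rw [lintegral_indicator_const (measurableSet_at T y), mul_comm]

theorem sum_trans (hP : IsMarkovChain q P) (t : ℝ≥0) (x : V) : ∑ y, trans P t x y = 1 := by
  have := hP.prob x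
  have h : ∑ y, (P x) {w | w.at t = y} = 1 := by
    rw [← measure_biUnion_finset]
    · rw [← measure_univ (μ := P x)]
      congr 1
      ext w
      simp
    · intro a _ b _ hab
      exact Set.disjoint_left.2 fun w (h1 : w.at t = a) (h2 : w.at t = b) => hab (h1.symm.trans h2)
    · exact fun y _ => measurableSet_at t y
  simp only [trans, Measure.real]
  rw [← ENNReal.toReal_sum fun y _ => measure_ne_top _ _, h, ENNReal.toReal_one]

theorem trans_zero (hP : IsMarkovChain q P) (x : V) : trans P 0 x x = 1 := by
  simp [trans, Measure.real, hP.start x]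

theorem trans_nonneg (t : ℝ≥0) (x y : V) : 0 ≤ trans P t x y := measureReal_nonneg

theorem trans_semigroup (hP : IsMarkovChain q P) : IsSemigroup (trans P) where
  stoch t := ⟨fun x y => trans_nonneg t x y, sum_trans hP t⟩
  zero φ := by
    classical
    have h0 : ∀ x y, x ≠ y → trans P 0 x y = 0 := by
      intro x y hxy
      have h1 := sum_trans hP 0 x
      rw [← Finset.add_sum_erase _ _ (Finset.mem_univ x), trans_zero hP] at h1
      have h2 : ∑ y ∈ Finset.univ.erase x, trans P 0 x y = 0 := by linarith
      exact (Finset.sum_eq_zero_iff_of_nonneg fun y _ => trans_nonneg 0 x y).1 h2 y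
        (Finset.mem_erase.2 ⟨hxy.symm, Finset.mem_univ y⟩)
    ext x
    rw [mulVec, dotProduct, Finset.sum_eq_single x]
    · rw [trans_zero hP, one_mul]
    · intro y _ hy
      rw [h0 x y hy.symm, zero_mul]
    · simp
  add s t := by
    ext x y
    have := hP.prob
    have h := measure_shift_preimage hP s (measurableSet_at t y) x
    have e : StepPath.shift s ⁻¹' {w : StepPath V | w.at t = y} = {w | w.at (s + t) = y} := by
      ext w
      simp [StepPath.shift, StepPath.at, add_comm]
    rw [e] at h
    simp only [Matrix.mul_apply, trans, Measure.real]
    rw [h, ENNReal.toReal_sum fun z _ => ENNReal.mul_ne_top (measure_ne_top _ _)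
      (measure_ne_top _ _)]
    simp only [ENNReal.toReal_mul]

/-- The law of independent walkers started at `x`. -/
noncomputable abbrev walkers (P : V → Measure (StepPath V)) (x : Fin k → V) :
    Measure (Fin k → StepPath V) :=
  Measure.pi fun i => P (x i)

/-- A product of mixtures is the mixture of the products. This gives the Markov property of the `k`
walkers from that of one, and identifies stationary walkers with a product measure. -/
theorem pi_sum_smul [∀ x, IsProbabilityMeasure (P x)] (a : Fin k → V → ℝ≥0∞)
    (ha : ∀ i, IsProbabilityMeasure (∑ v, a i v • P v)) :
    Measure.pi (fun i => ∑ v, a i v • P v) = ∑ x : Fin k → V, (∏ i, a i (x i)) • walkers P x := by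
  refine (Measure.pi_eq fun s hs => ?_)
  simp only [Measure.coe_finsetSum, Finset.sum_apply, Measure.smul_apply, smul_eq_mul,
    Measure.pi_pi]
  rw [Finset.prod_univ_sum, Fintype.piFinset_univ]
  simp only [Finset.prod_mul_distrib]

theorem map_shift (hP : IsMarkovChain q P) (T : ℝ≥0) (x : V) :
    (P x).map (StepPath.shift T) = ∑ y, P x {w | w.at T = y} • P y := by
  ext S hS
  rw [Measure.map_apply (measurable_shift T) hS, measure_shift_preimage hP T hS]
  simp

theorem walkers_shift (hP : IsMarkovChain q P) (T : ℝ≥0) (x : Fin k → V)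
    {S : Set (Fin k → StepPath V)} (hS : MeasurableSet S) :
    (walkers P x).real ((fun w i => (w i).shift T) ⁻¹' S)
      = ∑ y, prodK (trans P T) k x y * (walkers P y).real S := by
  have := hP.prob
  have hm : Measurable fun (w : Fin k → StepPath V) i => (w i).shift T :=
    measurable_pi_lambda _ fun i => (measurable_shift T).comp (measurable_pi_apply i)
  have hpr : ∀ i, IsProbabilityMeasure ((P (x i)).map (StepPath.shift T)) := fun i =>
    Measure.isProbabilityMeasure_map (measurable_shift T).aemeasurable
  have e : (walkers P x).map (fun w i => (w i).shift T)
      = ∑ y : Fin k → V, (∏ i, P (x i) {w | w.at T = y i}) • walkers P y := by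
    rw [← pi_sum_smul (fun i v => P (x i) {w | w.at T = v}) fun i => by
      rw [← map_shift hP]; exact hpr i]
    have h := Measure.pi_map_pi (μ := fun i => P (x i))
      (f := fun _ => (StepPath.shift T : StepPath V → StepPath V))
      (hμ := fun i => by have := hpr i; infer_instance) fun i => (measurable_shift T).aemeasurable
    simpa only [map_shift hP] using h
  rw [Measure.real, ← Measure.map_apply hm hS, e]
  simp only [Measure.coe_finsetSum, Finset.sum_apply, Measure.smul_apply, smul_eq_mul]
  rw [ENNReal.toReal_sum fun y _ => ENNReal.mul_ne_top
    (ENNReal.prod_ne_top fun i _ => measure_ne_top _ _) (measure_ne_top _ _)]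
  simp only [ENNReal.toReal_mul, ENNReal.toReal_prod]
  rfl

theorem walkers_start (hP : IsMarkovChain q P) (x : Fin k → V) :
    ∀ᵐ w ∂walkers P x, (fun i => (w i).at 0) = x := by
  have := hP.prob
  have h1 : walkers P x (Set.univ.pi fun i => {w : StepPath V | w.at 0 = x i}) = 1 := by
    rw [Measure.pi_pi]
    simp [hP.start]
  have h2 : MeasurableSet (Set.univ.pi fun i => {w : StepPath V | w.at 0 = x i}) :=
    MeasurableSet.univ_pi fun i => measurableSet_at 0 (x i)
  filter_upwards [(prob_compl_eq_zero_iff h2).2 h1 |> compl_mem_ae_iff.2] with w hw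
  rw [compl_compl] at *
  exact funext fun i => by simpa using hw i (Set.mem_univ i)

theorem walkers_gridAvoid (hP : IsMarkovChain q P) (A : Set (Fin k → V)) (h : ℝ≥0) (n : ℕ)
    (x : Fin k → V) :
    (walkers P x).real (gridAvoid k A h n) = avoid (prodK (trans P h) k) A n 1 x := by
  have := hP.prob
  induction n generalizing x with
  | zero =>
    by_cases hx : x ∈ A
    · have : (walkers P x) (gridAvoid k A h 0) = 0 := by
        rw [measure_eq_zero_iff_ae_notMem]
        filter_upwards [walkers_start hP x] with w hw hw'
        have := hw' 0 le_rfl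
        rw [zero_smul, hw] at this
        exact this hx
      simp [Measure.real, this, avoid, hx]
    · have : (walkers P x) (gridAvoid k A h 0) = 1 := by
        rw [← measure_univ (μ := walkers P x)]
        refine measure_congr (eventuallyEq_set.2 ?_)
        filter_upwards [walkers_start hP x] with w hw
        refine ⟨fun _ => trivial, fun _ j hj => ?_⟩
        rw [Nat.le_zero.1 hj, zero_smul, hw]
        exact hx
      simp [Measure.real, this, avoid, hx]
  | succ n ih =>
    by_cases hx : x ∈ A
    · have : (walkers P x) (gridAvoid k A h (n + 1)) = 0 := by
        rw [measure_eq_zero_iff_ae_notMem]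
        filter_upwards [walkers_start hP x] with w hw hw'
        have := hw' 0 (Nat.zero_le _)
        rw [zero_smul, hw] at this
        exact this hx
      simp [Measure.real, this, avoid, hx]
    · have e : (walkers P x).real (gridAvoid k A h (n + 1))
          = (walkers P x).real ((fun w i => (w i).shift h) ⁻¹' gridAvoid k A h n) := by
        unfold Measure.real
        congr 1
        refine measure_congr (eventuallyEq_set.2 ?_)
        filter_upwards [walkers_start hP x] with w hw
        have e1 : ∀ j : ℕ, (fun i => ((w i).shift h).at (j • h))
            = fun i => (w i).at ((j + 1) • h) := fun j => funext fun i => by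
          simp [StepPath.shift, StepPath.at, add_smul]
        constructor
        · intro hw' j hj
          simp only [e1]
          exact hw' (j + 1) (by omega)
        · intro hw' j hj
          cases j with
          | zero => rw [zero_smul, hw]; exact hx
          | succ j =>
            rw [← e1]
            exact hw' j (by omega)
      rw [e, walkers_shift hP h x (measurableSet_gridAvoid A h n)]
      simp [avoid, hx, mulVec, dotProduct, ih]

/-- The probability that the walkers started at `x` do not visit `A` up to time `t`. -/
noncomputable def surv (P : V → Measure (StepPath V)) (A : Set (Fin k → V)) (t : ℝ≥0)
    (x : Fin k → V) : ℝ :=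
  (walkers P x).real (pathAvoid k A t)

/-- The bridge by which the discrete inequalities become inequalities for the process. Horizons are
multiples of a fixed `T` so that several of them lie on the same dyadic grids. -/
theorem tendsto_surv (hP : IsMarkovChain q P) (A : Set (Fin k → V)) {T : ℝ≥0} (hT : 0 < T) (j : ℕ)
    (x : Fin k → V) :
    Tendsto (fun n : ℕ => avoid (prodK (trans P (T / 2 ^ n)) k) A (j * 2 ^ n) 1 x) atTop
      (𝓝 (surv P A (j • T) x)) := by
  have := hP.prob
  simp only [← walkers_gridAvoid hP]
  unfold surv Measure.real
  rw [pathAvoid_eq_iInter A hT]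
  refine (ENNReal.tendsto_toReal (measure_ne_top _ _)).comp ?_
  exact tendsto_measure_iInter_atTop
    (fun n => (measurableSet_gridAvoid A _ _).nullMeasurableSet) (gridAvoid_antitone A T j)
    ⟨0, measure_ne_top _ _⟩

end PathMeasure

/-! ### Survival inequalities in continuous time. -/

section Survival

open Matrix

variable {V : Type u} [Fintype V] {k : ℕ} {q : V → V → ℝ≥0} {P : V → Measure (StepPath V)}
  {π : PMF V}

theorem sum_pmf {W : Type*} [Fintype W] (ν : PMF W) : ∑ x, ν x = 1 := by
  have := ν.tsum_coe
  rwa [tsum_fintype] at this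

/-- The weights of a PMF as real numbers. -/
noncomputable def weights {W : Type*} (ν : W → ℝ≥0∞) : W → ℝ := fun x => (ν x).toReal

theorem weights_nonneg {W : Type*} (ν : W → ℝ≥0∞) : 0 ≤ weights ν := fun _ => ENNReal.toReal_nonneg

theorem sum_weights {W : Type*} [Fintype W] (ν : PMF W) : ∑ x, weights ν x = 1 := by
  simp only [weights]
  rw [← ENNReal.toReal_sum fun x _ => ν.apply_ne_top x, sum_pmf, ENNReal.toReal_one]

theorem isProbabilityMeasure_sum_smul {Ω W : Type*} [MeasurableSpace Ω] [Fintype W]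
    (Q : W → Measure Ω) (hQ : ∀ x, IsProbabilityMeasure (Q x)) {ν : W → ℝ≥0∞}
    (hν : ∑ x, ν x = 1) : IsProbabilityMeasure (∑ x, ν x • Q x) :=
  ⟨by simp [hν]⟩

theorem isProbabilityMeasure_chainFrom (hP : IsMarkovChain q P) (ν : PMF V) :
    IsProbabilityMeasure (chainFrom P ν) :=
  isProbabilityMeasure_sum_smul _ hP.prob (sum_pmf ν)

theorem isProbabilityMeasure_walkersFrom (hP : IsMarkovChain q P) {ν : (Fin k → V) → ℝ≥0∞}
    (hν : ∑ x, ν x = 1) : IsProbabilityMeasure (walkersFrom P ν) := by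
  have := hP.prob
  exact isProbabilityMeasure_sum_smul _ (fun x => inferInstance) hν

theorem walkersFrom_real (hP : IsMarkovChain q P) {ν : (Fin k → V) → ℝ≥0∞}
    (hν : ∀ x, ν x ≠ ∞) (S : Set (Fin k → StepPath V)) :
    (walkersFrom P ν).real S = ∑ x, weights ν x * (walkers P x).real S := by
  have := hP.prob
  simp only [walkersFrom, Measure.real, Measure.coe_finsetSum, Finset.sum_apply,
    Measure.smul_apply, smul_eq_mul, weights]
  rw [ENNReal.toReal_sum fun x _ => ENNReal.mul_ne_top (hν x) (measure_ne_top _ _)]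
  simp only [ENNReal.toReal_mul]

theorem walkersFrom_prod (hP : IsMarkovChain q P) (ν : PMF V) :
    walkersFrom P (fun x : Fin k → V => ∏ i, ν (x i)) = Measure.pi fun _ => chainFrom P ν := by
  have := hP.prob
  exact (pi_sum_smul (fun (_ : Fin k) v => ν v) fun i =>
    isProbabilityMeasure_chainFrom hP ν).symm

theorem weights_prod (ν : PMF V) :
    weights (fun x : Fin k → V => ∏ i, ν (x i)) = prodLaw (weights ν) k := by
  ext x
  simp [weights, prodLaw, ENNReal.toReal_prod]

theorem weights_stationary (hP : IsMarkovChain q P) (hM : IsMixing P π) (t : ℝ≥0) :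
    weights π ᵥ* trans P t = weights π := by
  have := hP.prob
  have h0 := (trans_semigroup hP).zero
  have e : ∀ (s : ℝ≥0) (y : V), (chainFrom P π {w | w.at s = y}).toReal
      = (weights π ᵥ* trans P s) y := by
    intro s y
    simp only [chainFrom, Measure.coe_finsetSum, Finset.sum_apply, Measure.smul_apply,
      smul_eq_mul, vecMul, dotProduct, weights, trans, Measure.real]
    rw [ENNReal.toReal_sum fun x _ => ENNReal.mul_ne_top (π.apply_ne_top x) (measure_ne_top _ _)]
    simp only [ENNReal.toReal_mul]
  ext y
  have h := hM.stationary t _ (measurableSet_at 0 y)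
  have e1 : StepPath.shift t ⁻¹' {w : StepPath V | w.at 0 = y} = {w | w.at t = y} := by
    ext w
    simp [StepPath.shift, StepPath.at]
  rw [e1] at h
  rw [← e, h, e, vecMul, dotProduct, Finset.sum_eq_single y]
  · rw [trans_zero hP, mul_one]
  · intro x _ hx
    rw [(trans_semigroup hP).zero_ne hx, mul_zero]
  · simp

theorem surv_nonneg (A : Set (Fin k → V)) (t : ℝ≥0) : 0 ≤ surv P A t := fun _ => measureReal_nonneg

theorem surv_le_one (hP : IsMarkovChain q P) (A : Set (Fin k → V)) (t : ℝ≥0) :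
    surv P A t ≤ 1 := fun _ => by
  have := hP.prob
  exact measureReal_le_one

theorem surv_antitone (hP : IsMarkovChain q P) (A : Set (Fin k → V)) :
    Antitone (surv P A) := fun s t h x => by
  have := hP.prob
  exact measureReal_mono fun w hw r hr => hw r (hr.trans h)

/-- The probability that stationary walkers do not visit `A` up to time `t`. -/
noncomputable def statSurv (P : V → Measure (StepPath V)) (π : PMF V) (A : Set (Fin k → V))
    (t : ℝ≥0) : ℝ :=
  prodLaw (weights π) k ⬝ᵥ surv P A t

theorem prodLaw_weights_one : prodLaw (weights π) k ⬝ᵥ 1 = 1 := prodLaw_one (sum_weights π)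

theorem statSurv_nonneg (A : Set (Fin k → V)) (t : ℝ≥0) : 0 ≤ statSurv P π A t :=
  Finset.sum_nonneg fun x _ =>
    mul_nonneg (prodLaw_nonneg (weights_nonneg π) x) (surv_nonneg A t x)

theorem statSurv_antitone (hP : IsMarkovChain q P) (A : Set (Fin k → V)) :
    Antitone (statSurv P π A) := fun _ _ h =>
  dotProduct_le_dotProduct_of_nonneg_left (surv_antitone hP A h)
    (prodLaw_nonneg (weights_nonneg π))

theorem statSurv_le_one (hP : IsMarkovChain q P) (A : Set (Fin k → V)) (t : ℝ≥0) :
    statSurv P π A t ≤ 1 := by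
  rw [← prodLaw_weights_one (π := π) (k := k)]
  exact dotProduct_le_dotProduct_of_nonneg_left (surv_le_one hP A t)
    (prodLaw_nonneg (weights_nonneg π))

theorem tendsto_statSurv (hP : IsMarkovChain q P) (A : Set (Fin k → V)) {T : ℝ≥0} (hT : 0 < T)
    (j : ℕ) :
    Tendsto (fun n : ℕ => prodLaw (weights π) k ⬝ᵥ
        avoid (prodK (trans P (T / 2 ^ n)) k) A (j * 2 ^ n) 1) atTop
      (𝓝 (statSurv P π A (j • T))) :=
  tendsto_finsetSum _ fun x _ => (tendsto_surv hP A hT j x).const_mul _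

theorem mixesTo_trans (hP : IsMarkovChain q P) {T : ℝ≥0} {a : ℕ} {D : ℝ}
    (hD : ∀ x, tvAt P π x (a • T) ≤ D) (n : ℕ) :
    MixesTo (prodK (trans P (T / 2 ^ n)) k) (prodLaw (weights π) k) (a * 2 ^ n) (k * D) := by
  refine mixesTo_prod (trans_semigroup hP) (weights_nonneg π) (sum_weights π) _ _ fun x => ?_
  have e : (a * 2 ^ n) • (T / 2 ^ n) = a • T := by
    simp only [nsmul_eq_mul]
    push_cast
    field_simp
  rw [e]
  exact hD x

variable {T : ℝ≥0} {A : Set (Fin k → V)}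

theorem surv_le_mul (hP : IsMarkovChain q P) (hT : 0 < T) {a : ℕ} {D : ℝ}
    (hD : ∀ x, tvAt P π x (a • T) ≤ D) (t v : ℕ) (x : Fin k → V) :
    surv P A ((t + (a + v)) • T) x
      ≤ surv P A (t • T) x * (statSurv P π A (v • T) + k * D) := by
  refine le_of_tendsto_of_tendsto' (tendsto_surv hP A hT _ x)
    ((tendsto_surv hP A hT t x).mul ((tendsto_statSurv hP A hT v).add_const _)) fun n => ?_
  have := surv_upper (A := A) (prodK_stoch ((trans_semigroup hP).stoch (T / 2 ^ n)))
    (mixesTo_trans (k := k) hP hD n) (t * 2 ^ n) (v * 2 ^ n) x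
  simpa only [add_mul] using this

theorem le_surv (hP : IsMarkovChain q P) (hT : 0 < T) {a : ℕ} {D : ℝ}
    (hD : ∀ x, tvAt P π x (a • T) ≤ D) (v : ℕ) (x : Fin k → V) :
    surv P A (a • T) x - (1 - statSurv P π A (v • T)) - k * D ≤ surv P A ((a + v) • T) x := by
  refine le_of_tendsto_of_tendsto' (((tendsto_surv hP A hT a x).sub
    ((tendsto_statSurv hP A hT v).const_sub 1)).sub_const _) (tendsto_surv hP A hT _ x) fun n => ?_
  have := surv_base (A := A) (prodK_stoch ((trans_semigroup hP).stoch (T / 2 ^ n)))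
    (mixesTo_trans (k := k) hP hD n) (v * 2 ^ n) x
  simpa only [add_mul] using this

theorem mul_sub_mul_le_surv (hP : IsMarkovChain q P) (hT : 0 < T) {a : ℕ} {D : ℝ}
    (hD : ∀ x, tvAt P π x (a • T) ≤ D) (t v : ℕ) (x : Fin k → V) :
    surv P A ((t + a) • T) x * (statSurv P π A (v • T) - k * D)
        - surv P A (t • T) x * (1 - statSurv P π A (a • T) + k * D)
      ≤ surv P A ((t + a + (a + v)) • T) x := by
  refine le_of_tendsto_of_tendsto'
    (((tendsto_surv hP A hT (t + a) x).mul ((tendsto_statSurv hP A hT v).sub_const _)).sub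
      ((tendsto_surv hP A hT t x).mul (((tendsto_statSurv hP A hT a).const_sub 1).add_const _)))
    (tendsto_surv hP A hT _ x) fun n => ?_
  have := surv_lower (A := A) (prodK_stoch ((trans_semigroup hP).stoch (T / 2 ^ n)))
    (mixesTo_trans (k := k) hP hD n) prodLaw_weights_one (t * 2 ^ n) (v * 2 ^ n) x
  simpa only [add_mul] using this

theorem statSurv_subadd (hP : IsMarkovChain q P) (hM : IsMixing P π) (hT : 0 < T) (a b : ℕ) :
    1 - statSurv P π A ((a + b) • T)
      ≤ (1 - statSurv P π A (a • T)) + (1 - statSurv P π A (b • T)) := by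
  refine le_of_tendsto_of_tendsto' ((tendsto_statSurv hP A hT _).const_sub 1)
    (((tendsto_statSurv hP A hT a).const_sub 1).add ((tendsto_statSurv hP A hT b).const_sub 1))
    fun n => ?_
  have := stat_subadd (A := A) (prodK_stoch ((trans_semigroup hP).stoch (T / 2 ^ n)))
    (prodLaw_nonneg (k := k) (weights_nonneg π))
    (prodLaw_vecMul (weights_stationary hP hM (T / 2 ^ n))) prodLaw_weights_one
    (a * 2 ^ n) (b * 2 ^ n)
  simpa only [add_mul] using this

/-- The probability that a walker started at `x` and a stationary walker meet by time `t`. -/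
noncomputable def hitFrom (P : V → Measure (StepPath V)) (π : PMF V) (t : ℝ≥0) (x : V) : ℝ :=
  ∑ z, weights π z * (1 - surv P (diag₂ V) t ![x, z])

theorem surv_le_grid (hP : IsMarkovChain q P) (A : Set (Fin k → V)) (hT : 0 < T) (j n : ℕ)
    (x : Fin k → V) :
    surv P A (j • T) x ≤ avoid (prodK (trans P (T / 2 ^ n)) k) A (j * 2 ^ n) 1 x := by
  have := hP.prob
  rw [← walkers_gridAvoid hP, surv, pathAvoid_eq_iInter A hT]
  exact measureReal_mono (Set.iInter_subset _ n)

/-- The discrete estimate applies on every grid with the same `c`, because walkers observed only at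
grid times are seen to meet less often. -/
theorem statSurv_correlation (hP : IsMarkovChain q P) (hM : IsMixing P π) (hT : 0 < T) (j : ℕ)
    {c : ℝ} (hc : ∀ x, hitFrom P π (j • T) x ≤ c) :
    2 * (1 - statSurv P π (diag₂ V) (j • T)) - (1 - statSurv P π (diag₃ V) (j • T))
      ≤ 2 * c * (1 - statSurv P π (diag₂ V) (j • T)) := by
  refine le_of_tendsto_of_tendsto'
    ((((tendsto_statSurv hP (diag₂ V) hT j).const_sub 1).const_mul 2).sub
      ((tendsto_statSurv hP (diag₃ V) hT j).const_sub 1))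
    (((tendsto_statSurv hP (diag₂ V) hT j).const_sub 1).const_mul (2 * c)) fun n => ?_
  refine correlation_le ((trans_semigroup hP).stoch _) (weights_nonneg π) (sum_weights π)
    (weights_stationary hP hM _) _ fun x => (Finset.sum_le_sum fun z _ => ?_).trans (hc x)
  exact mul_le_mul_of_nonneg_left (sub_le_sub_left (surv_le_grid hP _ hT j n _) 1)
    (weights_nonneg π z)

theorem one_sub_statSurv_two : 1 - statSurv P π (diag₂ V) T
    = ∑ x, weights π x * hitFrom P π T x := by
  rw [← prodLaw_weights_one (π := π) (k := 2), statSurv, ← dotProduct_sub, dotProduct, sum_fin_two]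
  simp [prodLaw, hitFrom, Fin.prod_univ_two, Finset.mul_sum, mul_assoc]

theorem hitFrom_nonneg (hP : IsMarkovChain q P) (t : ℝ≥0) (x : V) : 0 ≤ hitFrom P π t x :=
  Finset.sum_nonneg fun z _ =>
    mul_nonneg (weights_nonneg π z) (sub_nonneg.2 (surv_le_one hP _ t _))

/-- After time `a • T` the pair is nearly stationary, so the start matters only for meetings before
that. The term `2 * D` is the mixing error of two walkers. -/
theorem hitFrom_add_le (hP : IsMarkovChain q P) (hT : 0 < T) {a : ℕ} {D : ℝ}
    (hD : ∀ x, tvAt P π x (a • T) ≤ D) (v : ℕ) (x : V) :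
    hitFrom P π ((a + v) • T) x
      ≤ hitFrom P π (a • T) x + (1 - statSurv P π (diag₂ V) (v • T)) + 2 * D := by
  have h1 := sum_weights π
  have h2 : ∀ z, weights π z * (1 - surv P (diag₂ V) ((a + v) • T) ![x, z])
      ≤ weights π z * (1 - surv P (diag₂ V) (a • T) ![x, z])
        + weights π z * (1 - statSurv P π (diag₂ V) (v • T) + 2 * D) := by
    intro z
    rw [← mul_add]
    have := le_surv (A := diag₂ V) hP hT hD v ![x, z]
    refine mul_le_mul_of_nonneg_left ?_ (weights_nonneg π z)
    push_cast at this
    linarith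
  refine (Finset.sum_le_sum fun z _ => h2 z).trans (le_of_eq ?_)
  rw [Finset.sum_add_distrib, ← Finset.sum_mul, h1, hitFrom]
  ring

end Survival

/-! ### From one pair to `k` walkers: union bound and Bonferroni. -/

section Pairs

open Matrix ProbabilityTheory

/-- Adding an event to a union of `s.card` others loses at most `s.card * c` by overlap, and these
losses add up by Pascal's rule. -/
theorem bonferroni {Ω ι : Type*} [MeasurableSpace Ω] {μ : Measure Ω} [IsProbabilityMeasure μ]
    (E : ι → Set Ω) (hE : ∀ i, MeasurableSet (E i)) {c : ℝ} (s : Finset ι)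
    (hc : ∀ i ∈ s, ∀ j ∈ s, i ≠ j → μ.real (E i ∩ E j) ≤ c) :
    ∑ i ∈ s, μ.real (E i) - (s.card.choose 2 : ℝ) * c ≤ μ.real (⋃ i ∈ s, E i) := by
  classical
  induction s using Finset.induction_on with
  | empty => simp
  | insert a s ha ih =>
    have ih' := ih fun i hi j hj => hc i (Finset.mem_insert_of_mem hi) j (Finset.mem_insert_of_mem hj)
    have hm : MeasurableSet (⋃ i ∈ s, E i) :=
      MeasurableSet.biUnion s.countable_toSet fun i _ => hE i
    have h1 := measureReal_union_add_inter (μ := μ) (s := E a) hm (measure_ne_top _ _)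
      (measure_ne_top _ _)
    have h2 : μ.real (E a ∩ ⋃ i ∈ s, E i) ≤ s.card * c := by
      rw [Set.inter_iUnion₂]
      refine (measureReal_biUnion_finset_le s fun i => E a ∩ E i).trans ?_
      refine (Finset.sum_le_card_nsmul s _ c fun i hi => ?_).trans (le_of_eq (nsmul_eq_mul _ _))
      exact hc a (Finset.mem_insert_self _ _) i (Finset.mem_insert_of_mem hi)
        fun h => ha (h ▸ hi)
    rw [Finset.set_biUnion_insert, Finset.sum_insert ha, Finset.card_insert_of_notMem ha,
      Nat.choose_succ_succ' _ 1, Nat.choose_one_right]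
    push_cast
    linarith

theorem card_pairs (k : ℕ) :
    (Finset.univ.filter fun e : Fin k × Fin k => e.1 < e.2).card = k.choose 2 := by
  have h : (Finset.univ.filter fun e : Fin k × Fin k => e.1 < e.2)
      = (Finset.univ : Finset (Fin k)).biUnion fun i => (Finset.Ioi i).map
        ⟨fun j => (i, j), fun _ _ h => (Prod.mk.inj h).2⟩ := by
    ext ⟨i, j⟩
    simp only [Finset.mem_filter, Finset.mem_univ, true_and, Finset.mem_biUnion, Finset.mem_map,
      Finset.mem_Ioi]
    refine ⟨fun h => ⟨i, j, h, rfl⟩, ?_⟩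
    rintro ⟨a, b, h, hab⟩
    obtain ⟨rfl, rfl⟩ := Prod.mk.inj hab
    exact h
  rw [h, Finset.card_biUnion]
  · simp only [Finset.card_map, Fin.card_Ioi]
    rw [Fin.sum_univ_eq_sum_range fun i => k - 1 - i, Finset.sum_range_reflect (fun i => i) k,
      Finset.sum_range_id, Nat.choose_two_right]
  · intro i _ j _ hij
    refine Finset.disjoint_left.2 fun e h1 h2 => hij ?_
    simp only [Finset.mem_map] at h1 h2
    obtain ⟨_, _, rfl⟩ := h1
    obtain ⟨_, _, h⟩ := h2
    exact (Prod.mk.inj h).1.symm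

variable {V : Type u} [Fintype V] {k : ℕ} {q : V → V → ℝ≥0} {P : V → Measure (StepPath V)}
  {π : PMF V}

theorem measurableSet_pathAvoid (A : Set (Fin k → V)) (t : ℝ≥0) :
    MeasurableSet (pathAvoid k A t) := by
  rcases eq_or_ne t 0 with rfl | ht
  · have : pathAvoid k A 0 = {w : Fin k → StepPath V | (fun i => (w i).at 0) ∈ A}ᶜ := by
      ext w
      simp [pathAvoid]
    rw [this]
    exact (measurableSet_vec_mem A 0).compl
  · have := pathAvoid_eq_iInter A (pos_iff_ne_zero.2 ht) 1
    rw [one_smul] at this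
    rw [this]
    exact MeasurableSet.iInter fun n => measurableSet_gridAvoid A _ _

/-- The law of independent stationary walkers. -/
noncomputable abbrev statWalkers (P : V → Measure (StepPath V)) (π : PMF V) (k : ℕ) :
    Measure (Fin k → StepPath V) :=
  Measure.pi fun _ => chainFrom P π

theorem statWalkers_pathAvoid (hP : IsMarkovChain q P) (A : Set (Fin k → V)) (t : ℝ≥0) :
    (statWalkers P π k).real (pathAvoid k A t) = statSurv P π A t := by
  rw [statWalkers, ← walkersFrom_prod hP, walkersFrom_real hP fun x =>
    ENNReal.prod_ne_top fun i _ => π.apply_ne_top _, weights_prod]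
  rfl

theorem iIndepFun_statWalkers (hP : IsMarkovChain q P) :
    iIndepFun (fun (i : Fin k) (w : Fin k → StepPath V) => w i) (statWalkers P π k) := by
  have := isProbabilityMeasure_chainFrom hP π
  exact iIndepFun_pi (X := fun _ => id) fun _ => aemeasurable_id

theorem map_comp_statWalkers (hP : IsMarkovChain q P) {r : ℕ} {σ : Fin r → Fin k}
    (hσ : Function.Injective σ) :
    (statWalkers P π k).map (fun w j => w (σ j)) = statWalkers P π r := by
  have := isProbabilityMeasure_chainFrom hP π
  have h := (iIndepFun_iff_map_fun_eq_pi_map fun j =>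
    (measurable_pi_apply (σ j)).aemeasurable).1 ((iIndepFun_statWalkers (π := π) hP).precomp hσ)
  have h2 : ∀ i, (statWalkers P π k).map (fun w => w i) = chainFrom P π := fun i =>
    (measurePreserving_eval (fun _ : Fin k => chainFrom P π) i).map_eq
  rw [statWalkers]
  simp only [h2] at h
  exact h

theorem measurable_comp {r : ℕ} (σ : Fin r → Fin k) :
    Measurable fun (w : Fin k → StepPath V) j => w (σ j) :=
  measurable_pi_lambda _ fun _ => measurable_pi_apply _

theorem statWalkers_comp_pathAvoid (hP : IsMarkovChain q P) {r : ℕ} {σ : Fin r → Fin k}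
    (hσ : Function.Injective σ) (A : Set (Fin r → V)) (t : ℝ≥0) :
    (statWalkers P π k).real ((fun w j => w (σ j)) ⁻¹' pathAvoid r A t) = statSurv P π A t := by
  rw [← statWalkers_pathAvoid hP, ← map_comp_statWalkers hP hσ]
  exact (map_measureReal_apply (measurable_comp σ) (measurableSet_pathAvoid A t)).symm

/-- Walkers `i` and `j` meet by time `t`. -/
def pairMeet (t : ℝ≥0) (i j : Fin k) : Set (Fin k → StepPath V) :=
  {w | ∃ s ≤ t, (w i).at s = (w j).at s}

theorem pairMeet_comm (t : ℝ≥0) (i j : Fin k) :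
    (pairMeet t i j : Set (Fin k → StepPath V)) = pairMeet t j i := by
  ext w
  simp only [pairMeet, Set.mem_ofPred_eq, eq_comm]

theorem pairMeet_eq_compl (t : ℝ≥0) (i j : Fin k) : (pairMeet t i j : Set (Fin k → StepPath V))
    = ((fun w l => w (![i, j] l)) ⁻¹' pathAvoid 2 (diag₂ V) t)ᶜ := by
  ext w
  simp [pairMeet, pathAvoid, diag₂]

theorem measurableSet_pairMeet (t : ℝ≥0) (i j : Fin k) :
    MeasurableSet (pairMeet t i j : Set (Fin k → StepPath V)) := by
  rw [pairMeet_eq_compl]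
  exact (measurable_comp _ (measurableSet_pathAvoid _ t)).compl

theorem injective_pair {i j : Fin k} (h : i ≠ j) : Function.Injective ![i, j] := by
  intro a b hab
  fin_cases a <;> fin_cases b <;> simp_all

theorem injective_triple {i j l : Fin k} (h : i ≠ j) (h' : i ≠ l) (h'' : j ≠ l) :
    Function.Injective ![i, j, l] := by
  intro a b hab
  fin_cases a <;> fin_cases b <;> simp_all

theorem statWalkers_pairMeet (hP : IsMarkovChain q P) (t : ℝ≥0) {i j : Fin k} (h : i ≠ j) :
    (statWalkers P π k).real (pairMeet t i j) = 1 - statSurv P π (diag₂ V) t := by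
  have := isProbabilityMeasure_chainFrom hP π
  rw [pairMeet_eq_compl, probReal_compl_eq_one_sub
    (measurable_comp _ (measurableSet_pathAvoid _ t)),
    statWalkers_comp_pathAvoid hP (injective_pair h)]

/-- The union of the two events is the event that the triple enters `diag₃`, so inclusion–exclusion
reduces the claim to `statSurv_correlation`. -/
theorem statWalkers_pairMeet_inter (hP : IsMarkovChain q P) (hM : IsMixing P π) {t : ℝ≥0}
    (ht : 0 < t) {c : ℝ} (hc : ∀ x, hitFrom P π t x ≤ c) {i j l : Fin k} (h : i ≠ j) (h' : i ≠ l)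
    (h'' : j ≠ l) : (statWalkers P π k).real (pairMeet t i j ∩ pairMeet t i l)
      ≤ 2 * c * (1 - statSurv P π (diag₂ V) t) := by
  have := isProbabilityMeasure_chainFrom hP π
  have h1 := measureReal_union_add_inter (μ := statWalkers P π k) (s := pairMeet t i j)
    (measurableSet_pairMeet t i l)
  have h2 : (pairMeet t i j ∪ pairMeet t i l : Set (Fin k → StepPath V))
      = ((fun w m => w (![i, j, l] m)) ⁻¹' pathAvoid 3 (diag₃ V) t)ᶜ := by
    ext w
    simp only [pairMeet, pathAvoid, diag₃, Set.mem_union, Set.mem_preimage, Set.mem_ofPred_eq,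
      Set.mem_compl_iff,      not_forall, not_not]
    simp only [exists_prop, ← exists_or, ← and_or_left]
    rfl
  rw [h2, probReal_compl_eq_one_sub (measurable_comp _ (measurableSet_pathAvoid _ t)),
    statWalkers_comp_pathAvoid hP (injective_triple h h' h''), statWalkers_pairMeet hP t h,
    statWalkers_pairMeet hP t h'] at h1
  have h3 := statSurv_correlation hP hM ht 1 (c := c) (by simpa using hc)
  rw [one_smul] at h3
  linarith

theorem statWalkers_pairMeet_inter_disjoint (hP : IsMarkovChain q P) (t : ℝ≥0)
    {i j i' j' : Fin k} (h : i ≠ j) (h' : i' ≠ j') (h1 : i ≠ i') (h2 : i ≠ j') (h3 : j ≠ i')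
    (h4 : j ≠ j') : (statWalkers P π k).real (pairMeet t i j ∩ pairMeet t i' j')
      = (1 - statSurv P π (diag₂ V) t) * (1 - statSurv P π (diag₂ V) t) := by
  have hind := (iIndepFun_statWalkers (k := k) (π := π) hP).indepFun_prodMk_prodMk
    (fun i => measurable_pi_apply i) i j i' j' h1 h2 h3 h4
  have hmv : Measurable fun (ab : StepPath V × StepPath V) (m : Fin 2) => ![ab.1, ab.2] m :=
    measurable_pi_lambda _ fun m => by
      fin_cases m
      · exact measurable_fst
      · exact measurable_snd
  have hS : MeasurableSet {ab : StepPath V × StepPath V |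
      (fun m => ![ab.1, ab.2] m) ∈ (pairMeet t 0 1 : Set (Fin 2 → StepPath V))} :=
    hmv (measurableSet_pairMeet t 0 1)
  have h5 := hind.measure_inter_preimage_eq_mul _ _ hS hS
  have e : ∀ i j : Fin k, (fun w : Fin k → StepPath V => (w i, w j)) ⁻¹'
      {ab : StepPath V × StepPath V |
        (fun m => ![ab.1, ab.2] m) ∈ (pairMeet t 0 1 : Set (Fin 2 → StepPath V))}
      = pairMeet t i j := fun i j => rfl
  rw [e, e] at h5
  rw [Measure.real, h5, ENNReal.toReal_mul, ← statWalkers_pairMeet (k := k) hP t h]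
  congr 1
  exact (statWalkers_pairMeet hP t h').trans (statWalkers_pairMeet hP t h).symm

/-- Some two walkers share their position. -/
def diagAll (V : Type u) (k : ℕ) : Set (Fin k → V) := {x | ∃ i j, i < j ∧ x i = x j}

theorem pathAvoid_diagAll_compl (t : ℝ≥0) : (pathAvoid k (diagAll V k) t)ᶜ
    = ⋃ e ∈ Finset.univ.filter fun e : Fin k × Fin k => e.1 < e.2, pairMeet t e.1 e.2 := by
  ext w
  simp only [pathAvoid, diagAll, pairMeet, Set.mem_compl_iff, Set.mem_ofPred_eq, not_forall,
    not_not, Set.mem_iUnion, Finset.mem_filter, Finset.mem_univ, true_and, exists_prop]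
  constructor
  · rintro ⟨s, hs, i, j, hij, h⟩
    exact ⟨(i, j), hij, s, hs, h⟩
  · rintro ⟨⟨i, j⟩, hij, s, hs, h⟩
    exact ⟨s, hs, i, j, hij, h⟩

theorem one_sub_statSurv_le (hP : IsMarkovChain q P) (t : ℝ≥0) :
    1 - statSurv P π (diagAll V k) t ≤ k.choose 2 * (1 - statSurv P π (diag₂ V) t) := by
  have := isProbabilityMeasure_chainFrom hP π
  rw [← statWalkers_pathAvoid hP, ← probReal_compl_eq_one_sub (measurableSet_pathAvoid _ t),
    pathAvoid_diagAll_compl]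
  refine (measureReal_biUnion_finset_le _ _).trans ?_
  rw [← card_pairs k, ← nsmul_eq_mul]
  refine Finset.sum_le_card_nsmul _ _ _ fun e he => ?_
  exact (statWalkers_pairMeet hP t (Finset.mem_filter.1 he).2.ne).le

/-- Every two distinct pairs both meet with probability at most `2 * c * g`, whether or not they
share a walker, and there are at most half of `(k.choose 2) ^ 2` such couples of pairs. -/
theorem le_one_sub_statSurv (hP : IsMarkovChain q P) (hM : IsMixing P π) {t : ℝ≥0} (ht : 0 < t)
    {c : ℝ} (hc : ∀ x, hitFrom P π t x ≤ c) :
    k.choose 2 * (1 - statSurv P π (diag₂ V) t)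
        - (k.choose 2 : ℝ) ^ 2 * c * (1 - statSurv P π (diag₂ V) t)
      ≤ 1 - statSurv P π (diagAll V k) t := by
  have := isProbabilityMeasure_chainFrom hP π
  set g := 1 - statSurv P π (diag₂ V) t with hg
  have hg0 : 0 ≤ g := sub_nonneg.2 (statSurv_le_one hP _ _)
  have hgc : g ≤ c := by
    rw [hg, one_sub_statSurv_two]
    calc _ ≤ ∑ x, weights π x * c :=
          Finset.sum_le_sum fun x _ => mul_le_mul_of_nonneg_left (hc x) (weights_nonneg π x)
      _ = c := by rw [← Finset.sum_mul, sum_weights, one_mul]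
  have hb := bonferroni (μ := statWalkers P π k) (fun e : Fin k × Fin k => pairMeet t e.1 e.2)
    (fun e => measurableSet_pairMeet t e.1 e.2) (c := 2 * c * g)
    (Finset.univ.filter fun e : Fin k × Fin k => e.1 < e.2) (by
      rintro ⟨i, j⟩ hij ⟨i', j'⟩ hij' hne
      have hlt : i < j := (Finset.mem_filter.1 hij).2
      have hij : i ≠ j := (Finset.mem_filter.1 hij).2.ne
      have hlt' : i' < j' := (Finset.mem_filter.1 hij').2
      have hij' : i' ≠ j' := (Finset.mem_filter.1 hij').2.ne
      dsimp only
      by_cases h1 : i = i'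
      · subst h1
        exact statWalkers_pairMeet_inter hP hM ht hc hij hij' fun h => hne (by rw [h])
      by_cases h4 : j = j'
      · subst h4
        rw [pairMeet_comm t i, pairMeet_comm t i']
        exact statWalkers_pairMeet_inter hP hM ht hc hij.symm hij'.symm h1
      by_cases h2 : i = j'
      · subst h2
        rw [pairMeet_comm t i']
        refine statWalkers_pairMeet_inter hP hM ht hc hij hij'.symm ?_
        -- Here the two pairs would be the same pair listed in opposite orders, which the convention
        -- `e.1 < e.2` excludes.
        rintro rfl
        exact absurd hlt' hlt.not_gt
      by_cases h3 : j = i'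
      · subst h3
        rw [pairMeet_comm t i]
        exact statWalkers_pairMeet_inter hP hM ht hc hij.symm hij' h2
      -- Disjoint pairs are independent, and `g * g ≤ 2 * c * g` because `g`, an average of
      -- `hitFrom`, is at most `c`.
      rw [statWalkers_pairMeet_inter_disjoint hP t hij hij' h1 h2 h3 h4, ← hg]
      nlinarith)
  rw [← pathAvoid_diagAll_compl, probReal_compl_eq_one_sub (measurableSet_pathAvoid _ t),
    statWalkers_pathAvoid hP, card_pairs] at hb
  have e1 : ∑ e ∈ Finset.univ.filter (fun e : Fin k × Fin k => e.1 < e.2),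
      (statWalkers P π k).real (pairMeet t e.1 e.2) = k.choose 2 * g := by
    rw [← card_pairs k, ← nsmul_eq_mul]
    exact Finset.sum_eq_card_nsmul fun e he =>
      statWalkers_pairMeet hP t (Finset.mem_filter.1 he).2.ne
  rw [e1] at hb
  have e2 : ((k.choose 2).choose 2 : ℝ) * 2 ≤ (k.choose 2 : ℝ) ^ 2 := by
    have h := Nat.choose_two_right (k.choose 2)
    have : (k.choose 2).choose 2 * 2 ≤ (k.choose 2) ^ 2 := by
      rw [h]
      refine (Nat.div_mul_le_self _ _).trans ?_
      rw [sq]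
      exact Nat.mul_le_mul_left _ (Nat.sub_le _ _)
    exact_mod_cast this
  have e3 := mul_le_mul_of_nonneg_right e2 (mul_nonneg (hg0.trans hgc) hg0)
  nlinarith

end Pairs

/-! ### The meeting time as a hitting time of the diagonals. -/

section Meeting

variable {V : Type u} {k : ℕ}

/-- The infimum is not taken to be attained by definition. If there were no meeting up to `t`,
right-continuity would rule out meetings on some `[t, b)` as well, forcing the infimum to be at
least `b`. -/
theorem exists_attained_of_meetingTime_le {w : Fin k → StepPath V} {t : ℝ≥0}
    (h : meetingTime w ≤ t) : ∃ s ≤ t, (fun i => (w i).at s) ∈ diagAll V k := by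
  by_contra hno
  simp only [not_exists, not_and] at hno
  obtain ⟨b, hb, hb'⟩ := (mem_nhdsGE_iff_exists_Ico_subset).1 (eventually_at_eq w t)
  have htb : t < b := hb
  have hlt : meetingTime w < b := h.trans_lt (by exact_mod_cast htb)
  simp only [meetingTime, iInf_lt_iff] at hlt
  obtain ⟨s, hs, hsb⟩ := hlt
  have hsb : s < b := by exact_mod_cast hsb
  have hs' : (fun i => (w i).at s) ∈ diagAll V k := hs
  rcases le_total s t with hst | hst
  · exact hno s hst hs'
  · have := hb' ⟨hst, hsb⟩
    simp only [Set.mem_ofPred_eq] at this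
    rw [this] at hs'
    exact hno t le_rfl hs'

theorem meetingTime_le_iff {w : Fin k → StepPath V} {t : ℝ≥0} :
    meetingTime w ≤ t ↔ w ∉ pathAvoid k (diagAll V k) t := by
  constructor
  · intro h h'
    obtain ⟨s, hs, hA⟩ := exists_attained_of_meetingTime_le h
    exact h' s hs hA
  · intro h
    simp only [pathAvoid, Set.mem_ofPred_eq, not_forall, not_not] at h
    obtain ⟨s, hs, hA⟩ := h
    exact (iInf₂_le s hA).trans (by exact_mod_cast hs)

theorem lt_meetingTime_iff {w : Fin k → StepPath V} {t : ℝ≥0} :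
    (t : ℝ≥0∞) < meetingTime w ↔ w ∈ pathAvoid k (diagAll V k) t := by
  rw [← not_le, meetingTime_le_iff, not_not]

theorem measurable_meetingTime [Fintype V] :
    Measurable (meetingTime : (Fin k → StepPath V) → ℝ≥0∞) := by
  refine measurable_of_Iic fun c => ?_
  induction c with
  | top => simp
  | coe c =>
    have : meetingTime ⁻¹' Set.Iic (c : ℝ≥0∞) = (pathAvoid k (diagAll V k) c)ᶜ := by
      ext w
      exact meetingTime_le_iff
    rw [this]
    exact (measurableSet_pathAvoid _ c).compl

theorem pathAvoid_subset {t : ℝ} {s : ℝ≥0} (h : t ≤ s) :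
    pathAvoid k (diagAll V k) s ⊆ {w | ENNReal.ofReal t ≤ meetingTime w} := fun w hw => by
  refine le_trans ?_ (lt_meetingTime_iff.2 hw).le
  exact ENNReal.ofReal_le_of_le_toReal (by simpa using h)

theorem subset_pathAvoid {t : ℝ} {s : ℝ≥0} (h : (s : ℝ) < t) :
    {w | ENNReal.ofReal t ≤ meetingTime w} ⊆ pathAvoid k (diagAll V k) s := fun w hw => by
  refine lt_meetingTime_iff.1 (lt_of_lt_of_le ?_ hw)
  rw [← ENNReal.ofReal_coe_nnreal]
  exact (ENNReal.ofReal_lt_ofReal_iff_of_nonneg s.2).2 h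

end Meeting

/-! ### Means from exponential tail bounds. -/

section LayerCake

variable {Ω : Type*} [MeasurableSpace Ω] {μ : Measure Ω} [IsProbabilityMeasure μ] {Z : Ω → ℝ≥0∞}

theorem ae_ne_top_of_tail {A B : ℝ} (hB : 0 < B)
    (h : ∀ t : ℝ, 0 < t → μ.real {w | ENNReal.ofReal t ≤ Z w} ≤ A * Real.exp (-t / B)) :
    ∀ᵐ w ∂μ, Z w ≠ ∞ := by
  have h1 : ∀ t : ℝ, 0 < t → μ.real {w | Z w = ∞} ≤ A * Real.exp (-t / B) := fun t ht =>
    (measureReal_mono fun w (hw : Z w = ∞) => by simp [hw]).trans (h t ht)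
  have h2 : Tendsto (fun t : ℝ => A * Real.exp (-t / B)) atTop (𝓝 (A * 0)) := by
    refine (Real.tendsto_exp_atBot.comp ?_).const_mul A
    have := (tendsto_id (α := ℝ) (x := atTop)).atTop_div_const hB
    refine (tendsto_neg_atTop_atBot.comp this).congr fun t => ?_
    simp [neg_div]
  rw [mul_zero] at h2
  have h3 : μ.real {w | Z w = ∞} ≤ 0 :=
    ge_of_tendsto h2 ((eventually_gt_atTop 0).mono h1)
  have h4 : μ {w | Z w = ∞} = 0 :=
    (measureReal_eq_zero_iff).1 (le_antisymm h3 measureReal_nonneg)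
  simpa [ae_iff] using h4

theorem lintegral_eq_tail (hZ : AEMeasurable Z μ) (hfin : ∀ᵐ w ∂μ, Z w ≠ ∞) :
    ∫⁻ w, Z w ∂μ = ∫⁻ t in Set.Ioi (0 : ℝ), μ {w | ENNReal.ofReal t ≤ Z w} := by
  have h := lintegral_eq_lintegral_meas_le μ (f := fun w => (Z w).toReal)
    (ae_of_all _ fun w => ENNReal.toReal_nonneg) hZ.ennreal_toReal
  have e : ∫⁻ w, Z w ∂μ = ∫⁻ w, ENNReal.ofReal (Z w).toReal ∂μ :=
    lintegral_congr_ae (hfin.mono fun w hw => (ENNReal.ofReal_toReal hw).symm)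
  rw [e, h]
  refine setLIntegral_congr_fun measurableSet_Ioi fun t ht => ?_
  refine measure_congr (eventuallyEq_set.2 (hfin.mono fun w hw => ?_))
  exact (ENNReal.ofReal_le_iff_le_toReal hw).symm

theorem lintegral_exp_tail {A B : ℝ} (hB : 0 < B) (hA : 0 ≤ A) :
    ∫⁻ t in Set.Ioi (0 : ℝ), ENNReal.ofReal (A * Real.exp (-t / B)) = ENNReal.ofReal (A * B) := by
  have hb : -B⁻¹ < 0 := by simpa using hB
  have e : ∀ t : ℝ, -t / B = -B⁻¹ * t := fun t => by ring
  simp only [e]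
  rw [← ofReal_integral_eq_lintegral_ofReal ((integrableOn_exp_mul_Ioi hb 0).const_mul A)
    (ae_of_all _ fun t => by positivity), integral_const_mul, integral_exp_mul_Ioi hb]
  congr 1
  simp

theorem lintegral_le_of_tail (hZ : AEMeasurable Z μ) {A B : ℝ} (hB : 0 < B) (hA : 0 ≤ A)
    (h : ∀ t : ℝ, 0 < t → μ.real {w | ENNReal.ofReal t ≤ Z w} ≤ A * Real.exp (-t / B)) :
    ∫⁻ w, Z w ∂μ ≤ ENNReal.ofReal (A * B) := by
  rw [lintegral_eq_tail hZ (ae_ne_top_of_tail hB h), ← lintegral_exp_tail hB hA]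
  refine setLIntegral_mono' measurableSet_Ioi fun t ht => ?_
  rw [← ofReal_measureReal]
  exact ENNReal.ofReal_le_ofReal (h t ht)

theorem le_lintegral_of_tail (hZ : AEMeasurable Z μ) (hfin : ∀ᵐ w ∂μ, Z w ≠ ∞) {A B : ℝ}
    (hB : 0 < B) (hA : 0 ≤ A)
    (h : ∀ t : ℝ, 0 < t → A * Real.exp (-t / B) ≤ μ.real {w | ENNReal.ofReal t ≤ Z w}) :
    ENNReal.ofReal (A * B) ≤ ∫⁻ w, Z w ∂μ := by
  rw [lintegral_eq_tail hZ hfin, ← lintegral_exp_tail hB hA]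
  refine setLIntegral_mono' measurableSet_Ioi fun t ht => ?_
  rw [← ofReal_measureReal]
  exact ENNReal.ofReal_le_ofReal (h t ht)

/-- A law of type `Exp(m, α, β)` has mean close to `m`. -/
theorem IsNearExp.mean {m α β : ℝ} (h : IsNearExp μ Z m α β) :
    ∫⁻ w, Z w ∂μ ≠ ∞ ∧ |(∫⁻ w, Z w ∂μ).toReal - m| ≤ 2 * (α + β) * m := by
  have hm := h.m_pos
  have hα := h.α_pos
  have hβ := h.β_pos
  have hβ1 := h.β_lt_one
  have hU := lintegral_le_of_tail h.aemeasurable (by positivity) (by positivity) h.upper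
  have hfin : ∫⁻ w, Z w ∂μ ≠ ∞ := ne_top_of_le_ne_top ENNReal.ofReal_ne_top hU
  refine ⟨hfin, abs_le.2 ⟨?_, ?_⟩⟩
  -- For `α ≥ 1` the lower tail bound carries no information, but then the allowed error already
  -- exceeds `m`.
  · rcases le_or_gt 1 α with h1 | h1
    · have : 0 ≤ (∫⁻ w, Z w ∂μ).toReal := ENNReal.toReal_nonneg
      nlinarith
    · have hpos : 0 < (1 - β) * m := mul_pos (by linarith) hm
      have hL := le_lintegral_of_tail h.aemeasurable h.finite hpos (by linarith) h.lower
      have := (ENNReal.ofReal_le_iff_le_toReal hfin).1 hL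
      have h2 : 0 ≤ α * β * m := by positivity
      have h3 : 0 ≤ (α + β) * m := by positivity
      nlinarith
  · have := ENNReal.toReal_mono ENNReal.ofReal_ne_top hU
    rw [ENNReal.toReal_ofReal (by positivity)] at this
    have h2 : α * β * m ≤ α * m := by
      have : 0 < α * m := by positivity
      nlinarith
    have h3 : 0 ≤ β * m := by positivity
    nlinarith

end LayerCake

/-! ### Submultiplicativity of the distance to stationarity. -/

section Mixing

open Matrix

variable {V : Type u} [Fintype V] {k : ℕ} {q : V → V → ℝ≥0} {P : V → Measure (StepPath V)}
  {π : PMF V}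

/-- If `Π` denotes the matrix all of whose rows are `π`, then the semigroup property and
stationarity give `P_{s+t} - Π = (P_s - Π) (P_t - Π)`. The factor `2` appears because total
variation is half of the `ℓ¹` distance. -/
theorem tvAt_add_le (hP : IsMarkovChain q P) (hM : IsMixing P π) {s t : ℝ≥0} {a b : ℝ}
    (hs : ∀ x, tvAt P π x s ≤ a) (ht : ∀ x, tvAt P π x t ≤ b) (x : V) :
    tvAt P π x (s + t) ≤ 2 * a * b := by
  have e : ∀ y, trans P (s + t) x y - weights π y
      = ∑ z, (trans P s x z - weights π z) * (trans P t z y - weights π y) := by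
    intro y
    have h1 : ∑ z, trans P s x z * trans P t z y = trans P (s + t) x y := by
      rw [(trans_semigroup hP).add s t]
      rfl
    have h2 : ∑ z, weights π z * trans P t z y = weights π y :=
      congrFun (weights_stationary hP hM t) y
    simp only [sub_mul, mul_sub, Finset.sum_sub_distrib, ← Finset.sum_mul, h1, h2, sum_trans hP,
      sum_weights]
    ring
  have hb : ∀ z, ∑ y, |trans P t z y - weights π y| ≤ 2 * b := fun z => by
    have : 1 / 2 * ∑ y, |trans P t z y - weights π y| ≤ b := ht z
    linarith
  have ha : ∑ z, |trans P s x z - weights π z| ≤ 2 * a := by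
    have : 1 / 2 * ∑ y, |trans P s x y - weights π y| ≤ a := hs x
    linarith
  have hb0 : 0 ≤ 2 * b := (Finset.sum_nonneg fun y _ => abs_nonneg _).trans (hb x)
  calc tvAt P π x (s + t) = 1 / 2 * ∑ y, |trans P (s + t) x y - weights π y| := rfl
    _ ≤ 1 / 2 * ∑ y, ∑ z, |trans P s x z - weights π z| * |trans P t z y - weights π y| := by
        gcongr with y
        rw [e]
        refine (Finset.abs_sum_le_sum_abs _ _).trans (le_of_eq ?_)
        simp only [abs_mul]
    _ = 1 / 2 * ∑ z, |trans P s x z - weights π z| * ∑ y, |trans P t z y - weights π y| := by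
        rw [Finset.sum_comm]
        simp only [Finset.mul_sum]
    _ ≤ 1 / 2 * ∑ z, |trans P s x z - weights π z| * (2 * b) := by
        gcongr with z
        exact hb z
    _ ≤ 1 / 2 * ((2 * a) * (2 * b)) := by
        rw [← Finset.sum_mul]
        gcongr
    _ = 2 * a * b := by ring

theorem tvAt_nsmul_le (hP : IsMarkovChain q P) (hM : IsMixing P π) {T : ℝ≥0} {a : ℝ}
    (h : ∀ x, tvAt P π x T ≤ a) (j : ℕ) (x : V) :
    tvAt P π x ((j + 1) • T) ≤ (2 * a) ^ j * a := by
  induction j generalizing x with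
  | zero => simpa using h x
  | succ j ih =>
    rw [succ_nsmul]
    refine (tvAt_add_le hP hM ih h x).trans (le_of_eq ?_)
    rw [pow_succ]
    ring

theorem diagAll_two : diagAll V 2 = diag₂ V := by
  ext x
  simp only [diagAll, diag₂, Set.mem_ofPred_eq]
  constructor
  · rintro ⟨i, j, hij, h⟩
    have hi : i = 0 := by omega
    have hj : j = 1 := by omega
    rwa [hi, hj] at h
  · exact fun h => ⟨0, 1, by simp, h⟩

end Mixing

/-! ### Survival window by window, and exponential tails. -/

section Windows

variable {V : Type u} [Fintype V] {k : ℕ} {q : V → V → ℝ≥0} {P : V → Measure (StepPath V)}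
  {π : PMF V} {ν : (Fin k → V) → ℝ≥0∞}

/-- The probability that the walkers started from `ν` do not meet up to time `t`. -/
noncomputable def survFrom (P : V → Measure (StepPath V)) (ν : (Fin k → V) → ℝ≥0∞) (t : ℝ≥0) : ℝ :=
  (walkersFrom P ν).real (pathAvoid k (diagAll V k) t)

theorem ne_top_of_sum_eq_one {W : Type*} [Fintype W] {ν : W → ℝ≥0∞} (hν : ∑ x, ν x = 1) (x : W) :
    ν x ≠ ∞ :=
  ne_top_of_le_ne_top (by rw [hν]; simp) (Finset.single_le_sum (fun _ _ => zero_le)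
    (Finset.mem_univ x))

theorem sum_weights_of_sum_eq_one {W : Type*} [Fintype W] {ν : W → ℝ≥0∞} (hν : ∑ x, ν x = 1) :
    ∑ x, weights ν x = 1 := by
  simp only [weights]
  rw [← ENNReal.toReal_sum fun x _ => ne_top_of_sum_eq_one hν x, hν, ENNReal.toReal_one]

theorem survFrom_eq (hP : IsMarkovChain q P) (hν : ∑ x, ν x = 1) (t : ℝ≥0) :
    survFrom P ν t = ∑ x, weights ν x * surv P (diagAll V k) t x :=
  walkersFrom_real hP (ne_top_of_sum_eq_one hν) _

theorem survFrom_antitone (hP : IsMarkovChain q P) (hν : ∑ x, ν x = 1) :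
    Antitone (survFrom P ν) := fun s t h => by
  rw [survFrom_eq hP hν, survFrom_eq hP hν]
  exact Finset.sum_le_sum fun x _ =>
    mul_le_mul_of_nonneg_left (surv_antitone hP _ h x) (weights_nonneg ν x)

theorem survFrom_le_one (hP : IsMarkovChain q P) (hν : ∑ x, ν x = 1) (t : ℝ≥0) :
    survFrom P ν t ≤ 1 := by
  have := isProbabilityMeasure_walkersFrom hP hν
  exact measureReal_le_one

theorem survFrom_nonneg (t : ℝ≥0) : 0 ≤ survFrom P ν t := measureReal_nonneg

theorem survFrom_prod (hP : IsMarkovChain q P) (t : ℝ≥0) :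
    survFrom P (fun x : Fin k → V => ∏ i, π (x i)) t = statSurv P π (diagAll V k) t := by
  rw [survFrom, walkersFrom_prod hP, statWalkers_pathAvoid hP]

theorem survFrom_le_mul (hP : IsMarkovChain q P) (hν : ∑ x, ν x = 1) {T : ℝ≥0} (hT : 0 < T)
    {a : ℕ} {D : ℝ} (hD : ∀ x, tvAt P π x (a • T) ≤ D) (t v : ℕ) :
    survFrom P ν ((t + (a + v)) • T)
      ≤ survFrom P ν (t • T) * (statSurv P π (diagAll V k) (v • T) + k * D) := by
  rw [survFrom_eq hP hν, survFrom_eq hP hν, Finset.sum_mul]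
  refine Finset.sum_le_sum fun x _ => ?_
  rw [mul_assoc]
  exact mul_le_mul_of_nonneg_left (surv_le_mul hP hT hD t v x) (weights_nonneg ν x)

theorem le_survFrom (hP : IsMarkovChain q P) (hν : ∑ x, ν x = 1) {T : ℝ≥0} (hT : 0 < T)
    {a : ℕ} {D : ℝ} (hD : ∀ x, tvAt P π x (a • T) ≤ D) (v : ℕ) :
    survFrom P ν (a • T) - (1 - statSurv P π (diagAll V k) (v • T)) - k * D
      ≤ survFrom P ν ((a + v) • T) := by
  have h1 := sum_weights_of_sum_eq_one hν
  have h := Finset.sum_le_sum fun x (_ : x ∈ Finset.univ) =>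
    mul_le_mul_of_nonneg_left (le_surv (A := diagAll V k) hP hT hD v x) (weights_nonneg ν x)
  simp only [mul_sub, Finset.sum_sub_distrib, ← Finset.sum_mul, h1, ← survFrom_eq hP hν] at h
  linarith

theorem mul_sub_mul_le_survFrom (hP : IsMarkovChain q P) (hν : ∑ x, ν x = 1) {T : ℝ≥0}
    (hT : 0 < T) {a : ℕ} {D : ℝ} (hD : ∀ x, tvAt P π x (a • T) ≤ D) (t v : ℕ) :
    survFrom P ν ((t + a) • T) * (statSurv P π (diagAll V k) (v • T) - k * D)
        - survFrom P ν (t • T) * (1 - statSurv P π (diagAll V k) (a • T) + k * D)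
      ≤ survFrom P ν ((t + a + (a + v)) • T) := by
  have h := Finset.sum_le_sum fun x (_ : x ∈ Finset.univ) =>
    mul_le_mul_of_nonneg_left (mul_sub_mul_le_surv (A := diagAll V k) hP hT hD t v x)
      (weights_nonneg ν x)
  simp only [mul_sub (weights ν _), Finset.sum_sub_distrib, ← mul_assoc (weights ν _),
    ← Finset.sum_mul, ← survFrom_eq hP hν] at h
  exact h

theorem exists_window {t u : ℝ} (hu : 0 < u) (ht : 0 < t) :
    ∃ j : ℕ, j * u < t ∧ t ≤ (j + 1) * u := by
  have hc : 0 < ⌈t / u⌉₊ := Nat.ceil_pos.2 (by positivity)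
  refine ⟨⌈t / u⌉₊ - 1, ?_, ?_⟩
  · rw [← lt_div_iff₀ hu]
    exact Nat.lt_ceil.1 (by omega)
  · rw [← div_le_iff₀ hu]
    have := Nat.le_ceil (t / u)
    rw [Nat.cast_sub hc]
    push_cast
    linarith

/-- The geometric bound is turned into an exponential by `θ ≤ exp (θ - 1)`; rounding `t` down to a
multiple of `U` costs the prefactor `θ⁻¹`. -/
theorem tail_le_exp (hP : IsMarkovChain q P) (hν : ∑ x, ν x = 1) {U : ℝ≥0} (hU : 0 < U) {θ : ℝ}
    (hθ : 0 < θ) (hθ1 : θ ≤ 1)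
    (h : ∀ j : ℕ, survFrom P ν ((j + 1) • U) ≤ survFrom P ν (j • U) * θ) {t : ℝ} (ht : 0 < t) :
    (walkersFrom P ν).real {w | ENNReal.ofReal t ≤ meetingTime w}
      ≤ θ⁻¹ * Real.exp (-t * (1 - θ) / U) := by
  have := isProbabilityMeasure_walkersFrom hP hν
  have hU' : (0 : ℝ) < U := hU
  obtain ⟨j, hj, hj'⟩ := exists_window hU' ht
  have h1 : ∀ j : ℕ, survFrom P ν (j • U) ≤ θ ^ j := by
    intro j
    induction j with
    | zero => simpa using survFrom_le_one hP hν 0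
    | succ j ih =>
      rw [pow_succ]
      exact (h j).trans (mul_le_mul_of_nonneg_right ih hθ.le)
  have h2 : (walkersFrom P ν).real {w | ENNReal.ofReal t ≤ meetingTime w} ≤ survFrom P ν (j • U) :=
    measureReal_mono (subset_pathAvoid (by simpa [nsmul_eq_mul] using hj))
  have h3 : θ ≤ Real.exp (θ - 1) := by
    have := Real.add_one_le_exp (θ - 1)
    linarith
  calc _ ≤ θ ^ j := h2.trans (h1 j)
    _ = θ⁻¹ * θ ^ (j + 1) := by rw [pow_succ]; field_simp
    _ ≤ θ⁻¹ * Real.exp (θ - 1) ^ (j + 1) := by gcongr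
    _ = θ⁻¹ * Real.exp (((j + 1 : ℕ) : ℝ) * (θ - 1)) := by rw [Real.exp_nat_mul]
    _ ≤ _ := by
      gcongr
      rw [le_div_iff₀ hU']
      push_cast
      nlinarith [mul_le_mul_of_nonneg_right hj' (sub_nonneg.2 hθ1)]

/-- The reverse conversion uses `1 - θ⁻¹ ≤ log θ`. The ratio bound starts only from the second
window, since an arbitrary initial law gives no control over the first; that window enters through
`c`. -/
theorem exp_le_tail (hP : IsMarkovChain q P) (hν : ∑ x, ν x = 1) {U : ℝ≥0} (hU : 0 < U) {θ c : ℝ}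
    (hθ : 0 < θ) (hθ1 : θ ≤ 1) (hc : 0 ≤ c) (h1 : c ≤ survFrom P ν U)
    (h : ∀ j : ℕ, survFrom P ν ((j + 1) • U) * θ ≤ survFrom P ν ((j + 2) • U)) {t : ℝ}
    (ht : 0 < t) :
    c * Real.exp (-t * (θ⁻¹ - 1) / U)
      ≤ (walkersFrom P ν).real {w | ENNReal.ofReal t ≤ meetingTime w} := by
  have := isProbabilityMeasure_walkersFrom hP hν
  have hU' : (0 : ℝ) < U := hU
  obtain ⟨j, hj, hj'⟩ := exists_window hU' ht
  have h2 : ∀ j : ℕ, c * θ ^ j ≤ survFrom P ν ((j + 1) • U) := by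
    intro j
    induction j with
    | zero => simpa using h1
    | succ j ih =>
      rw [pow_succ, ← mul_assoc]
      exact (mul_le_mul_of_nonneg_right ih hθ.le).trans (h j)
  have h3 : survFrom P ν ((j + 1) • U)
      ≤ (walkersFrom P ν).real {w | ENNReal.ofReal t ≤ meetingTime w} :=
    measureReal_mono (pathAvoid_subset (by simpa [nsmul_eq_mul] using hj'))
  have h4 : Real.exp (-(θ⁻¹ - 1)) ≤ θ := by
    have h5 := Real.one_sub_inv_le_log_of_pos hθ
    calc Real.exp (-(θ⁻¹ - 1)) ≤ Real.exp (Real.log θ) := Real.exp_le_exp.2 (by linarith)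
      _ = θ := Real.exp_log hθ
  have h6 : 0 ≤ θ⁻¹ - 1 := sub_nonneg.2 ((one_le_inv₀ hθ).2 hθ1)
  calc c * Real.exp (-t * (θ⁻¹ - 1) / U) ≤ c * Real.exp ((j : ℝ) * (-(θ⁻¹ - 1))) := by
        gcongr
        rw [div_le_iff₀ hU']
        nlinarith [mul_le_mul_of_nonneg_right hj.le h6]
    _ = c * Real.exp (-(θ⁻¹ - 1)) ^ j := by rw [Real.exp_nat_mul]
    _ ≤ c * θ ^ j := by gcongr
    _ ≤ _ := (h2 j).trans h3

theorem sum_prod_pmf (π : PMF V) : ∑ x : Fin k → V, ∏ i, π (x i) = 1 := by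
  have h := Finset.prod_univ_sum (fun _ : Fin k => (Finset.univ : Finset V)) fun _ v => π v
  rw [Fintype.piFinset_univ] at h
  rw [← h]
  simp [sum_pmf]

/-- With `p` the stationary meeting probability, the mixing error `p / 4` for each of the two
walkers uses up half of `p`, leaving the factor `1 - p / 2`. -/
theorem survFrom_two_geometric {ν : (Fin 2 → V) → ℝ≥0∞} (hP : IsMarkovChain q P)
    (hν : ∑ x, ν x = 1) {T : ℝ≥0} (hT : 0 < T) {a b : ℕ}
    (hD : ∀ x, tvAt P π x (a • T) ≤ (1 - statSurv P π (diag₂ V) (b • T)) / 4) (j : ℕ) :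
    survFrom P ν ((j + 1) • ((a + b) • T))
      ≤ survFrom P ν (j • ((a + b) • T)) * (1 - (1 - statSurv P π (diag₂ V) (b • T)) / 2) := by
  have := survFrom_le_mul hP hν hT hD (j * (a + b)) b
  rw [diagAll_two] at this
  rw [smul_smul, smul_smul]
  convert this using 2
  · ring_nf
  · push_cast
    ring

/-- Each period of length `(a + b) • T` contains a meeting with conditional probability at least `p
/ 2`. The estimate shows that the mean is finite, and bounds meeting probabilities in terms of `m`
in the transitive case. -/
theorem lintegral_meetingTime_le (hP : IsMarkovChain q P) {T : ℝ≥0} (hT : 0 < T) {a b : ℕ}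
    (hab : 0 < a + b) {p : ℝ} (hp : 0 < p) (hpe : p = 1 - statSurv P π (diag₂ V) (b • T))
    (hD : ∀ x, tvAt P π x (a • T) ≤ p / 4) :
    ∫⁻ w, meetingTime w ∂(walkersFrom P fun x : Fin 2 → V => ∏ i, π (x i))
      ≤ ENNReal.ofReal (4 * ((a + b : ℕ) * T) / p) := by
  have hν := sum_prod_pmf (k := 2) π
  have := isProbabilityMeasure_walkersFrom hP hν
  have hp1 : p ≤ 1 := by rw [hpe]; linarith [statSurv_nonneg (P := P) (π := π) (diag₂ V) (b • T)]
  have hU : 0 < (a + b) • T := nsmul_pos hT hab.ne'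
  have hU' : (0 : ℝ) < ((a + b) • T : ℝ≥0) := hU
  have h := lintegral_le_of_tail (Z := meetingTime) measurable_meetingTime.aemeasurable
    (μ := walkersFrom P fun x : Fin 2 → V => ∏ i, π (x i))
    (A := (1 - p / 2)⁻¹) (B := (((a + b) • T : ℝ≥0) : ℝ) / (p / 2)) (by positivity)
    (inv_nonneg.2 (by linarith)) fun t ht => by
      have h := tail_le_exp hP hν hU (θ := 1 - p / 2) (by linarith) (by linarith)
        (fun j => by
          have := survFrom_two_geometric hP hν hT (hpe ▸ hD) j
          rwa [← hpe] at this) ht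
      convert h using 3
      rw [div_div_eq_mul_div]
      ring
  refine h.trans (ENNReal.ofReal_le_ofReal ?_)
  have e : (((a + b) • T : ℝ≥0) : ℝ) = (a + b : ℕ) * T := by simp [nsmul_eq_mul]
  rw [← e]
  have h2 : (1 - p / 2)⁻¹ ≤ 2 := by
    rw [inv_le_comm₀ (by linarith) two_pos]
    linarith
  calc (1 - p / 2)⁻¹ * ((((a + b) • T : ℝ≥0) : ℝ) / (p / 2))
      ≤ 2 * ((((a + b) • T : ℝ≥0) : ℝ) / (p / 2)) := by gcongr
    _ = _ := by field_simp; ring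

end Windows

/-! ### Choice of the window and two-sided tail estimates. -/

section Core

open Matrix

variable {V : Type u} [Fintype V] {k : ℕ} {q : V → V → ℝ≥0} {P : V → Measure (StepPath V)}
  {π : PMF V}

theorem exists_tvAt_nsmul_le (hP : IsMarkovChain q P) (hM : IsMixing P π) {U : ℝ≥0}
    (h : ∀ x, tvAt P π x U ≤ 1 / 4) {δ : ℝ} (hδ : 0 < δ) :
    ∃ j : ℕ, ∀ x, tvAt P π x (j • U) ≤ δ := by
  obtain ⟨j, hj⟩ := exists_pow_lt_of_lt_one hδ (by norm_num : (1 / 2 : ℝ) < 1)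
  refine ⟨j + 1, fun x => (tvAt_nsmul_le hP hM h j x).trans (le_trans ?_ hj.le)⟩
  have : (0 : ℝ) ≤ (1 / 2) ^ j := by positivity
  norm_num at this ⊢

theorem surv_of_mem (hP : IsMarkovChain q P) {A : Set (Fin k → V)} {x : Fin k → V} (hx : x ∈ A)
    (t : ℝ≥0) : surv P A t x = 0 := by
  refine le_antisymm ?_ (surv_nonneg A t x)
  have h := surv_le_grid hP A one_pos 0 0 x
  refine (surv_antitone hP A (zero_le) x).trans ?_
  simpa [avoid, hx] using h

theorem weights_le_hitFrom (hP : IsMarkovChain q P) (t : ℝ≥0) (x : V) :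
    weights π x ≤ hitFrom P π t x := by
  have h : weights π x * (1 - surv P (diag₂ V) t ![x, x]) ≤ hitFrom P π t x :=
    Finset.single_le_sum (f := fun z => weights π z * (1 - surv P (diag₂ V) t ![x, z]))
      (fun z _ => mul_nonneg (weights_nonneg π z) (sub_nonneg.2 (surv_le_one hP _ t _)))
      (Finset.mem_univ x)
  rwa [surv_of_mem hP (by simp [diag₂]), sub_zero, mul_one] at h

/-- Two stationary walkers start at the same state with positive probability. -/
theorem one_sub_statSurv_pos (hP : IsMarkovChain q P) (t : ℝ≥0) :
    0 < 1 - statSurv P π (diag₂ V) t := by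
  rw [one_sub_statSurv_two]
  have h1 : ∃ x, 0 < weights π x := by
    by_contra h
    simp only [not_exists, not_lt] at h
    have := Finset.sum_nonpos fun x (_ : x ∈ Finset.univ) => h x
    rw [sum_weights] at this
    linarith
  obtain ⟨x, hx⟩ := h1
  exact Finset.sum_pos' (fun y _ => mul_nonneg (weights_nonneg π y) (hitFrom_nonneg hP t y))
    ⟨x, Finset.mem_univ x, mul_pos hx (hx.trans_le (weights_le_hitFrom hP t x))⟩

theorem one_sub_statSurv_le_of_hitFrom {t : ℝ≥0} {c : ℝ} (hc : ∀ x, hitFrom P π t x ≤ c) :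
    1 - statSurv P π (diag₂ V) t ≤ c := by
  rw [one_sub_statSurv_two]
  calc _ ≤ ∑ x, weights π x * c :=
        Finset.sum_le_sum fun x _ => mul_le_mul_of_nonneg_left (hc x) (weights_nonneg π x)
    _ = c := by rw [← Finset.sum_mul, sum_weights, one_mul]

theorem exists_statSurv_lt (hP : IsMarkovChain q P) (hM : IsMixing P π) {U : ℝ≥0} (hU : 0 < U)
    (h : ∀ x, tvAt P π x U ≤ 1 / 4) {δ : ℝ} (hδ : 0 < δ) :
    ∃ j : ℕ, statSurv P π (diag₂ V) (j • U) < δ := by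
  have hp := one_sub_statSurv_pos (π := π) hP (1 • U)
  obtain ⟨a, ha⟩ := exists_tvAt_nsmul_le hP hM h
    (show 0 < (1 - statSurv P π (diag₂ V) (1 • U)) / 4 by linarith)
  have hs := statSurv_nonneg (P := P) (π := π) (diag₂ V) (1 • U)
  set θ := 1 - (1 - statSurv P π (diag₂ V) (1 • U)) / 2 with hθ
  have hν := sum_prod_pmf (k := 2) π
  have hg : ∀ j : ℕ, survFrom P (fun x : Fin 2 → V => ∏ i, π (x i)) (j • ((a + 1) • U)) ≤ θ ^ j := by
    intro j
    induction j with
    | zero => simpa using survFrom_le_one hP hν 0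
    | succ j ih =>
      rw [pow_succ]
      exact (survFrom_two_geometric hP hν hU ha j).trans
        (mul_le_mul_of_nonneg_right ih (by linarith))
  obtain ⟨j, hj⟩ := exists_pow_lt_of_lt_one hδ (by linarith : θ < 1)
  refine ⟨j * (a + 1), ?_⟩
  have := (hg j).trans_lt hj
  rwa [survFrom_prod hP, diagAll_two, smul_smul] at this

/-- A time scale on which two stationary walkers meet with probability about `e`. -/
theorem exists_window_size (hP : IsMarkovChain q P) (hM : IsMixing P π) {U : ℝ≥0} (hU : 0 < U)
    (h : ∀ x, tvAt P π x U ≤ 1 / 4) {e : ℝ} (he : e ≤ 1 / 2)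
    (h0 : 1 - statSurv P π (diag₂ V) U < e) :
    ∃ N : ℕ, 2 ≤ N ∧ e ≤ 1 - statSurv P π (diag₂ V) (N • U) ∧
      1 - statSurv P π (diag₂ V) (N • U) ≤ 2 * e := by
  classical
  have hex : ∃ n : ℕ, e ≤ 1 - statSurv P π (diag₂ V) (2 ^ n • U) := by
    obtain ⟨j, hj⟩ := exists_statSurv_lt hP hM hU h (δ := 1 / 2) (by norm_num)
    refine ⟨j, ?_⟩
    have : statSurv P π (diag₂ V) (2 ^ j • U) ≤ statSurv P π (diag₂ V) (j • U) :=
      statSurv_antitone hP _ (nsmul_le_nsmul_left (zero_le) (Nat.lt_two_pow_self).le)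
    linarith
  obtain ⟨m, hm⟩ : ∃ m, Nat.find hex = m + 1 := by
    refine Nat.exists_eq_succ_of_ne_zero fun hz => ?_
    have := Nat.find_spec hex
    rw [hz, pow_zero, one_smul] at this
    linarith
  have h1 := Nat.find_spec hex
  have h2 := not_le.1 (Nat.find_min hex (m := m) (by omega))
  rw [hm] at h1
  refine ⟨2 ^ (m + 1), ?_, h1, ?_⟩
  · exact Nat.le_self_pow (by omega) 2
  -- The window is doubled until the probability reaches `e`. By subadditivity one doubling at most
  -- doubles the probability, so it does not pass `2 * e`.
  · have h3 := statSurv_subadd (A := diag₂ V) hP hM hU (2 ^ m) (2 ^ m)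
    rw [← two_mul, ← pow_succ'] at h3
    linarith

/-- The data of a time window `N • U`. -/
structure IsWindow (P : V → Measure (StepPath V)) (π : PMF V) (U : ℝ≥0) (e : ℝ) (N : ℕ) :
    Prop where
  U_pos : 0 < U
  e_pos : 0 < e
  mix : ∀ x, tvAt P π x U ≤ e ^ 2
  hit : ∀ x, hitFrom P π U x ≤ e ^ 2
  N_ge : 2 ≤ N
  le_hit : e ≤ 1 - statSurv P π (diag₂ V) (N • U)
  hit_le : 1 - statSurv P π (diag₂ V) (N • U) ≤ 2 * e

theorem cast_le_two_mul_choose (hk : 2 ≤ k) : (k : ℝ) ≤ 2 * (k.choose 2 : ℝ) := by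
  have h : k ≤ 2 * k.choose 2 := by
    obtain ⟨m, rfl⟩ : ∃ m, k = m + 2 := ⟨k - 2, by omega⟩
    rw [Nat.choose_succ_succ' (m + 1) 1, Nat.choose_one_right]
    omega
  exact_mod_cast h

theorem one_le_choose (hk : 2 ≤ k) : (1 : ℝ) ≤ (k.choose 2 : ℝ) := by
  exact_mod_cast Nat.choose_pos hk

theorem choose_le_sq (k : ℕ) : (k.choose 2 : ℝ) ≤ (k : ℝ) ^ 2 := by
  have : k.choose 2 ≤ k ^ 2 := Nat.choose_le_pow k 2
  exact_mod_cast this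

namespace IsWindow

variable {U : ℝ≥0} {e : ℝ} {N : ℕ}

theorem statSurv_ge (hP : IsMarkovChain q P) :
    1 - (k.choose 2 : ℝ) * (1 - statSurv P π (diag₂ V) (N • U))
      ≤ statSurv P π (diagAll V k) (N • U) := by
  have := one_sub_statSurv_le (k := k) (π := π) hP (N • U)
  linarith

/-- With `t` the meeting probability in the window, `e ≤ t` makes every term `l * e ^ 2` at most `l
* t * (l * e)`. The `6` is then `3` from Bonferroni with `c = t + 3 * e ^ 2 ≤ 3 * e`, `1` from
shortening the window by `U`, and `2` from the mixing error, as `k ≤ 2 * l`. -/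
theorem upper_factor (h : IsWindow P π U e N) (hP : IsMarkovChain q P) (hM : IsMixing P π)
    (hk : 2 ≤ k) (hx : (k.choose 2 : ℝ) * e ≤ 1 / 10000) :
    statSurv P π (diagAll V k) ((N - 1) • U) + k * e ^ 2
      ≤ 1 - (k.choose 2 : ℝ) * (1 - statSurv P π (diag₂ V) (N • U))
        * (1 - 6 * ((k.choose 2 : ℝ) * e)) := by
  have hl := one_le_choose hk
  have hkl := cast_le_two_mul_choose hk
  have he := h.e_pos
  have hτ1 := h.le_hit
  have hτ2 := h.hit_le
  have hN : N - 1 + 1 = N := by have := h.N_ge; omega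
  have hNU : 0 < N • U := nsmul_pos h.U_pos (by have := h.N_ge; omega)
  have hg1 : 1 - statSurv P π (diag₂ V) ((N - 1) • U) ≤ 1 - statSurv P π (diag₂ V) (N • U) := by
    have := statSurv_antitone (π := π) hP (diag₂ V)
      (nsmul_le_nsmul_left (zero_le) (Nat.sub_le N 1) : (N - 1) • U ≤ N • U)
    linarith
  have hc : ∀ x, hitFrom P π (N • U) x
      ≤ (1 - statSurv P π (diag₂ V) (N • U)) + 3 * e ^ 2 := fun x => by
    have h1 := hitFrom_add_le (π := π) hP h.U_pos (a := 1) (by simpa using h.mix) (N - 1) x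
    rw [add_comm 1, hN, one_smul] at h1
    have := h.hit x
    linarith
  have h1 := le_one_sub_statSurv (k := k) hP hM hNU hc
  have h2 := statSurv_subadd (A := diagAll V k) hP hM h.U_pos (N - 1) 1
  rw [hN, one_smul] at h2
  have h3 := one_sub_statSurv_le (k := k) (π := π) hP U
  have h4 := one_sub_statSurv_le_of_hitFrom h.hit
  set t := 1 - statSurv P π (diag₂ V) (N • U)
  set l : ℝ := (k.choose 2 : ℝ)
  have h5 : l * (1 - statSurv P π (diag₂ V) U) ≤ l * e ^ 2 := by gcongr
  have he1 : e ≤ 1 / 10000 := by nlinarith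
  have h6 : (k : ℝ) * e ^ 2 ≤ 2 * l * e ^ 2 := by gcongr
  have h7 : l * e ^ 2 ≤ l * t * (l * e) := by
    have : e * e ≤ t * (l * e) := mul_le_mul hτ1 (by nlinarith) he.le (by linarith)
    nlinarith
  have h8 : l ^ 2 * (t + 3 * e ^ 2) * t ≤ l * t * (l * e) * 3 := by
    have : t + 3 * e ^ 2 ≤ 3 * e := by nlinarith
    calc l ^ 2 * (t + 3 * e ^ 2) * t ≤ l ^ 2 * (3 * e) * t := by gcongr; linarith
      _ = _ := by ring
  nlinarith

/-- Only the union bound is needed in this direction. The `8` is `2` from the mixing error in the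
window, and `2 * (1 + 2)` from twice the probability, mixing error included, of a meeting in the
gap. The factor `2` in front of the gap term is supplied by the induction in `tail_lower`. -/
theorem lower_factor (h : IsWindow P π U e N) (hP : IsMarkovChain q P)
    (hk : 2 ≤ k) :
    1 - (k.choose 2 : ℝ) * (1 - statSurv P π (diag₂ V) (N • U)) * (1 + 8 * ((k.choose 2 : ℝ) * e))
      ≤ statSurv P π (diagAll V k) ((N - 1) • U) - k * e ^ 2
        - 2 * (1 - statSurv P π (diagAll V k) U + k * e ^ 2) := by
  have hl := one_le_choose hk
  have hkl := cast_le_two_mul_choose hk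
  have he := h.e_pos
  have hτ1 := h.le_hit
  have h1 : statSurv P π (diagAll V k) (N • U) ≤ statSurv P π (diagAll V k) ((N - 1) • U) :=
    statSurv_antitone hP _ (nsmul_le_nsmul_left (zero_le) (Nat.sub_le N 1))
  have h2 := statSurv_ge (k := k) (π := π) (U := U) (N := N) hP
  have h3 := one_sub_statSurv_le (k := k) (π := π) hP U
  have h4 := one_sub_statSurv_le_of_hitFrom h.hit
  set t := 1 - statSurv P π (diag₂ V) (N • U)
  set l : ℝ := (k.choose 2 : ℝ)
  have h5 : l * (1 - statSurv P π (diag₂ V) U) ≤ l * e ^ 2 := by gcongr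
  have h6 : (k : ℝ) * e ^ 2 ≤ 2 * l * e ^ 2 := by gcongr
  have h7 : l * e ^ 2 ≤ l * t * (l * e) := by
    have : e * e ≤ t * (l * e) := mul_le_mul hτ1 (by nlinarith) he.le (by linarith)
    nlinarith
  nlinarith

variable {ν : (Fin k → V) → ℝ≥0∞}

theorem tail_upper (h : IsWindow P π U e N) (hP : IsMarkovChain q P) (hM : IsMixing P π)
    (hk : 2 ≤ k) (hx : (k.choose 2 : ℝ) * e ≤ 1 / 10000) (hν : ∑ x, ν x = 1) {t : ℝ} (ht : 0 < t) :
    (walkersFrom P ν).real {w | ENNReal.ofReal t ≤ meetingTime w}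
      ≤ (1 + 3 * ((k.choose 2 : ℝ) * e)) * Real.exp (-t *
        ((k.choose 2 : ℝ) * (1 - statSurv P π (diag₂ V) (N • U))
          * (1 - 6 * ((k.choose 2 : ℝ) * e))) / ((N • U : ℝ≥0) : ℝ)) := by
  have hl := one_le_choose hk
  have he := h.e_pos
  have hN := h.N_ge
  have hτ1 := h.le_hit
  have hτ2 := h.hit_le
  have hNU : 0 < N • U := nsmul_pos h.U_pos (by omega)
  have hf := h.upper_factor hP hM hk hx
  set s := 1 - statSurv P π (diag₂ V) (N • U)
  set l : ℝ := (k.choose 2 : ℝ)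
  have hx0 : 0 < l * e := by positivity
  have hy0 : 0 ≤ l * s * (1 - 6 * (l * e)) := mul_nonneg (by nlinarith) (by linarith)
  have hy : l * s * (1 - 6 * (l * e)) ≤ 2 * (l * e) := by
    have : l * s ≤ 2 * (l * e) := by nlinarith
    have h0 : 0 ≤ l * s := by nlinarith
    nlinarith
  set y := l * s * (1 - 6 * (l * e))
  have h1 := tail_le_exp hP hν hNU (θ := 1 - y) (by linarith) (by linarith) (fun j => by
    have h2 := survFrom_le_mul hP hν h.U_pos (a := 1) (by simpa using h.mix) (j * N) (N - 1)
    have e1 : (j * N + (1 + (N - 1))) • U = (j + 1) • N • U := by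
      rw [smul_smul]; congr 1; rw [show 1 + (N - 1) = N by omega]; ring
    rw [e1, ← smul_smul] at h2
    exact h2.trans (mul_le_mul_of_nonneg_left hf (survFrom_nonneg _))) ht
  refine h1.trans ?_
  rw [sub_sub_cancel]
  gcongr
  rw [inv_le_iff_one_le_mul₀ (by linarith)]
  nlinarith

theorem tail_lower (h : IsWindow P π U e N) (hP : IsMarkovChain q P)
    (hk : 2 ≤ k) (hx : (k.choose 2 : ℝ) * e ≤ 1 / 10000) (hν : ∑ x, ν x = 1) {c : ℝ}
    (hc0 : 0 ≤ c) (hc : c ≤ survFrom P ν (N • U)) (hc2 : 1 / 2 ≤ survFrom P ν (N • U)) {t : ℝ}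
    (ht : 0 < t) :
    c * Real.exp (-t * ((k.choose 2 : ℝ) * (1 - statSurv P π (diag₂ V) (N • U))
        * (1 + 12 * ((k.choose 2 : ℝ) * e))) / ((N • U : ℝ≥0) : ℝ))
      ≤ (walkersFrom P ν).real {w | ENNReal.ofReal t ≤ meetingTime w} := by
  have hl := one_le_choose hk
  have he := h.e_pos
  have hN := h.N_ge
  have hτ1 := h.le_hit
  have hτ2 := h.hit_le
  have hNU : 0 < N • U := nsmul_pos h.U_pos (by omega)
  have hf := h.lower_factor (k := k) hP hk
  have hG : statSurv P π (diagAll V k) U ≤ 1 := statSurv_le_one hP _ _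
  set s := 1 - statSurv P π (diag₂ V) (N • U)
  set l : ℝ := (k.choose 2 : ℝ)
  have hx0 : 0 < l * e := by positivity
  have hls : l * s ≤ 2 * (l * e) := by nlinarith
  have hls0 : 0 < l * s := by nlinarith
  have hy0 : 0 ≤ l * s * (1 + 8 * (l * e)) := by positivity
  have hy : l * s * (1 + 8 * (l * e)) ≤ 21 / 10 * (l * e) := by nlinarith
  set y := l * s * (1 + 8 * (l * e)) with hydef
  -- `mul_sub_mul_le_survFrom` subtracts a multiple of survival at a time before the current one. To
  -- absorb it, one needs that survival at most halves over one window. This holds for the first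
  -- window by `hc2`, and the ratio bound then carries it to the next window, since `1 - y ≥ 1 / 2`.
  have key : ∀ j : ℕ, survFrom P ν (j • N • U) ≤ 2 * survFrom P ν ((j + 1) • N • U) ∧
      survFrom P ν ((j + 1) • N • U) * (1 - y) ≤ survFrom P ν ((j + 2) • N • U) := by
    have step : ∀ j : ℕ, survFrom P ν (j • N • U) ≤ 2 * survFrom P ν ((j + 1) • N • U) →
        survFrom P ν ((j + 1) • N • U) * (1 - y) ≤ survFrom P ν ((j + 2) • N • U) := by
      intro j hj
      have h2 := mul_sub_mul_le_survFrom hP hν h.U_pos (a := 1) (by simpa using h.mix)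
        (j * N + (N - 1)) (N - 1)
      have e1 : (j * N + (N - 1) + 1 + (1 + (N - 1))) • U = (j + 2) • N • U := by
        rw [smul_smul]; congr 1
        obtain ⟨M, rfl⟩ : ∃ M, N = M + 1 := ⟨N - 1, by omega⟩
        simp only [Nat.add_sub_cancel]; ring
      have e2 : (j * N + (N - 1) + 1) • U = (j + 1) • N • U := by
        rw [smul_smul]; congr 1
        obtain ⟨M, rfl⟩ : ∃ M, N = M + 1 := ⟨N - 1, by omega⟩
        simp only [Nat.add_sub_cancel]; ring
      rw [e2, e1, one_smul] at h2
      have h3 : survFrom P ν ((j * N + (N - 1)) • U) ≤ survFrom P ν (j • N • U) := by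
        refine survFrom_antitone hP hν ?_
        rw [smul_smul]
        exact nsmul_le_nsmul_left (zero_le) (by omega)
      have h4 : 0 ≤ 1 - statSurv P π (diagAll V k) U + k * e ^ 2 := by
        have : (0 : ℝ) ≤ k * e ^ 2 := by positivity
        linarith
      have h5 := mul_le_mul_of_nonneg_right (h3.trans hj) h4
      have h6 := mul_le_mul_of_nonneg_left hf (survFrom_nonneg (P := P) (ν := ν) ((j + 1) • N • U))
      nlinarith
    intro j
    induction j with
    | zero =>
      have h0 : survFrom P ν (0 • N • U) ≤ 2 * survFrom P ν ((0 + 1) • N • U) := by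
        have := survFrom_le_one hP hν (0 • N • U)
        rw [zero_add, one_smul]
        linarith
      exact ⟨h0, step 0 h0⟩
    | succ j ih =>
      have h0 : survFrom P ν ((j + 1) • N • U) ≤ 2 * survFrom P ν ((j + 1 + 1) • N • U) := by
        have := ih.2
        have h1 := survFrom_nonneg (P := P) (ν := ν) ((j + 1) • N • U)
        have h2 : survFrom P ν ((j + 1) • N • U) * (1 / 2)
          ≤ survFrom P ν ((j + 1) • N • U) * (1 - y) := by gcongr; linarith
        rw [show j + 1 + 1 = j + 2 from rfl]
        linarith
      exact ⟨h0, step (j + 1) h0⟩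
  have h1 := exp_le_tail hP hν hNU (θ := 1 - y) (by linarith) (by linarith) hc0 hc
    (fun j => (key j).2) ht
  refine le_trans ?_ h1
  gcongr c * Real.exp (?_ / _)
  rw [neg_mul, neg_mul, neg_le_neg_iff]
  gcongr
  rw [sub_le_iff_le_add, inv_le_iff_one_le_mul₀ (by linarith), hydef]
  have h8 : 0 ≤ l * s * (l * e) := by positivity
  nlinarith

/-- Integrating the tails for two stationary walkers compares `m` with window length over meeting
probability; this allows the window to be eliminated from the result for `k` walkers. The stationary
start survives its first window with probability at least `1 - 2 * e`. -/
theorem mean_bounds (h : IsWindow P π U e N) (hP : IsMarkovChain q P) (hM : IsMixing P π)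
    (hx : e ≤ 1 / 10000) :
    meanMeeting P π * ((1 - statSurv P π (diag₂ V) (N • U)) * (1 - 6 * e))
      ≤ (1 + 3 * e) * ((N • U : ℝ≥0) : ℝ) ∧
    (1 - 2 * e) * ((N • U : ℝ≥0) : ℝ)
      ≤ meanMeeting P π * ((1 - statSurv P π (diag₂ V) (N • U)) * (1 + 12 * e)) := by
  have hν := sum_prod_pmf (k := 2) π
  have := isProbabilityMeasure_walkersFrom hP hν
  have he := h.e_pos
  have hN := h.N_ge
  have hτ1 := h.le_hit
  have hτ2 := h.hit_le
  have hNU : (0 : ℝ) < ((N • U : ℝ≥0) : ℝ) := by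
    have : 0 < N • U := nsmul_pos h.U_pos (by omega)
    exact_mod_cast this
  have hu : ∀ t : ℝ, 0 < t → _ := fun t ht =>
    h.tail_upper hP hM (le_refl 2) (by simpa using hx) hν ht
  have hsurv : 1 - 2 * e ≤ survFrom P (fun x : Fin 2 → V => ∏ i, π (x i)) (N • U) := by
    rw [survFrom_prod hP, diagAll_two]
    linarith
  have hlo : ∀ t : ℝ, 0 < t → _ := fun t ht =>
    h.tail_lower hP (le_refl 2) (by simpa using hx) hν (c := 1 - 2 * e) (by linarith) hsurv
      (by linarith) ht
  simp only [Nat.choose_self, Nat.cast_one, one_mul] at hu hlo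
  set s := 1 - statSurv P π (diag₂ V) (N • U)
  set u : ℝ := ((N • U : ℝ≥0) : ℝ)
  have hs : 0 < s := by linarith
  have h6 : 0 < 1 - 6 * e := by linarith
  have hB : 0 < u / (s * (1 - 6 * e)) := by positivity
  have hu' : ∀ t : ℝ, 0 < t → (walkersFrom P fun x : Fin 2 → V => ∏ i, π (x i)).real
      {w | ENNReal.ofReal t ≤ meetingTime w}
      ≤ (1 + 3 * e) * Real.exp (-t / (u / (s * (1 - 6 * e)))) := fun t ht => by
    rw [div_div_eq_mul_div]
    exact hu t ht
  have hlo' : ∀ t : ℝ, 0 < t → (1 - 2 * e) * Real.exp (-t / (u / (s * (1 + 12 * e))))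
      ≤ (walkersFrom P fun x : Fin 2 → V => ∏ i, π (x i)).real
        {w | ENNReal.ofReal t ≤ meetingTime w} := fun t ht => by
    rw [div_div_eq_mul_div]
    exact hlo t ht
  have hmeas := measurable_meetingTime.aemeasurable (α := Fin 2 → StepPath V)
    (μ := walkersFrom P fun x : Fin 2 → V => ∏ i, π (x i))
  have hU := lintegral_le_of_tail hmeas hB (by positivity) hu'
  have hfin := ne_top_of_le_ne_top ENNReal.ofReal_ne_top hU
  have hL := le_lintegral_of_tail hmeas (ae_ne_top_of_tail hB hu')
    (by positivity : 0 < u / (s * (1 + 12 * e))) (by linarith) hlo'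
  have hU' := ENNReal.toReal_mono ENNReal.ofReal_ne_top hU
  rw [ENNReal.toReal_ofReal (by positivity)] at hU'
  have hL' := (ENNReal.ofReal_le_iff_le_toReal hfin).1 hL
  constructor
  · calc meanMeeting P π * (s * (1 - 6 * e))
        ≤ (1 + 3 * e) * (u / (s * (1 - 6 * e))) * (s * (1 - 6 * e)) := by
          gcongr
          exact hU'
      _ = (1 + 3 * e) * u := by
          rw [mul_assoc, div_mul_cancel₀ _ (mul_pos hs h6).ne']
  · calc (1 - 2 * e) * u = (1 - 2 * e) * (u / (s * (1 + 12 * e))) * (s * (1 + 12 * e)) := by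
          field_simp
      _ ≤ _ := by
          gcongr
          exact hL'

end IsWindow

end Core

/-! ### Eliminating the window: the law in terms of the mean meeting time. -/

section NearExp

variable {V : Type u} [Fintype V] {k : ℕ} {q : V → V → ℝ≥0} {P : V → Measure (StepPath V)}
  {π : PMF V}

theorem real_meetingTime_le (hP : IsMarkovChain q P) {ν : (Fin k → V) → ℝ≥0∞}
    (hν : ∑ x, ν x = 1) (T : ℝ≥0) :
    (walkersFrom P ν).real {w | meetingTime w ≤ (T : ℝ≥0∞)} = 1 - survFrom P ν T := by
  have := isProbabilityMeasure_walkersFrom hP hν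
  have e : {w : Fin k → StepPath V | meetingTime w ≤ (T : ℝ≥0∞)}
      = (pathAvoid k (diagAll V k) T)ᶜ := by
    ext w
    exact meetingTime_le_iff
  rw [e, probReal_compl_eq_one_sub (measurableSet_pathAvoid _ T), survFrom]

/-- The tail bounds have rate `l * s / u` up to `O(x)`, and `mean_bounds` gives `m * s = u * (1 +
O(x))`, where `x = l * e`. All these errors fit under `1000 * x`, which is `l` times the error
parameter once `e` is a thousandth of it. -/
theorem IsWindow.nearExp {T : ℝ≥0} {e : ℝ} {N : ℕ} (h : IsWindow P π (5 • T) e N)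
    (hP : IsMarkovChain q P) (hM : IsMixing P π) (hk : 2 ≤ k)
    (hx : (k.choose 2 : ℝ) * e ≤ 1 / 10000) (hT : ∀ x, tvAt P π x T ≤ (1000 * e) ^ 2)
    {ν : (Fin k → V) → ℝ≥0∞} (hν : ∑ x, ν x = 1) :
    IsNearExp (walkersFrom P ν) meetingTime (meanMeeting P π / (k.choose 2 : ℝ))
      ((k.choose 2 : ℝ) * (1000 * e)
        + 2 * (walkersFrom P ν).real {w | meetingTime w ≤ (T : ℝ≥0∞)})
      ((k.choose 2 : ℝ) * (1000 * e)) := by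
  have := isProbabilityMeasure_walkersFrom hP hν
  have hl := one_le_choose hk
  have hkl := cast_le_two_mul_choose hk
  have he := h.e_pos
  have hN := h.N_ge
  have hτ1 := h.le_hit
  have hτ2 := h.hit_le
  have he1 : e ≤ 1 / 10000 := by nlinarith
  have hNU : (0 : ℝ) < ((N • 5 • T : ℝ≥0) : ℝ) := by
    have : 0 < N • 5 • T := nsmul_pos h.U_pos (by omega)
    exact_mod_cast this
  have hT0 : 0 < T := by
    have := h.U_pos
    rw [nsmul_eq_mul] at this
    exact pos_of_mul_pos_right this (zero_le)
  obtain ⟨hm1, hm2⟩ := h.mean_bounds hP hM he1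
  have hu : ∀ t : ℝ, 0 < t → _ := fun t ht => h.tail_upper hP hM hk hx hν ht
  have hlo := fun (c : ℝ) hc0 hc hc2 (t : ℝ) (ht : 0 < t) =>
    h.tail_lower hP hk hx hν (c := c) hc0 hc hc2 ht
  have hr := real_meetingTime_le hP hν T
  have hr0 : 0 ≤ (walkersFrom P ν).real {w | meetingTime w ≤ (T : ℝ≥0∞)} := measureReal_nonneg
  -- The first window is split at `T`, not at the unit `5 • T`, so that `r` refers to meetings up to
  -- `T`. The price is the weaker mixing bound `(1000 * e) ^ 2`.
  have hbase : 1 - (walkersFrom P ν).real {w | meetingTime w ≤ (T : ℝ≥0∞)}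
      - (k.choose 2 : ℝ) * (1 - statSurv P π (diag₂ V) (N • 5 • T)) - k * (1000 * e) ^ 2
      ≤ survFrom P ν (N • 5 • T) := by
    have h1 := le_survFrom (k := k) hP hν hT0 (a := 1) (by simpa using hT) (N * 5 - 1)
    rw [show 1 + (N * 5 - 1) = N * 5 by omega, ← smul_smul, one_smul] at h1
    have h2 : statSurv P π (diagAll V k) (N • 5 • T)
        ≤ statSurv P π (diagAll V k) ((N * 5 - 1) • T) := by
      refine statSurv_antitone hP _ ?_
      rw [smul_smul]
      exact nsmul_le_nsmul_left (zero_le) (by omega)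
    have h3 := IsWindow.statSurv_ge (k := k) (π := π) (U := 5 • T) (N := N) hP
    linarith
  set r := (walkersFrom P ν).real {w | meetingTime w ≤ (T : ℝ≥0∞)}
  set s := 1 - statSurv P π (diag₂ V) (N • 5 • T)
  set l : ℝ := (k.choose 2 : ℝ)
  set m := meanMeeting P π
  set u : ℝ := ((N • 5 • T : ℝ≥0) : ℝ)
  set x := l * e with hxdef
  have hex : e ≤ x := by nlinarith
  have hs : 0 < s := by linarith
  have hx0 : 0 < x := by linarith
  have hms1 : (1 - 14 * x) * u ≤ m * s := by
    have h1 : (1 - 14 * e) * (1 + 12 * e) * u ≤ m * s * (1 + 12 * e) := by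
      refine le_trans ?_ (hm2.trans (le_of_eq (by ring)))
      gcongr
      nlinarith
    have h2 : (1 - 14 * e) * u ≤ m * s := by
      refine le_of_mul_le_mul_right ?_ (by linarith : 0 < 1 + 12 * e)
      linarith
    refine le_trans ?_ h2
    gcongr
  have hms0 : 0 < m * s := lt_of_lt_of_le (mul_pos (by linarith) hNU) hms1
  have hm : 0 < m := pos_of_mul_pos_left hms0 hs.le
  have hms2 : m * s ≤ (1 + 10 * x) * u := by
    have h1 : m * s * (1 - 6 * e) ≤ (1 + 10 * e) * (1 - 6 * e) * u := by
      refine le_trans (le_of_eq (by ring)) (hm1.trans ?_)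
      gcongr
      nlinarith
    have h2 : m * s ≤ (1 + 10 * e) * u := by
      refine le_of_mul_le_mul_right ?_ (by linarith : 0 < 1 - 6 * e)
      linarith
    refine h2.trans ?_
    gcongr
  have hb : l * (1000 * e) = 1000 * x := by rw [hxdef]; ring
  have hl0 : 0 < l := by linarith
  rw [hb]
  have hb1 : 1000 * x < 1 := by linarith
  have hke : (k : ℝ) * (1000 * e) ^ 2 ≤ 200 * x := by
    calc (k : ℝ) * (1000 * e) ^ 2 ≤ 2 * l * (1000 * e) ^ 2 := by gcongr
      _ = 2000000 * x * e := by rw [hxdef]; ring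
      _ ≤ 2000000 * x * (1 / 10000) := by gcongr
      _ = 200 * x := by ring
  have hls : l * s ≤ 2 * x := by rw [hxdef]; nlinarith
  refine ⟨by positivity, by positivity, by positivity, hb1,
    measurable_meetingTime.aemeasurable, ?_, ?_, ?_⟩
  · refine ae_ne_top_of_tail (A := 1 + 3 * x) (B := u / (l * s * (1 - 6 * x))) ?_ fun t ht => ?_
    · have : 0 < 1 - 6 * x := by linarith
      positivity
    · rw [div_div_eq_mul_div]
      exact hu t ht
  · intro t ht
    -- If the coefficient is nonpositive nothing is claimed. Otherwise `r < 1 / 2 - 500 * x`, and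
    -- `hbase` gives survival above `1 / 2` in the first window, as `tail_lower` requires; this is
    -- the reason for `2 * r` instead of `r`.
    rcases le_or_gt 1 (1000 * x + 2 * r) with h1 | h1
    · refine le_trans ?_ measureReal_nonneg
      exact mul_nonpos_of_nonpos_of_nonneg (by linarith) (Real.exp_pos _).le
    · refine le_trans ?_ (hlo (1 - (1000 * x + 2 * r)) (by linarith) (by linarith)
        (by linarith) t ht)
      gcongr _ * Real.exp ?_
      rw [neg_mul, neg_div, neg_div, neg_le_neg_iff, mul_div_assoc, div_eq_mul_inv t]
      gcongr
      rw [le_inv_comm₀ (by positivity) (mul_pos (by linarith) (by positivity)), inv_div,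
        le_div_iff₀ (by positivity)]
      calc (1 - 1000 * x) * (m / l) * (l * s * (1 + 12 * x))
          = (1 - 1000 * x) * (1 + 12 * x) * (m * s) := by field_simp
        _ ≤ (1 - 1000 * x) * (1 + 12 * x) * ((1 + 10 * x) * u) := by
            have : 0 ≤ (1 - 1000 * x) * (1 + 12 * x) := mul_nonneg (by linarith) (by linarith)
            gcongr
        _ = ((1 - 1000 * x) * ((1 + 12 * x) * (1 + 10 * x))) * u := by ring
        _ ≤ 1 * u := by
            gcongr
            have : (1 + 12 * x) * (1 + 10 * x) ≤ 1 + 30 * x := by nlinarith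
            nlinarith
        _ = u := one_mul u
  · intro t ht
    refine (hu t ht).trans ?_
    gcongr ?_ * Real.exp ?_
    · linarith
    rw [neg_mul, neg_div, neg_div, neg_le_neg_iff, mul_div_assoc, div_eq_mul_inv t]
    gcongr
    have h6 : 0 < 1 - 6 * x := by linarith
    rw [inv_le_comm₀ (by positivity) (by positivity), inv_div, div_le_iff₀ (by positivity)]
    calc u = 1 * u := (one_mul u).symm
      _ ≤ ((1 + 1000 * x) * ((1 - 6 * x) * (1 - 14 * x))) * u := by
          gcongr
          have : 1 - 20 * x ≤ (1 - 6 * x) * (1 - 14 * x) := by nlinarith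
          nlinarith
      _ = (1 + 1000 * x) * (1 - 6 * x) * ((1 - 14 * x) * u) := by ring
      _ ≤ (1 + 1000 * x) * (1 - 6 * x) * (m * s) := by gcongr
      _ = (1 + 1000 * x) * (m / l) * (l * s * (1 - 6 * x)) := by field_simp

end NearExp

/-! ### Use of the jump rates: continuity, holding probabilities, occupation bound, symmetry. -/

section Rates

open Matrix

variable {V : Type u} [Fintype V] {k : ℕ} {q : V → V → ℝ≥0} {P : V → Measure (StepPath V)}
  {π : PMF V}

theorem tendsto_coe_nhdsGT_zero : Tendsto (fun e : ℝ≥0 => (e : ℝ)) (𝓝[>] 0) (𝓝 0) := by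
  have : Tendsto (fun e : ℝ≥0 => (e : ℝ)) (𝓝 0) (𝓝 ((0 : ℝ≥0) : ℝ)) :=
    NNReal.continuous_coe.tendsto 0
  exact this.mono_left nhdsWithin_le_nhds

theorem coe_pos_eventually : ∀ᶠ e : ℝ≥0 in 𝓝[>] 0, (0 : ℝ) < e :=
  eventually_mem_nhdsWithin.mono fun e (he : 0 < e) => by exact_mod_cast he

open Classical in
theorem tendsto_one_sub_trans_div (hP : IsMarkovChain q P) (x : V) :
    Tendsto (fun e : ℝ≥0 => (1 - trans P e x x) / (e : ℝ)) (𝓝[>] 0)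
      (𝓝 (∑ y ∈ Finset.univ.filter (fun y => y ≠ x), (q x y : ℝ))) := by
  have h : Tendsto (fun e : ℝ≥0 => ∑ y ∈ Finset.univ.filter (fun y => y ≠ x),
      trans P e x y / (e : ℝ)) (𝓝[>] 0)
      (𝓝 (∑ y ∈ Finset.univ.filter (fun y => y ≠ x), (q x y : ℝ))) :=
    tendsto_finsetSum _ fun y hy => hP.rate x y (Finset.mem_filter.1 hy).2.symm
  refine h.congr fun e => ?_
  rw [← Finset.sum_div]
  congr 1
  have h1 := sum_trans hP e x
  rw [← Finset.add_sum_erase _ _ (Finset.mem_univ x)] at h1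
  have h2 : Finset.univ.filter (fun y => y ≠ x) = Finset.univ.erase x := by
    ext y
    simp
  rw [h2]
  linarith

theorem tendsto_trans_nhdsGT_zero (hP : IsMarkovChain q P) (x y : V) :
    Tendsto (fun e : ℝ≥0 => trans P e x y) (𝓝[>] 0) (𝓝 (trans P 0 x y)) := by
  classical
  by_cases hxy : x = y
  · subst hxy
    rw [trans_zero hP]
    have h := ((tendsto_one_sub_trans_div hP x).mul tendsto_coe_nhdsGT_zero).const_sub 1
    rw [mul_zero, sub_zero] at h
    refine h.congr' (coe_pos_eventually.mono fun e he => ?_)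
    dsimp only
    rw [div_mul_cancel₀ _ he.ne']
    ring
  · rw [(trans_semigroup hP).zero_ne hxy]
    have h := (hP.rate x y hxy).mul tendsto_coe_nhdsGT_zero
    rw [mul_zero] at h
    refine h.congr' (coe_pos_eventually.mono fun e he => ?_)
    dsimp only
    rw [div_mul_cancel₀ _ he.ne']
    rfl

theorem tendsto_tvAt (hP : IsMarkovChain q P) (t : ℝ≥0) (x : V) :
    Tendsto (fun e : ℝ≥0 => tvAt P π x (t + e)) (𝓝[>] 0) (𝓝 (tvAt P π x t)) := by
  have hz : ∀ y, trans P t x y = ∑ z, trans P t x z * trans P 0 z y := fun y => by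
    have := (trans_semigroup hP).add t 0
    rw [add_zero] at this
    conv_lhs => rw [this]
    rfl
  have h : ∀ y, Tendsto (fun e : ℝ≥0 => trans P (t + e) x y) (𝓝[>] 0) (𝓝 (trans P t x y)) := by
    intro y
    rw [hz y]
    have h1 : Tendsto (fun e : ℝ≥0 => ∑ z, trans P t x z * trans P e z y) (𝓝[>] 0)
        (𝓝 (∑ z, trans P t x z * trans P 0 z y)) :=
      tendsto_finsetSum _ fun z _ => (tendsto_trans_nhdsGT_zero hP z y).const_mul _
    refine h1.congr fun e => ?_
    rw [(trans_semigroup hP).add]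
    rfl
  exact (tendsto_finsetSum _ fun y _ => ((h y).sub_const _).abs).const_mul _

/-- The infimum defining the mixing time is attained because the distance is right-continuous in
time: a value above `a` at the infimum would persist just after it. -/
theorem tvAt_tmix_le (hP : IsMarkovChain q P) (hM : IsMixing P π) {a : ℝ}
    (ha : a ∈ Set.Ioo (0 : ℝ) 1) (x : V) : tvAt P π x (tmix P π a) ≤ a := by
  by_contra hlt
  rw [not_le] at hlt
  have h := (tendsto_tvAt (π := π) hP (tmix P π a) x).eventually (lt_mem_nhds hlt)
  obtain ⟨δ, hδ, hδ'⟩ := (mem_nhdsGT_iff_exists_Ioo_subset).1 h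
  have hδ : 0 < δ := hδ
  obtain ⟨T, hT⟩ := hM.mixes a ha
  obtain ⟨r, hr, hrδ⟩ := exists_lt_of_csInf_lt
    (s := {T : ℝ≥0 | ∀ x, tvAt P π x T ≤ a}) ⟨T, hT⟩ (lt_add_of_pos_right (tmix P π a) hδ)
  have hle : tmix P π a ≤ r := csInf_le (OrderBot.bddBelow _) hr
  rcases hle.eq_or_lt with heq | hlt'
  · rw [heq] at hlt
    exact absurd (hr x) (not_le.2 hlt)
  · have h1 : r - tmix P π a ∈ Set.Ioo 0 δ :=
      ⟨tsub_pos_of_lt hlt', (tsub_lt_iff_left hle).2 hrδ⟩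
    have h2 : a < tvAt P π x (tmix P π a + (r - tmix P π a)) := hδ' h1
    rw [add_tsub_cancel_of_le hle] at h2
    exact absurd (hr x) (not_le.2 h2)

theorem tmix_le {a : ℝ} {T : ℝ≥0} (h : ∀ x, tvAt P π x T ≤ a) : tmix P π a ≤ T :=
  csInf_le (OrderBot.bddBelow _) h

theorem one_sub_weights_le_tvAt_zero (hP : IsMarkovChain q P) (x : V) :
    1 - weights π x ≤ tvAt P π x 0 := by
  classical
  have h1 := sum_weights π
  rw [← Finset.add_sum_erase _ _ (Finset.mem_univ x)] at h1
  have h2 : tvAt P π x 0 = 1 / 2 * ∑ y, |trans P 0 x y - weights π y| := rfl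
  rw [h2, ← Finset.add_sum_erase _ _ (Finset.mem_univ x), trans_zero hP]
  have h3 : ∑ y ∈ Finset.univ.erase x, |trans P 0 x y - weights π y|
      = ∑ y ∈ Finset.univ.erase x, weights π y := by
    refine Finset.sum_congr rfl fun y hy => ?_
    rw [(trans_semigroup hP).zero_ne (Finset.mem_erase.1 hy).1.symm, zero_sub, abs_neg,
      abs_of_nonneg (weights_nonneg π y)]
  rw [h3]
  have := le_abs_self (1 - weights π x)
  linarith

/-- At time zero the distance from state `x` is at least `1 - π x`. Two states cannot both have
stationary mass above one half. -/
theorem tmix_pos [Nontrivial V] (hP : IsMarkovChain q P) (hM : IsMixing P π) {a : ℝ} (ha : 0 < a)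
    (ha' : a < 1 / 2) : 0 < tmix P π a := by
  classical
  rw [pos_iff_ne_zero]
  intro h0
  have h : ∀ x, 1 - weights π x ≤ a := fun x => by
    have := tvAt_tmix_le hP hM ⟨ha, by linarith⟩ x
    rw [h0] at this
    exact (one_sub_weights_le_tvAt_zero hP x).trans this
  obtain ⟨x, y, hxy⟩ := exists_pair_ne V
  have h1 : ∑ z ∈ {x, y}, weights π z ≤ ∑ z, weights π z :=
    Finset.sum_le_sum_of_subset_of_nonneg (Finset.subset_univ _) fun z _ _ => weights_nonneg π z
  rw [Finset.sum_pair hxy, sum_weights] at h1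
  have := h x
  have := h y
  linarith

theorem trans_self_pow_le (hP : IsMarkovChain q P) (x : V) (h : ℝ≥0) (n : ℕ) :
    trans P h x x ^ n ≤ trans P (n • h) x x := by
  induction n with
  | zero => rw [pow_zero, zero_smul, trans_zero hP]
  | succ n ih =>
    rw [succ_nsmul, (trans_semigroup hP).add, pow_succ]
    refine (mul_le_mul_of_nonneg_right ih (trans_nonneg h x x)).trans ?_
    exact Finset.single_le_sum (f := fun z => trans P (n • h) x z * trans P h z x)
      (fun z _ => mul_nonneg (trans_nonneg _ _ _) (trans_nonneg _ _ _)) (Finset.mem_univ x)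

theorem tendsto_div_nat_nhdsGT {t : ℝ≥0} (ht : 0 < t) :
    Tendsto (fun n : ℕ => t / n) atTop (𝓝[>] 0) := by
  refine tendsto_nhdsWithin_iff.2 ⟨?_, (eventually_gt_atTop 0).mono fun n hn => ?_⟩
  · rw [← NNReal.tendsto_coe]
    simpa using tendsto_const_div_atTop_nhds_zero_nat (t : ℝ)
  · exact div_pos ht (by exact_mod_cast hn)

/-- A return probability dominates the probability of being at `x` at all times of a grid of mesh `t
/ n`, which tends to `exp (-κ * t)`, with `κ` the total rate out of `x`. -/
theorem exp_le_trans_self (hP : IsMarkovChain q P) (x : V) (t : ℝ≥0) :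
    Real.exp (-(qMax q * t)) ≤ trans P t x x := by
  classical
  rcases eq_or_ne t 0 with rfl | ht
  · rw [trans_zero hP]
    simp
  have ht : 0 < t := pos_iff_ne_zero.2 ht
  have ht' : (0 : ℝ) < t := by exact_mod_cast ht
  set κ : ℝ := ∑ y ∈ Finset.univ.filter (fun y => y ≠ x), (q x y : ℝ) with hκ
  have hκle : κ ≤ qMax q := by
    have : ∑ y ∈ Finset.univ.filter (fun y => y ≠ x), q x y ≤ qMax q := by
      unfold qMax
      convert Finset.le_sup (f := fun x => ∑ y ∈ Finset.univ.filter (fun y => y ≠ x), q x y)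
        (Finset.mem_univ x)
    rw [hκ]
    exact_mod_cast this
  have h1 := (tendsto_one_sub_trans_div hP x).comp (tendsto_div_nat_nhdsGT ht)
  have h2 : Tendsto (fun n : ℕ => (n : ℝ) * (trans P (t / n) x x - 1)) atTop (𝓝 (-(κ * t))) := by
    refine ((h1.mul_const (t : ℝ)).neg).congr' ((eventually_gt_atTop 0).mono fun n hn => ?_)
    have hn' : (0 : ℝ) < n := by exact_mod_cast hn
    simp only [Function.comp_apply]
    push_cast
    field_simp
    ring
  have h3 := Real.tendsto_one_add_pow_exp_of_tendsto h2
  refine le_trans (Real.exp_le_exp.2 ?_) (le_of_tendsto h3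
    ((eventually_gt_atTop 0).mono fun n hn => ?_))
  · rw [neg_le_neg_iff]
    gcongr
  · have h4 := trans_self_pow_le hP x (t / n) n
    have hn' : (n : ℝ≥0) ≠ 0 := by exact_mod_cast hn.ne'
    rw [nsmul_eq_mul, mul_div_cancel₀ _ hn'] at h4
    simpa using h4

theorem weights_le_piMax (x : V) : weights π x ≤ piMax π := by
  refine ENNReal.toReal_mono ?_ (Finset.le_sup (f := fun x => π x) (Finset.mem_univ x))
  rw [← lt_top_iff_ne_top, Finset.sup_lt_iff (by simp)]
  exact fun y _ => lt_top_iff_ne_top.2 (π.apply_ne_top y)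

theorem tendsto_hitFrom (hP : IsMarkovChain q P) {T : ℝ≥0} (hT : 0 < T) (j : ℕ) (x : V) :
    Tendsto (fun n : ℕ => ∑ z, weights π z * hit₂ (trans P (T / 2 ^ n)) (j * 2 ^ n) x z) atTop
      (𝓝 (hitFrom P π (j • T) x)) :=
  tendsto_finsetSum _ fun z _ =>
    ((tendsto_surv hP (diag₂ V) hT j ![x, z]).const_sub 1).const_mul _

/-- At time `t` the stationary walker has law `π` and is independent of the other one, so it is
found at the other's position with probability at most `piMax π`. -/
theorem sum_weights_prodK_diag (hP : IsMarkovChain q P) (hM : IsMixing P π) (t : ℝ≥0) (x : V) :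
    ∑ z, weights π z * (prodK (trans P t) 2 *ᵥ (diag₂ V).indicator 1) ![x, z] ≤ piMax π := by
  classical
  have h1 : ∀ z, (prodK (trans P t) 2 *ᵥ (diag₂ V).indicator 1) ![x, z]
      = ∑ a, trans P t x a * trans P t z a := by
    intro z
    simp only [mulVec, dotProduct, sum_fin_two, prodK, Fin.prod_univ_two]
    refine Finset.sum_congr rfl fun a _ => ?_
    rw [Finset.sum_eq_single a]
    · rw [Set.indicator_of_mem (show ![a, a] ∈ diag₂ V from rfl)]
      simp
    · intro b _ hb
      rw [Set.indicator_of_notMem (show ![a, b] ∉ diag₂ V from fun h => hb (Eq.symm h)), mul_zero]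
    · simp
  have h2 : ∀ a, ∑ z, weights π z * trans P t z a = weights π a := fun a =>
    congrFun (weights_stationary hP hM t) a
  calc ∑ z, weights π z * (prodK (trans P t) 2 *ᵥ (diag₂ V).indicator 1) ![x, z]
      = ∑ a, trans P t x a * ∑ z, weights π z * trans P t z a := by
        simp only [h1, Finset.mul_sum]
        rw [Finset.sum_comm]
        exact Finset.sum_congr rfl fun a _ => Finset.sum_congr rfl fun z _ => by ring
    _ ≤ ∑ a, trans P t x a * piMax π := by
        refine Finset.sum_le_sum fun a _ => ?_
        rw [h2]
        exact mul_le_mul_of_nonneg_left (weights_le_piMax a) (trans_nonneg _ _ _)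
    _ = piMax π := by rw [← Finset.sum_mul, sum_trans hP, one_mul]

theorem piMax_nonneg : 0 ≤ piMax π := ENNReal.toReal_nonneg

/-- The expected number of grid times at which the two walkers coincide is counted in two ways. It
is at most `piMax π` per grid time; and by `occupation_ge` each meeting produces at least a constant
times `m` coincidences on average. -/
theorem hitFrom_le_piMax (hP : IsMarkovChain q P) (hM : IsMixing P π) {t : ℝ≥0} (ht : 0 < t)
    (x : V) : hitFrom P π t x ≤ Real.exp 2 * (2 + qMax q * t) * piMax π := by
  have hlim := tendsto_hitFrom (π := π) hP ht 1 x
  rw [one_smul] at hlim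
  refine le_of_tendsto' hlim fun n => ?_
  rw [one_mul]
  set h : ℝ≥0 := t / 2 ^ n with hh
  set κ : ℝ := (qMax q : ℝ)
  have hκ : 0 ≤ κ := (qMax q).coe_nonneg
  have ht' : (0 : ℝ) < t := by exact_mod_cast ht
  have hκt : 0 ≤ κ * t := by positivity
  -- The indices below `m` cover a time of at most about `1 / κ`, during which each walker is found
  -- at its site with probability at least `exp (-1)`. The summand `1` keeps the stretch within the
  -- horizon when `κ * t` is small or zero.
  set m : ℕ := ⌈(2 ^ n : ℝ) / (1 + κ * t)⌉₊ with hm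
  have hm1 : (2 ^ n : ℝ) / (1 + κ * t) ≤ m := Nat.le_ceil _
  have hmpos : (0 : ℝ) < m := lt_of_lt_of_le (by positivity) hm1
  have hst := prodK_stoch (k := 2) ((trans_semigroup hP).stoch h)
  have hsg := (trans_semigroup hP).prod (k := 2)
  have hc : ∀ y ∈ diag₂ V, ∀ i < m, Real.exp (-2)
      ≤ avoid (prodK (trans P h) 2) ∅ i ((diag₂ V).indicator 1) y := by
    intro y hy i hi
    rw [hsg.avoid_empty]
    have hi' : (i : ℝ) ≤ (2 ^ n : ℝ) / (1 + κ * t) := (Nat.lt_ceil.1 hi).le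
    have h1 : κ * ((i • h : ℝ≥0) : ℝ) ≤ 1 := by
      rw [nsmul_eq_mul, hh]
      push_cast
      rw [le_div_iff₀ (by positivity)] at hi'
      have h2 : (0 : ℝ) < 2 ^ n := by positivity
      rw [← mul_assoc, mul_div_assoc', div_le_one h2]
      have : (0 : ℝ) ≤ i := by positivity
      nlinarith
    have h2 : ∀ z, Real.exp (-1) ≤ trans P (i • h) z z := fun z =>
      (Real.exp_le_exp.2 (by linarith)).trans (exp_le_trans_self hP z (i • h))
    have h3 : prodK (trans P (i • h)) 2 y y * (diag₂ V).indicator 1 y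
        ≤ (prodK (trans P (i • h)) 2 *ᵥ (diag₂ V).indicator 1) y :=
      Finset.single_le_sum
        (f := fun z => prodK (trans P (i • h)) 2 y z * (diag₂ V).indicator 1 z)
        (fun z _ => mul_nonneg ((hsg.stoch _).nonneg _ _)
          (Set.indicator_nonneg (fun _ _ => zero_le_one) z)) (Finset.mem_univ y)
    refine le_trans ?_ h3
    rw [Set.indicator_of_mem hy, Pi.one_apply, mul_one, prodK, Fin.prod_univ_two]
    calc Real.exp (-2) = Real.exp (-1) * Real.exp (-1) := by rw [← Real.exp_add]; norm_num
      _ ≤ _ := mul_le_mul (h2 _) (h2 _) (Real.exp_pos _).le (trans_nonneg _ _ _)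
  have hocc := occupation_ge hst m (2 ^ n) hc
  have hsum : (Real.exp (-2) * m) * ∑ z, weights π z * hit₂ (trans P h) (2 ^ n) x z
      ≤ ((2 ^ n + m : ℕ) : ℝ) * piMax π := by
    calc _ = ∑ z, weights π z * ((Real.exp (-2) * m) * hit₂ (trans P h) (2 ^ n) x z) := by
          rw [Finset.mul_sum]
          exact Finset.sum_congr rfl fun z _ => by ring
      _ ≤ ∑ z, weights π z * occupation (prodK (trans P h) 2) (diag₂ V) (2 ^ n + m) ![x, z] :=
          Finset.sum_le_sum fun z _ =>
            mul_le_mul_of_nonneg_left (hocc ![x, z]) (weights_nonneg π z)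
      _ = ∑ i ∈ Finset.range (2 ^ n + m), ∑ z, weights π z *
            (prodK (trans P (i • h)) 2 *ᵥ (diag₂ V).indicator 1) ![x, z] := by
          simp only [occupation, Finset.sum_apply, Finset.mul_sum, hsg.avoid_empty]
          rw [Finset.sum_comm]
      _ ≤ ∑ i ∈ Finset.range (2 ^ n + m), piMax π :=
          Finset.sum_le_sum fun i _ => sum_weights_prodK_diag hP hM _ x
      _ = _ := by simp
  have h4 : ((2 ^ n + m : ℕ) : ℝ) ≤ (2 + κ * t) * m := by
    rw [div_le_iff₀ (by positivity)] at hm1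
    push_cast
    linarith
  have h5 : Real.exp 2 * Real.exp (-2) = 1 := by rw [← Real.exp_add]; norm_num
  have h6 := hsum.trans (mul_le_mul_of_nonneg_right h4 (piMax_nonneg (π := π)))
  set S := ∑ z, weights π z * hit₂ (trans P h) (2 ^ n) x z
  refine le_of_mul_le_mul_right ?_ hmpos
  calc S * m = Real.exp 2 * (Real.exp (-2) * m * S) := by
        linear_combination (-(S * m)) * h5
    _ ≤ Real.exp 2 * ((2 + κ * t) * m * piMax π) := by gcongr
    _ = _ := by ring

/-- Row distances of stochastic semigroups are subadditive in time, so the distance at `t` is at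
most `n` times the one at `t / n`, which tends to zero. Thus the rates determine the transition
probabilities, and symmetries of the rates become symmetries of the chain. -/
theorem semigroup_unique {p p' : ℝ≥0 → Matrix V V ℝ} (hp : IsSemigroup p) (hp' : IsSemigroup p')
    (h : ∀ x y, Tendsto (fun e : ℝ≥0 => (p e x y - p' e x y) / (e : ℝ)) (𝓝[>] 0) (𝓝 0))
    (t : ℝ≥0) : p t = p' t := by
  have hadd : ∀ {s t : ℝ≥0} {a b : ℝ}, (∀ x, ∑ y, |p s x y - p' s x y| ≤ a) →
      (∀ x, ∑ y, |p t x y - p' t x y| ≤ b) → ∀ x, ∑ y, |p (s + t) x y - p' (s + t) x y| ≤ a + b := by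
    intro s t a b ha hb x
    have e : ∀ y, p (s + t) x y - p' (s + t) x y
        = ∑ z, ((p s x z - p' s x z) * p t z y + p' s x z * (p t z y - p' t z y)) := fun y => by
      rw [hp.add, hp'.add, Matrix.mul_apply, Matrix.mul_apply, ← Finset.sum_sub_distrib]
      exact Finset.sum_congr rfl fun z _ => by ring
    calc ∑ y, |p (s + t) x y - p' (s + t) x y|
        ≤ ∑ y, ∑ z, (|p s x z - p' s x z| * p t z y + p' s x z * |p t z y - p' t z y|) := by
          refine Finset.sum_le_sum fun y _ => ?_
          rw [e]
          refine (Finset.abs_sum_le_sum_abs _ _).trans (Finset.sum_le_sum fun z _ => ?_)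
          refine (abs_add_le _ _).trans (le_of_eq ?_)
          rw [abs_mul, abs_mul, abs_of_nonneg ((hp.stoch t).nonneg z y),
            abs_of_nonneg ((hp'.stoch s).nonneg x z)]
      _ = ∑ z, |p s x z - p' s x z| + ∑ z, p' s x z * ∑ y, |p t z y - p' t z y| := by
          rw [Finset.sum_comm]
          simp only [Finset.sum_add_distrib, ← Finset.mul_sum, (hp.stoch t).sum_eq_one, mul_one]
      _ ≤ a + ∑ z, p' s x z * b := by
          gcongr with z
          · exact ha x
          · exact (hp'.stoch s).nonneg x z
          · exact hb z
      _ = a + b := by rw [← Finset.sum_mul, (hp'.stoch s).sum_eq_one, one_mul]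
  have hmul : ∀ (s : ℝ≥0) (a : ℝ), (∀ x, ∑ y, |p s x y - p' s x y| ≤ a) → ∀ (n : ℕ) x,
      ∑ y, |p ((n + 1) • s) x y - p' ((n + 1) • s) x y| ≤ (n + 1) * a := by
    intro s a ha n
    induction n with
    | zero => simpa using ha
    | succ n ih =>
      intro x
      rw [succ_nsmul]
      refine (hadd ih ha x).trans (le_of_eq ?_)
      push_cast
      ring
  rcases eq_or_ne t 0 with rfl | ht
  · classical
    ext x y
    by_cases hxy : x = y
    · subst hxy; rw [hp.zero_self, hp'.zero_self]
    · rw [hp.zero_ne hxy, hp'.zero_ne hxy]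
  have ht : 0 < t := pos_iff_ne_zero.2 ht
  have ht' : (0 : ℝ) < t := by exact_mod_cast ht
  have hlim : Tendsto (fun n : ℕ => ∑ x, ∑ y, |(p (t / n) x y - p' (t / n) x y)
      / ((t / n : ℝ≥0) : ℝ)| * t) atTop (𝓝 (∑ x : V, ∑ y : V, |(0 : ℝ)| * t)) :=
    tendsto_finsetSum _ fun x _ => tendsto_finsetSum _ fun y _ =>
      (((h x y).comp (tendsto_div_nat_nhdsGT ht)).abs).mul_const _
  simp only [abs_zero, zero_mul, Finset.sum_const_zero] at hlim
  have hle : ∀ x, ∑ y, |p t x y - p' t x y| ≤ 0 := fun x => by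
    refine ge_of_tendsto hlim ((eventually_gt_atTop 0).mono fun n hn => ?_)
    have hn' : (0 : ℝ) < n := by exact_mod_cast hn
    have hn0 : (n : ℝ≥0) ≠ 0 := by exact_mod_cast hn.ne'
    obtain ⟨m, rfl⟩ : ∃ m, n = m + 1 := ⟨n - 1, by omega⟩
    have h1 := hmul (t / (m + 1 : ℕ)) (∑ x, ∑ y, |p (t / (m + 1 : ℕ)) x y
        - p' (t / (m + 1 : ℕ)) x y|) (fun x => Finset.single_le_sum
          (f := fun x => ∑ y, |p (t / (m + 1 : ℕ)) x y - p' (t / (m + 1 : ℕ)) x y|)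
          (fun x _ => Finset.sum_nonneg fun y _ => abs_nonneg _) (Finset.mem_univ x)) m x
    have e : (m + 1) • (t / (m + 1 : ℕ)) = t := by
      rw [nsmul_eq_mul, mul_div_cancel₀ _ hn0]
    rw [e] at h1
    refine h1.trans (le_of_eq ?_)
    simp only [Finset.mul_sum]
    refine Finset.sum_congr rfl fun x _ => Finset.sum_congr rfl fun y _ => ?_
    have h2 : ((t / (m + 1 : ℕ) : ℝ≥0) : ℝ) = t / (m + 1) := by push_cast; rfl
    rw [abs_div, h2, abs_of_pos (by positivity : (0 : ℝ) < t / (m + 1))]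
    field_simp
  ext x y
  have h3 := (Finset.sum_eq_zero_iff_of_nonneg fun y _ => abs_nonneg _).1
    (le_antisymm (hle x) (Finset.sum_nonneg fun y _ => abs_nonneg _)) y (Finset.mem_univ y)
  exact sub_eq_zero.1 (abs_eq_zero.1 h3)

theorem IsSemigroup.submatrix {p : ℝ≥0 → Matrix V V ℝ} (hp : IsSemigroup p) (g : Equiv.Perm V) :
    IsSemigroup fun t => (p t).submatrix g g where
  stoch t := ⟨fun x y => (hp.stoch t).nonneg _ _, fun x => by
    simp only [Matrix.submatrix_apply]
    rw [Equiv.sum_comp g fun y => p t (g x) y]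
    exact (hp.stoch t).sum_eq_one _⟩
  zero φ := by
    rw [Matrix.submatrix_mulVec_equiv, hp.zero]
    ext x
    simp
  add s t := by rw [hp.add, Matrix.submatrix_mul_equiv]

theorem trans_perm (hP : IsMarkovChain q P) {g : Equiv.Perm V}
    (hg : ∀ a b, a ≠ b → q (g a) (g b) = q a b) (t : ℝ≥0) (x y : V) :
    trans P t (g x) (g y) = trans P t x y := by
  classical
  have hs := trans_semigroup hP
  have h := semigroup_unique (hs.submatrix g) hs (fun x y => ?_) t
  · exact congrFun (congrFun h x) y
  · by_cases hxy : x = y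
    · subst hxy
      have h1 := (tendsto_one_sub_trans_div hP x).sub (tendsto_one_sub_trans_div hP (g x))
      have e : ∑ y ∈ Finset.univ.filter (fun y => y ≠ g x), (q (g x) y : ℝ)
          = ∑ y ∈ Finset.univ.filter (fun y => y ≠ x), (q x y : ℝ) := by
        refine (Finset.sum_bij (fun y _ => g y) (fun y hy => ?_) (fun a _ b _ hab =>
          g.injective hab) (fun y hy => ⟨g.symm y, ?_, by simp⟩) fun y hy => ?_).symm
        · simpa using hy
        · simp only [Finset.mem_filter, Finset.mem_univ, true_and] at hy ⊢
          rintro rfl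
          simp at hy
        · rw [hg x y (by simpa using Ne.symm (Finset.mem_filter.1 hy).2)]
      rw [e, sub_self] at h1
      refine h1.congr fun e => ?_
      simp only [Matrix.submatrix_apply]
      ring
    · have h1 := (hP.rate (g x) (g y) (g.injective.ne hxy)).sub (hP.rate x y hxy)
      rw [hg x y hxy, sub_self] at h1
      refine h1.congr fun e => ?_
      simp only [Matrix.submatrix_apply, trans]
      ring

/-- After a long time the return probabilities at `y` and at `g y` agree by symmetry and are close
to the two stationary weights. -/
theorem weights_perm (hP : IsMarkovChain q P) (hM : IsMixing P π) {g : Equiv.Perm V}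
    (hg : ∀ a b, a ≠ b → q (g a) (g b) = q a b) (y : V) :
    weights π (g y) = weights π y := by
  by_contra hne
  have hpos : 0 < |weights π (g y) - weights π y| := abs_pos.2 (sub_ne_zero.2 hne)
  set δ := |weights π (g y) - weights π y|
  obtain ⟨T, hT⟩ := hM.mixes (min (δ / 5) (1 / 2)) ⟨lt_min (by linarith) (by norm_num),
    (min_le_right _ _).trans_lt (by norm_num)⟩
  have h1 : ∀ x z, |trans P T x z - weights π z| ≤ 2 * (δ / 5) := fun x z => by
    have h2 : 1 / 2 * ∑ y, |trans P T x y - weights π y| ≤ δ / 5 := (hT x).trans (min_le_left _ _)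
    have h3 : |trans P T x z - weights π z| ≤ ∑ y, |trans P T x y - weights π y| :=
      Finset.single_le_sum (f := fun y => |trans P T x y - weights π y|)
        (fun y _ => abs_nonneg _) (Finset.mem_univ z)
    linarith
  have h2 := h1 (g y) (g y)
  have h3 := h1 y y
  rw [trans_perm hP hg] at h2
  have h4 : δ ≤ |trans P T y y - weights π (g y)| + |trans P T y y - weights π y| := by
    have : weights π (g y) - weights π y
      = -(trans P T y y - weights π (g y)) + (trans P T y y - weights π y) := by ring
    calc δ = |-(trans P T y y - weights π (g y)) + (trans P T y y - weights π y)| := by rw [← this]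
      _ ≤ _ := (abs_add_le _ _).trans (by rw [abs_neg])
  linarith

theorem hit₂_perm {p : Matrix V V ℝ} (hp : IsStoch p) {g : Equiv.Perm V}
    (hg : ∀ x y, p (g x) (g y) = p x y) (n : ℕ) (x y : V) :
    hit₂ p n (g x) (g y) = hit₂ p n x y := by
  by_cases hxy : x = y
  · subst hxy; rw [hit₂_self, hit₂_self]
  induction n generalizing x y with
  | zero => rw [hit₂_zero hxy, hit₂_zero (g.injective.ne hxy)]
  | succ n ih =>
    rw [hit₂_succ hp n hxy, hit₂_succ hp n (g.injective.ne hxy), ← Equiv.sum_comp g]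
    refine Finset.sum_congr rfl fun a _ => ?_
    rw [← Equiv.sum_comp g]
    refine Finset.sum_congr rfl fun b _ => ?_
    rw [hg, hg]
    by_cases hab : a = b
    · subst hab; rw [hit₂_self, hit₂_self]
    · rw [ih a b hab]

theorem hitFrom_perm (hP : IsMarkovChain q P) (hM : IsMixing P π) {g : Equiv.Perm V}
    (hg : ∀ a b, a ≠ b → q (g a) (g b) = q a b) {t : ℝ≥0} (ht : 0 < t) (x : V) :
    hitFrom P π t (g x) = hitFrom P π t x := by
  have h1 := tendsto_hitFrom (π := π) hP ht 1 (g x)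
  have h2 := tendsto_hitFrom (π := π) hP ht 1 x
  rw [one_smul] at h1 h2
  refine tendsto_nhds_unique h1 (h2.congr fun n => ?_)
  rw [← Equiv.sum_comp g fun z => weights π z * hit₂ (trans P (t / 2 ^ n)) (1 * 2 ^ n) (g x) z]
  refine Finset.sum_congr rfl fun z _ => ?_
  rw [hit₂_perm ((trans_semigroup hP).stoch _) (trans_perm hP hg _), weights_perm hP hM hg]

theorem hitFrom_eq_of_transitive (hP : IsMarkovChain q P) (hM : IsMixing P π)
    (ht : IsTransitive q) {t : ℝ≥0} (ht0 : 0 < t) (x : V) :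
    hitFrom P π t x = 1 - statSurv P π (diag₂ V) t := by
  have h : ∀ y, hitFrom P π t y = hitFrom P π t x := fun y => by
    obtain ⟨g, rfl, hg⟩ := ht x y
    exact hitFrom_perm hP hM hg ht0 x
  rw [one_sub_statSurv_two]
  simp only [h]
  rw [← Finset.sum_mul, sum_weights, one_mul]

theorem surv_zero (hP : IsMarkovChain q P) (A : Set (Fin k → V)) (x : Fin k → V) :
    surv P A 0 x = Aᶜ.indicator 1 x := by
  have h := tendsto_surv hP A one_pos 0 x
  simp only [zero_mul, zero_smul] at h
  exact tendsto_nhds_unique h tendsto_const_nhds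

/-- By transitivity all weights are positive, so two stationary walkers start apart with positive
probability. Finiteness of the integral is needed too, since `toReal` would turn an infinite mean
into zero. -/
theorem meanMeeting_pos_of_transitive [Nontrivial V] (hP : IsMarkovChain q P) (hM : IsMixing P π)
    (ht : IsTransitive q) : 0 < meanMeeting P π := by
  have hν := sum_prod_pmf (k := 2) π
  have := isProbabilityMeasure_walkersFrom hP hν
  have hw : ∀ x, 0 < weights π x := by
    have h : ∀ x y, weights π y = weights π x := fun x y => by
      obtain ⟨g, rfl, hg⟩ := ht x y
      exact weights_perm hP hM hg x
    intro x
    rcases (weights_nonneg π x).lt_or_eq with h1 | h1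
    · exact h1
    · have h2 := sum_weights π
      simp only [h x, ← h1, Pi.zero_apply, Finset.sum_const_zero] at h2
      exact absurd h2 zero_ne_one
  obtain ⟨x, y, hxy⟩ := exists_pair_ne V
  have h0 : 0 < statSurv P π (diag₂ V) 0 := by
    refine Finset.sum_pos' (fun z _ => mul_nonneg (prodLaw_nonneg (weights_nonneg π) z)
      (surv_nonneg _ _ z)) ⟨![x, y], Finset.mem_univ _, ?_⟩
    rw [surv_zero hP, Set.indicator_of_mem (by simpa [diag₂] using hxy)]
    simpa [prodLaw, Fin.prod_univ_two] using mul_pos (hw x) (hw y)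
  have hT : 0 < tmix P π (1 / 4) := tmix_pos hP hM (by norm_num) (by norm_num)
  have hp := one_sub_statSurv_pos (π := π) hP (1 • tmix P π (1 / 4))
  obtain ⟨a, ha⟩ := exists_tvAt_nsmul_le hP hM (tvAt_tmix_le hP hM ⟨by norm_num, by norm_num⟩)
    (show 0 < (1 - statSurv P π (diag₂ V) (1 • tmix P π (1 / 4))) / 4 by linarith)
  have hfin := lintegral_meetingTime_le hP hT (by omega) hp rfl ha
  refine ENNReal.toReal_pos ?_ (ne_top_of_le_ne_top ENNReal.ofReal_ne_top hfin)
  intro hzero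
  rw [lintegral_eq_zero_iff measurable_meetingTime] at hzero
  have h1 : survFrom P (fun x : Fin 2 → V => ∏ i, π (x i)) 0 = 0 := by
    rw [survFrom, measureReal_eq_zero_iff, measure_eq_zero_iff_ae_notMem]
    filter_upwards [hzero] with w hw hw'
    have := lt_meetingTime_iff.2 hw'
    rw [hw] at this
    simp at this
  rw [survFrom_prod hP, diagAll_two] at h1
  linarith

theorem piMax_pos : 0 < piMax π := by
  by_contra h
  have h1 := sum_weights π
  have h2 : ∑ x, weights π x ≤ 0 :=
    Finset.sum_nonpos fun x _ => (weights_le_piMax x).trans (not_lt.1 h)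
  linarith

end Rates

/-! ### The error parameter and the meeting bound within five mixing times. -/

section Parameters

variable {V : Type u} [Fintype V] {k : ℕ} {q : V → V → ℝ≥0} {P : V → Measure (StepPath V)}
  {π : PMF V}

theorem smallParam_pos [Nontrivial V] (hP : IsMarkovChain q P) (hM : IsMixing P π) :
    0 < smallParam q P π := by
  classical
  have hT : (0 : ℝ) < tmix P π (1 / 4) := tmix_pos hP hM (by norm_num) (by norm_num)
  unfold smallParam
  split_ifs with h
  · exact div_pos hT (meanMeeting_pos_of_transitive hP hM h.2)
  · exact mul_pos (by positivity) piMax_pos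

theorem err_self (c : ℝ) (q : V → V → ℝ≥0) (P : V → Measure (StepPath V)) (π : PMF V) :
    err c c q P π = c * √(smallParam q P π * Real.log (1 / smallParam q P π)) := by
  simp [err]

/-- The constant `c₀ = c₁` for parameters at most `s`. -/
noncomputable def errConst (s : ℝ) : ℝ := 20000 * (1 + 1 / Real.log (1 / s))

theorem log_inv_pos {s : ℝ} (h0 : 0 < s) (h1 : s < 1) : 0 < Real.log (1 / s) :=
  Real.log_pos ((one_lt_div h0).2 h1)

theorem errConst_sq {s : ℝ} (h0 : 0 < s) (h1 : s < 1) :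
    400000000 ≤ errConst s ^ 2 ∧ 400000000 ≤ errConst s ^ 2 * Real.log (1 / s) := by
  have hl := log_inv_pos h0 h1
  set l := Real.log (1 / s) with hldef
  have he : errConst s = 20000 * (1 + 1 / l) := rfl
  have hi : 0 < 1 / l := by positivity
  have hil : 1 / l * l = 1 := by field_simp
  rw [he]
  constructor
  · nlinarith
  · have : (20000 * (1 + 1 / l)) ^ 2 * l
        = 400000000 * (l + 2 * (1 / l * l) + 1 / l * (1 / l * l)) := by ring
    rw [this, hil]
    linarith

/-- For `ρ` between `1 / 4` and `s` the logarithm is at least `log (1 / s)`, so the constant makes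
the error far too large. This is where the dependence on `s` comes from: `log (1 / ρ)` may be close
to zero when `ρ` is close to one. -/
theorem le_quarter_of_err_le {s ρ : ℝ} (h0 : 0 < s) (h1 : s < 1) (hρ : 0 < ρ) (hρs : ρ ≤ s)
    (h : (errConst s * √(ρ * Real.log (1 / ρ))) ^ 2 ≤ 1 / 100) : ρ ≤ 1 / 4 := by
  by_contra hlt
  rw [not_le] at hlt
  have hl := log_inv_pos h0 h1
  have hL : Real.log (1 / s) ≤ Real.log (1 / ρ) :=
    Real.log_le_log (by positivity) (one_div_le_one_div_of_le hρ hρs)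
  have hc := (errConst_sq h0 h1).2
  rw [mul_pow, Real.sq_sqrt (mul_nonneg hρ.le (hl.le.trans hL))] at h
  have h2 : 1 / 4 * Real.log (1 / s) ≤ ρ * Real.log (1 / ρ) := by gcongr
  have h3 := mul_le_mul_of_nonneg_left h2 (sq_nonneg (errConst s))
  nlinarith

theorem one_le_log_inv {ρ : ℝ} (hρ : 0 < ρ) (h : ρ ≤ 1 / 4) : 1 ≤ Real.log (1 / ρ) := by
  rw [Real.le_log_iff_exp_le (by positivity)]
  have h1 := Real.exp_one_lt_d9
  have h2 : 4 ≤ 1 / ρ := by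
    rw [le_div_iff₀ hρ]
    linarith
  linarith

theorem exp_two_le : Real.exp 2 ≤ 8 := by
  have h1 := Real.exp_one_lt_d9
  have h2 : Real.exp 2 = Real.exp 1 * Real.exp 1 := by rw [← Real.exp_add]; norm_num
  rw [h2]
  nlinarith [Real.exp_pos 1]

/-- The bound on the distance halves with each further `tmix (1 / 4)`, so about `2 * log (1 / ρ)`
repetitions bring it below `ρ`. -/
theorem tmix_le_mul_log (hP : IsMarkovChain q P) (hM : IsMixing P π) {ρ a : ℝ} (hρ : 0 < ρ)
    (hρ4 : ρ ≤ 1 / 4) (ha : ρ ≤ a) :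
    (tmix P π a : ℝ) ≤ 4 * Real.log (1 / ρ) * (tmix P π (1 / 4) : ℝ) := by
  have hL := one_le_log_inv hρ hρ4
  set L := Real.log (1 / ρ) with hLdef
  set n := ⌈2 * L⌉₊ with hn
  have hn1 : 2 * L ≤ n := Nat.le_ceil _
  have hn2 : (n : ℝ) < 2 * L + 1 := Nat.ceil_lt_add_one (by linarith)
  have hpow : (1 / 2 : ℝ) ^ n ≤ ρ := by
    have h1 : (1 / 2 : ℝ) ≤ Real.exp (-(1 / 2)) := by
      have := Real.add_one_le_exp (-(1 / 2) : ℝ)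
      linarith
    calc (1 / 2 : ℝ) ^ n ≤ Real.exp (-(1 / 2)) ^ n := by gcongr
      _ = Real.exp (n * (-(1 / 2))) := by rw [Real.exp_nat_mul]
      _ ≤ Real.exp (-L) := Real.exp_le_exp.2 (by linarith)
      _ = ρ := by rw [hLdef, one_div, Real.log_inv, neg_neg, Real.exp_log hρ]
  have h := tmix_le (π := π) (P := P) (a := a) (T := (n + 1) • tmix P π (1 / 4)) fun x => by
    refine (tvAt_nsmul_le hP hM (tvAt_tmix_le hP hM ⟨by norm_num, by norm_num⟩) n x).trans ?_
    have h2 : (2 * (1 / 4) : ℝ) = 1 / 2 := by norm_num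
    rw [h2]
    have h3 : (0 : ℝ) ≤ (1 / 2) ^ n := by positivity
    linarith
  have h' : (tmix P π a : ℝ) ≤ (n + 1) * (tmix P π (1 / 4) : ℝ) := by
    have : (tmix P π a : ℝ) ≤ (((n + 1) • tmix P π (1 / 4) : ℝ≥0) : ℝ) := by exact_mod_cast h
    rw [nsmul_eq_mul] at this
    push_cast at this
    exact this
  refine h'.trans ?_
  gcongr
  linarith

/-- Within five mixing times `tmix (ε ^ 2)` a stationary walker meets any other one with
probability at most `(ε / 1000) ^ 2`. -/
theorem hitFrom_five_tmix_le [Nontrivial V] (hP : IsMarkovChain q P) (hM : IsMixing P π)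
    {c ε : ℝ} (hc : 400000000 ≤ c ^ 2) (hρ4 : smallParam q P π ≤ 1 / 4)
    (hε : ε ^ 2 = c ^ 2 * (smallParam q P π * Real.log (1 / smallParam q P π)))
    (hε1 : ε ^ 2 ≤ 1 / 100) (x : V) :
    hitFrom P π (5 • tmix P π (ε ^ 2)) x ≤ (ε / 1000) ^ 2 := by
  classical
  have hρ := smallParam_pos hP hM
  have hL := one_le_log_inv hρ hρ4
  have hρL : smallParam q P π ≤ smallParam q P π * Real.log (1 / smallParam q P π) :=
    le_mul_of_one_le_right hρ.le hL
  have hρε : smallParam q P π ≤ ε ^ 2 := by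
    rw [hε]
    nlinarith
  have hε0 : 0 < ε ^ 2 := hρ.trans_le hρε
  have hT := tmix_le_mul_log hP hM hρ hρ4 hρε
  have hTpos : 0 < tmix P π (ε ^ 2) := tmix_pos hP hM hε0 (by linarith)
  have h5pos : 0 < 5 • tmix P π (ε ^ 2) := nsmul_pos hTpos (by norm_num)
  have hT4 : (0 : ℝ) < tmix P π (1 / 4) := tmix_pos hP hM (by norm_num) (by norm_num)
  set L := Real.log (1 / smallParam q P π)
  have hL0 : 0 < L := by linarith
  -- The constant `400000000` is `400 * 1000 ^ 2`. The transitive case below needs a number above `4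
  -- * 11 * 4 = 176`, the other case `160`.
  have hscale : 400 * (smallParam q P π * L) ≤ (ε / 1000) ^ 2 := by
    rw [div_pow, hε]
    have := mul_le_mul_of_nonneg_right hc (mul_pos hρ hL0).le
    linarith
  by_cases hrt : IsReversible q π ∧ IsTransitive q
  · have hm := meanMeeting_pos_of_transitive hP hM hrt.2
    have hρeq : smallParam q P π = (tmix P π (1 / 4) : ℝ) / meanMeeting P π := by
      simp only [smallParam, if_pos hrt]
    rw [hitFrom_eq_of_transitive hP hM hrt.2 h5pos]
    by_contra hlt
    rw [not_le] at hlt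
    set p := 1 - statSurv P π (diag₂ V) (5 • tmix P π (ε ^ 2)) with hp
    have hp0 : 0 < p := lt_of_le_of_lt (by positivity) hlt
    -- If `p` exceeded the claimed bound, six mixing times would already suffice for mixing up to `p
    -- / 4`. The mean meeting time would then be at most `4 * 11 * tmix (ε ^ 2) / p`, contradicting
    -- the value of `m` encoded in `ρ`.
    have hmix : ∀ x, tvAt P π x (6 • tmix P π (ε ^ 2)) ≤ p / 4 := fun x => by
      refine (tvAt_nsmul_le hP hM (tvAt_tmix_le hP hM ⟨hε0, by linarith⟩) 5 x).trans ?_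
      have h1 : (2 * ε ^ 2) ^ 5 ≤ (1 / 50) ^ 5 := by
        gcongr
        linarith
      have h2 := mul_le_mul_of_nonneg_right h1 hε0.le
      rw [div_pow] at hlt
      norm_num at h2 hlt ⊢
      linarith
    have hle := lintegral_meetingTime_le hP hTpos (a := 6) (b := 5) (by norm_num) hp0 hp hmix
    have hle' : meanMeeting P π ≤ 4 * ((6 + 5 : ℕ) * (tmix P π (ε ^ 2) : ℝ)) / p := by
      have := ENNReal.toReal_mono ENNReal.ofReal_ne_top hle
      rwa [ENNReal.toReal_ofReal (by positivity)] at this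
    rw [le_div_iff₀ hp0] at hle'
    have h1 : 400 * (smallParam q P π * L) < p := hscale.trans_lt hlt
    have h2 : meanMeeting P π * (400 * (smallParam q P π * L)) < meanMeeting P π * p := by gcongr
    have h3 : meanMeeting P π * (400 * (smallParam q P π * L))
        = 400 * L * (tmix P π (1 / 4) : ℝ) := by
      rw [hρeq]
      field_simp
    have h4 : 0 < L * (tmix P π (1 / 4) : ℝ) := by positivity
    push_cast at hle'
    nlinarith
  · have hρeq : smallParam q P π = (1 + (qMax q : ℝ) * (tmix P π (1 / 4) : ℝ)) * piMax π := by
      simp only [smallParam, if_neg hrt]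
    refine (hitFrom_le_piMax hP hM h5pos x).trans (le_trans ?_ hscale)
    have hq : (0 : ℝ) ≤ qMax q := (qMax q).coe_nonneg
    have hπ := piMax_pos (π := π)
    have h1 : ((5 • tmix P π (ε ^ 2) : ℝ≥0) : ℝ) ≤ 20 * L * (tmix P π (1 / 4) : ℝ) := by
      rw [nsmul_eq_mul]
      push_cast
      linarith
    calc Real.exp 2 * (2 + (qMax q : ℝ) * ((5 • tmix P π (ε ^ 2) : ℝ≥0) : ℝ)) * piMax π
        ≤ 8 * (2 * L + (qMax q : ℝ) * (20 * L * (tmix P π (1 / 4) : ℝ))) * piMax π := by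
          gcongr
          · exact exp_two_le
          · linarith
      _ ≤ 8 * (20 * L + (qMax q : ℝ) * (20 * L * (tmix P π (1 / 4) : ℝ))) * piMax π := by
          gcongr
          norm_num
      _ = 160 * (smallParam q P π * L) := by rw [hρeq]; ring
      _ ≤ 400 * (smallParam q P π * L) := by
          gcongr
          norm_num

end Parameters

end MeanField

/-! ### The theorem: choice of constants and assembly. -/

theorem mainTheorem7 (s : ℝ) (hs : s < 1) :
    ∃ c₀ > (0 : ℝ), ∃ c₁ > (0 : ℝ), ∃ C > (0 : ℝ), ∃ ξ > (0 : ℝ),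
      ∀ (V : Type u) [Fintype V] [Nontrivial V] (q : V → V → ℝ≥0)
        (P : V → Measure (StepPath V)) (π : PMF V),
        IsMarkovChain q P → IsMixing P π → smallParam q P π ≤ s →
        ∀ k : ℕ, 2 ≤ k → err c₀ c₁ q P π ≤ 1 / (10 * (k.choose 2 : ℝ)) →
        ∀ ν : PMF (Fin k → V),
          ∃ a b : ℝ,
            ((k : ℝ) ^ 2 * err c₀ c₁ q P π ≤ ξ →
              |a| ≤ C * ((k : ℝ) ^ 2 * err c₀ c₁ q P π) ∧
              |b| ≤ C * ((k : ℝ) ^ 2 * err c₀ c₁ q P π)) ∧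
            let μ : Measure (Fin k → StepPath V) := walkersFrom P ν
            let r : ℝ := μ.real {w | meetingTime w ≤ (tmix P π (err c₀ c₁ q P π ^ 2) : ℝ≥0∞)}
            let mean : ℝ := meanMeeting P π / (k.choose 2 : ℝ)
            IsNearExp μ meetingTime mean (a + 2 * r) b ∧
            ∫⁻ w, meetingTime w ∂μ ≠ ∞ ∧
            |(∫⁻ w, meetingTime w ∂μ).toReal - mean| ≤ 2 * ((a + 2 * r) + b) * mean := by
  -- Raising `s` to at least `1 / 2` makes `log (1 / s)` meaningful and positive also for `s ≤ 0`.
  have hs0 : 0 < max s (1 / 2) := lt_max_of_lt_right (by norm_num)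
  have hs1 : max s (1 / 2) < 1 := max_lt hs (by norm_num)
  have hc0 : 0 < errConst (max s (1 / 2)) := by
    have := log_inv_pos hs0 hs1
    unfold errConst
    positivity
  refine ⟨errConst (max s (1 / 2)), hc0, errConst (max s (1 / 2)), hc0, 1, one_pos, 1, one_pos, ?_⟩
  intro V _ _ q P π hP hM hρs k hk herr ν
  have hρ := smallParam_pos hP hM
  have hl := one_le_choose hk
  have herr_eq := err_self (errConst (max s (1 / 2))) q P π
  set ε := err (errConst (max s (1 / 2))) (errConst (max s (1 / 2))) q P π with hεdef
  have hε0' : 0 ≤ ε := by rw [herr_eq]; positivity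
  have hlε : (k.choose 2 : ℝ) * ε ≤ 1 / 10 := by
    rw [le_div_iff₀ (by positivity)] at herr
    linarith
  have hε1 : ε ≤ 1 / 10 := by nlinarith
  have hεsq : ε ^ 2 ≤ 1 / 100 := by nlinarith
  have hρ4 := le_quarter_of_err_le hs0 hs1 hρ (hρs.trans (le_max_left _ _)) (by rwa [← herr_eq])
  have hL := one_le_log_inv hρ hρ4
  have hρL : 0 < smallParam q P π * Real.log (1 / smallParam q P π) := mul_pos hρ (by linarith)
  have hε : 0 < ε := by
    rw [herr_eq]
    exact mul_pos hc0 (Real.sqrt_pos.2 hρL)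
  have hε2 : ε ^ 2 = errConst (max s (1 / 2)) ^ 2
      * (smallParam q P π * Real.log (1 / smallParam q P π)) := by
    rw [herr_eq, mul_pow, Real.sq_sqrt hρL.le]
  have hεpos : 0 < ε ^ 2 := by positivity
  set T := tmix P π (ε ^ 2) with hT
  have hT0 : 0 < T := tmix_pos hP hM hεpos (by linarith)
  have hmix : ∀ x, tvAt P π x T ≤ ε ^ 2 := tvAt_tmix_le hP hM ⟨hεpos, by linarith⟩
  have hhit := hitFrom_five_tmix_le hP hM (errConst_sq hs0 hs1).1 hρ4 hε2 hεsq
  -- This fixes the unit `5 • T`: the factor `(2 * ε ^ 2) ^ 4 ≤ (1 / 50) ^ 4` is below `1 / 1000 ^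
  -- 2`, whereas the third power of `1 / 50` is not.
  have hmix5 : ∀ x, tvAt P π x (5 • T) ≤ (ε / 1000) ^ 2 := fun x => by
    refine (tvAt_nsmul_le hP hM hmix 4 x).trans ?_
    have h1 : (2 * ε ^ 2) ^ 4 ≤ (1 / 50) ^ 4 := by
      gcongr
      linarith
    have h2 := mul_le_mul_of_nonneg_right h1 hεpos.le
    rw [div_pow]
    norm_num at h2 ⊢
    linarith
  have h5pos : 0 < 5 • T := nsmul_pos hT0 (by norm_num)
  have hsmall : (ε / 1000) ^ 2 < ε / 1000 := by nlinarith
  obtain ⟨N, hN, hN1, hN2⟩ := exists_window_size hP hM h5pos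
    (fun x => (hmix5 x).trans (by linarith)) (e := ε / 1000) (by linarith)
    ((one_sub_statSurv_le_of_hitFrom hhit).trans_lt hsmall)
  have hW : IsWindow P π (5 • T) (ε / 1000) N :=
    ⟨h5pos, by positivity, hmix5, hhit, hN, hN1, hN2⟩
  have he : 1000 * (ε / 1000) = ε := by ring
  have hexp := hW.nearExp hP hM hk (by linarith) (by rwa [he]) (sum_pmf ν)
  rw [he] at hexp
  have := isProbabilityMeasure_walkersFrom hP (sum_pmf ν)
  -- Both errors are `(k.choose 2) * ε`, so `C = 1` works because `k.choose 2 ≤ k ^ 2`.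
  refine ⟨(k.choose 2 : ℝ) * ε, (k.choose 2 : ℝ) * ε, fun _ => ?_, hexp, hexp.mean⟩
  have h1 : |(k.choose 2 : ℝ) * ε| ≤ 1 * ((k : ℝ) ^ 2 * ε) := by
    rw [abs_of_nonneg (by positivity), one_mul]
    have := choose_le_sq k
    gcongr
  exact ⟨h1, h1⟩
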